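/- **Setting.** Let $b>0$, $g\in\mathbb R$, $0<T\le\infty$, $\mathbb T^2=\mathbb R^2/\mathbb Z^2$, $\Omega=\mathbb T^2\times(-b,0)$, $\Sigma=\mathbb T^2\times\{0\}$, $\Sigma_b=\mathbb T^2\times\{-b\}$. Let $\chi:\overline\Omega\to\mathbb R$ be smooth with $\chi=1$ on $\Sigma$ and $\chi=0$ on $\Sigma_b$, and let $f:\mathbb R^2\times\mathbb R^{2\times2}\to\mathbb R$ be smooth. For $\eta:[0,T)\times\mathbb T^2\to\mathbb R$ let $\mathcal E\eta$ be its harmonic extension, $\mathcal E\eta(t,x)=\sum_{k\in\mathbb Z^2}\hat\eta(t,k)e^{2\pi|k|x_3}e^{2\pi i k\cdot(x_1,x_2)}$, and put $$\Phi(t,x)=x+\chi(x)\,\mathcal E\eta(t,x)\,e_3,\quad J=\det\nabla\Phi,\quad \mathcal A=(\nabla\Phi)^{-T},\quad \nu^{\mathcal A}=J\mathcal A e_3=(-\partial_1\eta,-\partial_2\eta,1)\ \text{on }\Sigma .$$ Write $\partial_i^{\mathcal A}=\mathcal A_{ij}\partial_j$, $\nabla^{\mathcal A}=(\partial_i^{\mathcal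 A})_i$, $\nabla^{\mathcal A}\cdot w=\partial^{\mathcal A}_iw_i$, $(\nabla^{\mathcal A}\cdot M)_i=\partial_j^{\mathcal A}M_{ij}$, $\Delta^{\mathcal A}=\partial_j^{\mathcal A}\partial_j^{\mathcal A}$, $(\mathbb D^{\mathcal A}w)_{ij}=\partial_i^{\mathcal A}w_j+\partial_j^{\mathcal A}w_i$ and $D_t^{u,\mathcal A}=\partial_t-\partial_t\Phi\cdot\nabla^{\mathcal A}+u\cdot\nabla^{\mathcal A}$. Let $\mathcal J\eta=(\nabla\eta,\nabla^2\eta)$, with formal adjoint $\mathcal J^*(P,M)=-\nabla\cdot P+\nabla^2:M$, and put $$\mathcal W(\eta)=\int_{\mathbb T^2}f(\mathcal J\eta),\quad \delta\mathcal W(\eta)=\mathcal J^*(\nabla f(\mathcal J\eta)),\quad (\delta^2\mathcal W(\eta))\phi=\mathcal J^*(\nabla^2f(\mathcal J\eta)\cdot\mathcal J\phi),$$ $$\mathcal Q_\eta(\phi)=\tfrac12\int_{\mathbb T^2}\nabla^2f(\mathcal J\eta)\bullet(\mathcal J\phi\otimes\mathcal J\phi),\qquad \mathcal Q_{\dot\eta}(\phi)=\tfrac12\int_{\mathbb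 T^2}\partial_t\big(\nabla^2f(\mathcal J\eta)\big)\bullet(\mathcal J\phi\otimes\mathcal J\phi).$$ Assume that $\eta$ is of class $C^5$ on $[0,T)\times\mathbb T^2$ and that $J>0$ on $[0,T)\times\overline\Omega$ (so that each $\Phi(t,\cdot)$ is a diffeomorphism). Time derivatives at $t=0$ are one-sided. **Proposition.** (1) *Higher-order energy-dissipation relation.* Let $u:[0,T)\times\overline\Omega\to\mathbb R^3$ be $C^1$ in space at each time, with $$\nabla^{\mathcal A}\cdot u=0\ \text{in }\Omega,\qquad \partial_t\eta=u\cdot\nu^{\mathcal A}\ \text{on }\Sigma,\qquad u=0\ \text{on }\Sigma_b .$$ Let $v:[0,T)\times\overline\Omega\to\mathbb R^3$ be $C^1$ in space-time and $C^2$ in space at each time, $q:[0,T)\times\overline\Omega\to\mathbb R$ be $C^1$ in space at each time, and $\zeta:[0,T)\times\mathbb T^2\to\mathbb R$ be $C^4$. Let $C=(C^1,C^2,C^3,C^4)$, write $T^{\mathcal A}=qI-\mathbb D^{\mathcal A}v$, and suppose that for all $t\in[0,T)$ $$\begin{cases}D_t^{u,\mathcal A}v+\nabla^{\mathcal A}\cdot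 T^{\mathcal A}=C^1&\text{in }\Omega,\\ \nabla^{\mathcal A}\cdot v=C^2&\text{in }\Omega,\\ \big((\delta^2\mathcal W(\eta))\zeta+g\zeta\big)\nu^{\mathcal A}-T^{\mathcal A}\nu^{\mathcal A}=C^3&\text{on }\Sigma,\\ \partial_t\zeta-v\cdot\nu^{\mathcal A}=C^4&\text{on }\Sigma,\\ v=0&\text{on }\Sigma_b.\end{cases}$$ Then the energy below is differentiable in time on $[0,T)$, and for every $t\in[0,T)$ $$\frac{d}{dt}\Big(\int_\Omega\tfrac12|v|^2J+\mathcal Q_\eta(\zeta)+\int_{\mathbb T^2}\tfrac g2|\zeta|^2\Big)+\int_\Omega\tfrac12|\mathbb D^{\mathcal A}v|^2J$$ $$=\mathcal Q_{\dot\eta}(\zeta)+\int_\Omega(C^1\cdot v)J+\int_\Omega C^2qJ+\int_{\mathbb T^2}C^3\cdot v|_\Sigma+\int_{\mathbb T^2}C^4\big((\delta^2\mathcal W(\eta))\zeta+g\zeta\big).$$ (2) *Zeroth-order energy-dissipation relation.* Let $u:[0,T)\times\overline\Omega\to\mathbb R^3$ be $C^1$ in space-time and $C^2$ in space at each time, and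 let $p:[0,T)\times\overline\Omega\to\mathbb R$ be $C^1$ in space at each time. Suppose that for all $t\in[0,T)$ $$\begin{cases}D_t^{u,\mathcal A}u=-\nabla^{\mathcal A}p+\Delta^{\mathcal A}u&\text{in }\Omega,\\ \nabla^{\mathcal A}\cdot u=0&\text{in }\Omega,\\ (pI-\mathbb D^{\mathcal A}u)\nu^{\mathcal A}=(\delta\mathcal W(\eta)+g\eta)\nu^{\mathcal A}&\text{on }\Sigma,\\ \partial_t\eta=u\cdot\nu^{\mathcal A}&\text{on }\Sigma,\\ u=0&\text{on }\Sigma_b.\end{cases}$$ Then the energy below is differentiable in time on $[0,T)$, and for every $t\in[0,T)$ $$\frac{d}{dt}\Big(\int_\Omega\tfrac12|u|^2J+\mathcal W(\eta)+\int_{\mathbb T^2}\tfrac g2|\eta|^2\Big)+\int_\Omega\tfrac12|\mathbb D^{\mathcal A}u|^2J=0.$$ -/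

import Mathlib

open MeasureTheory Set
open scoped ContDiff Matrix

noncomputable section

namespace FreeSurface

/-! Functions on the torus `ℝ² / ℤ²` and on `ℝ² / ℤ² × [-b, 0]` are represented by functions on `ℝ²`
and on `ℝ² × [-b, 0]` that are `1`-periodic in the horizontal variables; integrals over the torus
are taken over one period.  Coordinates are numbered `0, 1` (horizontal) and `2` (vertical). -/

/-- The horizontal plane. -/
abbrev R2 : Type := Fin 2 → ℝ

/-- Three-dimensional space, the last coordinate being the vertical one. -/
abbrev R3 : Type := Fin 3 → ℝ

/-- The space `ℝ² × ℝ^{2 × 2}` in which second-order jets `(∇η, ∇²η)` take values. -/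
abbrev JetSpace : Type := (Fin 2 → ℝ) × (Fin 2 → Fin 2 → ℝ)

/-! ### Domains -/

/-- The time interval `[0, T)`, with `T` finite or infinite. -/
def timeInterval (T : EReal) : Set ℝ := {t | 0 ≤ t ∧ (t : EReal) < T}

/-- The (lifted) equilibrium domain `Ω = {-b < x₃ < 0}`. -/
def slab (b : ℝ) : Set R3 := {x | -b < x 2 ∧ x 2 < 0}

/-- The closure of the (lifted) equilibrium domain. -/
def closedSlab (b : ℝ) : Set R3 := {x | -b ≤ x 2 ∧ x 2 ≤ 0}

/-- One period of the torus `ℝ² / ℤ²`. -/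
def square : Set R2 := {x | ∀ i, 0 ≤ x i ∧ x i < 1}

/-- One horizontal period of `Ω`. -/
def cell (b : ℝ) : Set R3 := {x | (0 ≤ x 0 ∧ x 0 < 1) ∧ (0 ≤ x 1 ∧ x 1 < 1) ∧ -b < x 2 ∧ x 2 < 0}

/-- The point of the plane `x₃ = h` above `y`: the upper boundary `Σ` is `h = 0`, the lower boundary
`Σ_b` is `h = -b`. -/
def atHeight (h : ℝ) (y : R2) : R3 := ![y 0, y 1, h]

/-- The vertical unit vector. -/
def e3 : R3 := ![0, 0, 1]

/-- Horizontal periodicity of a function on the closed slab. -/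
def PeriodicOnSlab {F : Type*} (b : ℝ) (w : R3 → F) : Prop :=
  ∀ x ∈ closedSlab b, w (x + Pi.single 0 1) = w x ∧ w (x + Pi.single 1 1) = w x

/-- Periodicity of a function on the plane. -/
def PeriodicOnPlane {F : Type*} (w : R2 → F) : Prop :=
  ∀ x, w (x + Pi.single 0 1) = w x ∧ w (x + Pi.single 1 1) = w x

/-! ### Derivatives -/

/-- Horizontal partial derivative `∂_i` of a function on the plane. -/
def hpartial (i : Fin 2) (h : R2 → ℝ) (x : R2) : ℝ := fderiv ℝ h x (Pi.single i 1)

/-- Partial derivative `∂_i` of a function on the closed slab (one-sided on its boundary). -/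
def spartial (b : ℝ) (i : Fin 3) (h : R3 → ℝ) (x : R3) : ℝ :=
  fderivWithin ℝ h (closedSlab b) x (Pi.single i 1)

/-- Time derivative on the interval `[0, T)` (one-sided at the initial time). -/
def tpartial {F : Type*} [NormedAddCommGroup F] [NormedSpace ℝ F] (T : EReal) (w : ℝ → F) (t : ℝ) :
    F := derivWithin w (timeInterval T) t

/-! ### Harmonic extension and flattening map -/

/-- Fourier coefficient of a function on the torus `ℝ² / ℤ²`. -/
def fourierCoeffTorus (h : R2 → ℝ) (k : Fin 2 → ℤ) : ℂ :=
  ∫ y in square, (h y : ℂ) *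
    Complex.exp (-(2 * Real.pi * Complex.I * (((k 0 : ℝ) * y 0 + (k 1 : ℝ) * y 1 : ℝ) : ℂ)))

/-- Harmonic extension to the lower half-space,
`(𝓔 h)(x) = ∑ₖ ĥ(k) exp (2π |k| x₃) exp (2π i k ⬝ (x₁, x₂))`; the sum is real for real `h`. -/
def harmExt (h : R2 → ℝ) (x : R3) : ℝ :=
  (∑' k : Fin 2 → ℤ, fourierCoeffTorus h k *
    Complex.exp ((2 * Real.pi * Real.sqrt ((k 0 : ℝ) ^ 2 + (k 1 : ℝ) ^ 2) * x 2 : ℝ) : ℂ) *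
    Complex.exp (2 * Real.pi * Complex.I * (((k 0 : ℝ) * x 0 + (k 1 : ℝ) * x 1 : ℝ) : ℂ))).re

/-- Admissible cutoffs: smooth on the closed slab, equal to `1` on `Σ` and to `0` on `Σ_b`. -/
structure IsCutoff (b : ℝ) (χ : R3 → ℝ) : Prop where
  smooth : ContDiffOn ℝ ∞ χ (closedSlab b)
  periodic : PeriodicOnSlab b χ
  top : ∀ y, χ (atHeight 0 y) = 1
  bottom : ∀ y, χ (atHeight (-b) y) = 0

/-- The flattening map `Φ = id + χ (𝓔 η) e₃`. -/
def flattening (χ : R3 → ℝ) (η : R2 → ℝ) (x : R3) : R3 := x + (χ x * harmExt η x) • e3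

/-- The matrix `(∇Φ)_{ij} = ∂_j Φ_i`. -/
def gradFlattening (b : ℝ) (χ : R3 → ℝ) (η : R2 → ℝ) (x : R3) : Matrix (Fin 3) (Fin 3) ℝ :=
  Matrix.of fun i j => spartial b j (fun y => flattening χ η y i) x

/-- `J = det ∇Φ`. -/
def jac (b : ℝ) (χ : R3 → ℝ) (η : R2 → ℝ) (x : R3) : ℝ := (gradFlattening b χ η x).det

/-- `𝒜 = (∇Φ)^{-T}`. -/
def geo (b : ℝ) (χ : R3 → ℝ) (η : R2 → ℝ) (x : R3) : Matrix (Fin 3) (Fin 3) ℝ :=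
  ((gradFlattening b χ η x)⁻¹)ᵀ

/-- The normal `ν^𝒜 = (J 𝒜) e₃` on the upper boundary, as a function of the horizontal position. -/
def nuA (b : ℝ) (χ : R3 → ℝ) (η : R2 → ℝ) (y : R2) : R3 :=
  (jac b χ η (atHeight 0 y) • geo b χ η (atHeight 0 y)) *ᵥ e3

/-! ### Differential operators with geometric coefficients -/

/-- `∂_i^𝒜 = 𝒜_{ij} ∂_j`. -/
def partialA (b : ℝ) (χ : R3 → ℝ) (η : R2 → ℝ) (i : Fin 3) (h : R3 → ℝ) (x : R3) : ℝ :=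
  ∑ j, geo b χ η x i j * spartial b j h x

/-- `∇^𝒜 ⬝ w = ∂_i^𝒜 w_i`. -/
def divA (b : ℝ) (χ : R3 → ℝ) (η : R2 → ℝ) (w : R3 → R3) (x : R3) : ℝ :=
  ∑ i, partialA b χ η i (fun y => w y i) x

/-- `(𝔻^𝒜 w)_{ij} = ∂_i^𝒜 w_j + ∂_j^𝒜 w_i`. -/
def symGradA (b : ℝ) (χ : R3 → ℝ) (η : R2 → ℝ) (w : R3 → R3) (x : R3) :
    Matrix (Fin 3) (Fin 3) ℝ :=
  Matrix.of fun i j => partialA b χ η i (fun y => w y j) x + partialA b χ η j (fun y => w y i) x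

/-- The stress tensor `q I - 𝔻^𝒜 w`. -/
def stressA (b : ℝ) (χ : R3 → ℝ) (η : R2 → ℝ) (w : R3 → R3) (q : R3 → ℝ) (x : R3) :
    Matrix (Fin 3) (Fin 3) ℝ :=
  q x • (1 : Matrix (Fin 3) (Fin 3) ℝ) - symGradA b χ η w x

/-- `(∇^𝒜 ⬝ M)_i = ∂_j^𝒜 M_{ij}` for a matrix field `M`. -/
def matDivA (b : ℝ) (χ : R3 → ℝ) (η : R2 → ℝ) (M : R3 → Matrix (Fin 3) (Fin 3) ℝ) (x : R3) : R3 :=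
  fun i => ∑ j, partialA b χ η j (fun y => M y i j) x

/-- `∇^𝒜 q`. -/
def gradA (b : ℝ) (χ : R3 → ℝ) (η : R2 → ℝ) (q : R3 → ℝ) (x : R3) : R3 :=
  fun i => partialA b χ η i q x

/-- `Δ^𝒜 w = ∇^𝒜 ⬝ ∇^𝒜 w`, componentwise. -/
def lapA (b : ℝ) (χ : R3 → ℝ) (η : R2 → ℝ) (w : R3 → R3) (x : R3) : R3 :=
  fun i => ∑ j, partialA b χ η j (fun y => partialA b χ η j (fun z => w z i) y) x

/-- `(a ⬝ ∇^𝒜) w` for a vector `a`. -/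
def advectA (b : ℝ) (χ : R3 → ℝ) (η : R2 → ℝ) (a : R3) (w : R3 → R3) (x : R3) : R3 :=
  fun i => ∑ j, a j * partialA b χ η j (fun y => w y i) x

/-- `D_t^{u,𝒜} w = ∂_t w - (∂_t Φ) ⬝ ∇^𝒜 w + u ⬝ ∇^𝒜 w`. -/
def materialA (b : ℝ) (χ : R3 → ℝ) (T : EReal) (η : ℝ → R2 → ℝ) (u w : ℝ → R3 → R3) (t : ℝ)
    (x : R3) : R3 :=
  tpartial T (fun s => w s x) t
    - advectA b χ (η t) (tpartial T (fun s => flattening χ (η s) x) t) (w t) x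
    + advectA b χ (η t) (u t x) (w t) x

/-! ### Surface energy -/

/-- The jet `𝒥 η = (∇η, ∇²η)`. -/
def jet (η : R2 → ℝ) (x : R2) : JetSpace :=
  (fun i => hpartial i η x, fun i j => hpartial i (hpartial j η) x)

/-- The formal adjoint of the jet, `𝒥^* (P, M) = -∇ ⬝ P + ∇² : M`. -/
def jetAdj (G : R2 → JetSpace) (x : R2) : ℝ :=
  -(∑ i, hpartial i (fun y => (G y).1 i) x)
    + ∑ i, ∑ j, hpartial i (hpartial j (fun y => (G y).2 i j)) x

/-- The element of `ℝ² × ℝ^{2 × 2}` that represents a linear functional through the standard inner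
product, that is, the coordinates of the functional. -/
def coords (l : JetSpace →L[ℝ] ℝ) : JetSpace :=
  (fun i => l (Pi.single i 1, 0), fun i j => l (0, Pi.single i (Pi.single j 1)))

/-- The Hessian `∇² f` as a bilinear form. -/
def hess (f : JetSpace → ℝ) (w : JetSpace) : JetSpace →L[ℝ] JetSpace →L[ℝ] ℝ :=
  fderiv ℝ (fderiv ℝ f) w

/-- The surface energy `𝒲(η) = ∫ f(𝒥η)`. -/
def surfEnergy (f : JetSpace → ℝ) (η : R2 → ℝ) : ℝ := ∫ y in square, f (jet η y)

/-- The first variation `δ𝒲(η) = 𝒥^* (∇f (𝒥η))`. -/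
def firstVar (f : JetSpace → ℝ) (η : R2 → ℝ) (x : R2) : ℝ :=
  jetAdj (fun y => coords (fderiv ℝ f (jet η y))) x

/-- The second variation `(δ²𝒲(η)) φ = 𝒥^* (∇²f (𝒥η) ⬝ 𝒥φ)`. -/
def secondVar (f : JetSpace → ℝ) (η φ : R2 → ℝ) (x : R2) : ℝ :=
  jetAdj (fun y => coords (hess f (jet η y) (jet φ y))) x

/-- The quadratic approximation `𝒬_η(φ) = ½ ∫ ∇²f (𝒥η) • (𝒥φ ⊗ 𝒥φ)`. -/
def quadW (f : JetSpace → ℝ) (η φ : R2 → ℝ) : ℝ :=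
  1 / 2 * ∫ y in square, hess f (jet η y) (jet φ y) (jet φ y)

/-- `𝒬_{η̇}(φ) = ½ ∫ ∂_t (∇²f (𝒥η)) • (𝒥φ ⊗ 𝒥φ)` at time `t`; the argument `φ` is not
differentiated. -/
def quadWdot (f : JetSpace → ℝ) (T : EReal) (η : ℝ → R2 → ℝ) (t : ℝ) (φ : R2 → ℝ) : ℝ :=
  1 / 2 * ∫ y in square, tpartial T (fun s => hess f (jet (η s) y)) t (jet φ y) (jet φ y)

/-! ### Energies, dissipation, pairing -/

/-- `½ ∫_Ω |w|² J(η)`. -/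
def kinetic (b : ℝ) (χ : R3 → ℝ) (η : R2 → ℝ) (w : R3 → R3) : ℝ :=
  ∫ x in cell b, 1 / 2 * (w x ⬝ᵥ w x) * jac b χ η x

/-- `∫_{𝕋²} (g/2) |ζ|²`. -/
def potential (g : ℝ) (ζ : R2 → ℝ) : ℝ := ∫ y in square, g / 2 * ζ y ^ 2

/-- The zeroth-order energy `½ ∫_Ω |u|² J(η) + 𝒲(η) + ∫ (g/2) |η|²`. -/
def energyZero (b g : ℝ) (χ : R3 → ℝ) (f : JetSpace → ℝ) (u : R3 → R3) (η : R2 → ℝ) : ℝ :=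
  kinetic b χ η u + surfEnergy f η + potential g η

/-- The energy `½ ∫_Ω |v|² J(η) + 𝒬_η(ζ) + ∫ (g/2) |ζ|²`. -/
def energy (b g : ℝ) (χ : R3 → ℝ) (f : JetSpace → ℝ) (η : R2 → ℝ) (v : R3 → R3) (ζ : R2 → ℝ) : ℝ :=
  kinetic b χ η v + quadW f η ζ + potential g ζ

/-- The dissipation `½ ∫_Ω |𝔻^{𝒜(η)} w|² J(η)`. -/
def dissipation (b : ℝ) (χ : R3 → ℝ) (η : R2 → ℝ) (w : R3 → R3) : ℝ :=
  ∫ x in cell b, 1 / 2 * (∑ i, ∑ j, symGradA b χ η w x i j ^ 2) * jac b χ η x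

/-- The pairing `⟨C, Y⟩_{X₀}` at time `t`, with `C = (C1, C2, C3, C4)` taken at that time. -/
def pairing (b g : ℝ) (χ : R3 → ℝ) (f : JetSpace → ℝ) (T : EReal) (η : ℝ → R2 → ℝ) (t : ℝ)
    (v : R3 → R3) (q : R3 → ℝ) (ζ : R2 → ℝ)
    (C1 : R3 → R3) (C2 : R3 → ℝ) (C3 : R2 → R3) (C4 : R2 → ℝ) : ℝ :=
  quadWdot f T η t ζ
    + (∫ x in cell b, (C1 x ⬝ᵥ v x) * jac b χ (η t) x)
    + (∫ x in cell b, C2 x * q x * jac b χ (η t) x)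
    + (∫ y in square, C3 y ⬝ᵥ v (atHeight 0 y))
    + (∫ y in square, C4 y * (secondVar f (η t) ζ y + g * ζ y))

/-! ### Regularity classes and systems of equations -/

/-- Surface elevations of class `C^n` on `[0, T) × 𝕋²`. -/
structure RegularElevation (T : EReal) (n : ℕ) (η : ℝ → R2 → ℝ) : Prop where
  periodic : ∀ t ∈ timeInterval T, PeriodicOnPlane (η t)
  contDiff : ContDiffOn ℝ n (fun z : ℝ × R2 => η z.1 z.2) (timeInterval T ×ˢ univ)

/-- Time-dependent fields on `Ω` that are of class `C^n` in space, up to the boundary, at each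
time. -/
structure SpatiallyRegular {F : Type*} [NormedAddCommGroup F] [NormedSpace ℝ F]
    (b : ℝ) (T : EReal) (n : ℕ) (w : ℝ → R3 → F) : Prop where
  periodic : ∀ t ∈ timeInterval T, PeriodicOnSlab b (w t)
  contDiff : ∀ t ∈ timeInterval T, ContDiffOn ℝ n (w t) (closedSlab b)

/-- Velocities of class `C¹` in space-time and `C²` in space, up to the boundary. -/
structure RegularVelocity (b : ℝ) (T : EReal) (w : ℝ → R3 → R3) : Prop where
  spatial : SpatiallyRegular b T 2 w
  contDiff : ContDiffOn ℝ 1 (fun z : ℝ × R3 => w z.1 z.2) (timeInterval T ×ˢ closedSlab b)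

/-- `J(η) > 0` up to the boundary at all times, so that `Φ(t, ⬝)` is a diffeomorphism. -/
def NonDegenerate (b : ℝ) (χ : R3 → ℝ) (T : EReal) (η : ℝ → R2 → ℝ) : Prop :=
  ∀ t ∈ timeInterval T, ∀ x ∈ closedSlab b, 0 < jac b χ (η t) x

/-- The kinematic part of the free boundary problem for `(u, η)`: incompressibility, advection of
the free surface and no-slip condition. -/
structure SolvesKinematic (b : ℝ) (χ : R3 → ℝ) (T : EReal) (u : ℝ → R3 → R3) (η : ℝ → R2 → ℝ) :
    Prop where
  incompressible : ∀ t ∈ timeInterval T, ∀ x ∈ slab b, divA b χ (η t) (u t) x = 0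
  advection : ∀ t ∈ timeInterval T, ∀ y,
    tpartial T (fun s => η s y) t = u t (atHeight 0 y) ⬝ᵥ nuA b χ (η t) y
  no_slip : ∀ t ∈ timeInterval T, ∀ y, u t (atHeight (-b) y) = 0

/-- The free boundary Navier-Stokes system for `(u, p, η)` in the fixed domain. -/
structure SolvesNS (b g : ℝ) (χ : R3 → ℝ) (f : JetSpace → ℝ) (T : EReal)
    (u : ℝ → R3 → R3) (p : ℝ → R3 → ℝ) (η : ℝ → R2 → ℝ) : Prop where
  momentum : ∀ t ∈ timeInterval T, ∀ x ∈ slab b,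
    materialA b χ T η u u t x = -gradA b χ (η t) (p t) x + lapA b χ (η t) (u t) x
  kinematic : SolvesKinematic b χ T u η
  dynamic : ∀ t ∈ timeInterval T, ∀ y,
    stressA b χ (η t) (u t) (p t) (atHeight 0 y) *ᵥ nuA b χ (η t) y
      = (firstVar f (η t) y + g * η t y) • nuA b χ (η t) y

/-- The linear system `L_{X₀}(Y) = C` for `Y = (v, q, ζ)`, with coefficients built from `(u, η)` and
data `C = (C1, C2, C3, C4)`. -/
structure SolvesLinear (b g : ℝ) (χ : R3 → ℝ) (f : JetSpace → ℝ) (T : EReal)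
    (u : ℝ → R3 → R3) (η : ℝ → R2 → ℝ)
    (v : ℝ → R3 → R3) (q : ℝ → R3 → ℝ) (ζ : ℝ → R2 → ℝ)
    (C1 : ℝ → R3 → R3) (C2 : ℝ → R3 → ℝ) (C3 : ℝ → R2 → R3) (C4 : ℝ → R2 → ℝ) : Prop where
  momentum : ∀ t ∈ timeInterval T, ∀ x ∈ slab b,
    materialA b χ T η u v t x + matDivA b χ (η t) (stressA b χ (η t) (v t) (q t)) x = C1 t x
  divergence : ∀ t ∈ timeInterval T, ∀ x ∈ slab b, divA b χ (η t) (v t) x = C2 t x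
  dynamic : ∀ t ∈ timeInterval T, ∀ y,
    (secondVar f (η t) (ζ t) y + g * ζ t y) • nuA b χ (η t) y
      - stressA b χ (η t) (v t) (q t) (atHeight 0 y) *ᵥ nuA b χ (η t) y = C3 t y
  kinematic : ∀ t ∈ timeInterval T, ∀ y,
    tpartial T (fun s => ζ s y) t - v t (atHeight 0 y) ⬝ᵥ nuA b χ (η t) y = C4 t y
  no_slip : ∀ t ∈ timeInterval T, ∀ y, v t (atHeight (-b) y) = 0

end FreeSurface

end

/-!
The proof is a computation in the moving domain, carried out in the flattened coordinates, together
with the regularity up to the boundary that makes each step legitimate.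

Geometry. With `θ = χ (𝓔 η)` one has `J = 1 + ∂₃θ`, and the entries of `J 𝒜` are affine in `∇θ`.
Hence the rows of `J 𝒜` are divergence free (`RegularFlattening.piola`), so `J ∇^𝒜 ⬝ X` is the
divergence of `(J 𝒜)ᵀ X` and Gauss' theorem on one period (`integral_cell_divergence`) applies; and
the operators `∂ᵢ^𝒜` commute (`RegularFlattening.partialA_comm`), which turns the viscous term
`Δ^𝒜 u` of a divergence-free field into the divergence of the stress.

Bulk. With `w = ∂ₜΦ - u`, the material derivative of `v` is `∂ₜv - w ⬝ ∇^𝒜 v`, and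
`J ∇^𝒜 ⬝ w = ∂ₜJ` because `u` is divergence free. The product rule then writes `∂ₜ(½ |v|² J)` plus
the dissipation density as the work of the data plus `J ∇^𝒜 ⬝ (½ |v|² w - T^𝒜 v)`
(`RegularFlattening.local_energy_balance`). The flux vanishes at the bottom, where `v = 0`; at the
top `w ⬝ ν^𝒜 = ∂ₜη - u ⬝ ν^𝒜 = 0`, so that only the work of the stress remains
(`bulk_energy_balance`).

Surface. `𝒥` and `𝒥^*` are adjoint on the torus (`integral_apply_jet`), and time and space
derivatives of `η` commute; differentiating `𝒲` and `𝒬` under the integral produces the first and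
the second variation tested against the velocity of the surface (`hasDerivWithinAt_surfEnergy`,
`hasDerivWithinAt_quadW`). The boundary conditions identify this with the work of the stress.

Regularity. Fourier coefficients of `C^m` functions on the torus are `O((1 + |k|)^{-m})`, and in two
dimensions `(1 + |k|)^{-3}` is summable. So the harmonic extension of a `C⁵` function is `C²` up to
the boundary, that of `∂ₜη ∈ C⁴` is `C¹`, and `∂ₜ` may be taken term by term. In order to work with
ordinary derivatives at the boundary, the modes are continued smoothly, with bounded derivatives,
beyond `x₃ = 0` (`fullExt`). Fourier inversion gives the trace `𝓔 η = η` on the upper boundary.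
-/

noncomputable section

namespace FreeSurface

open Filter Topology

/-! ### Differentiation under integrals and sums along a set of times -/

/-- Differentiation under the integral sign along a set `I` of times, possibly at an end point of
`I`; the domination is required only on a convex neighbourhood `K` of `t` in `I`. -/
theorem hasDerivWithinAt_integral_of_dominated {α E : Type*} [MeasurableSpace α] {μ : Measure α}
    [NormedAddCommGroup E] [NormedSpace ℝ E] {I K : Set ℝ} {t : ℝ}
    {F F' : ℝ → α → E} {bound : α → ℝ} (hK : Convex ℝ K) (hKI : K ⊆ I) (hnhds : K ∈ 𝓝[I] t)
    (ht : t ∈ K) (hF : ∀ s ∈ K, Integrable (F s) μ) (hbound : Integrable bound μ)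
    (hderiv : ∀ᵐ a ∂μ, ∀ s ∈ K, HasDerivWithinAt (fun r => F r a) (F' s a) I s)
    (hle : ∀ᵐ a ∂μ, ∀ s ∈ K, ‖F' s a‖ ≤ bound a) :
    HasDerivWithinAt (fun s => ∫ a, F s a ∂μ) (∫ a, F' t a ∂μ) I t := by
  have hset : I \ {t} ∩ K = K \ {t} := by
    ext x; simp only [mem_inter_iff, Set.mem_sdiff]
    exact ⟨fun h => ⟨h.2, h.1.2⟩, fun h => ⟨⟨hKI h.1, h.2⟩, h.1⟩⟩
  refine HasDerivWithinAt.mono_of_mem_nhdsWithin (t := K) ?_ hnhds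
  rw [hasDerivWithinAt_iff_tendsto_slope]
  have hev : ∀ᶠ s in 𝓝[K \ {t}] t, s ∈ K \ {t} := self_mem_nhdsWithin
  have hslope : ∀ s ∈ K, slope (fun s => ∫ a, F s a ∂μ) t s
      = ∫ a, slope (fun r => F r a) t s ∂μ := by
    intro s hs
    simp only [slope_def_module]
    rw [integral_smul, integral_sub (hF s hs) (hF t ht)]
  have key : Tendsto (fun s => ∫ a, slope (fun r => F r a) t s ∂μ) (𝓝[K \ {t}] t)
      (𝓝 (∫ a, F' t a ∂μ)) := by
    refine tendsto_integral_filter_of_dominated_convergence bound ?_ ?_ hbound ?_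
    · filter_upwards [hev] with s hs
      simp only [slope_def_module]
      exact (((hF s hs.1).sub (hF t ht)).smul _).aestronglyMeasurable
    -- the mean value inequality on `K` bounds the difference quotients
    · filter_upwards [hev] with s hs
      filter_upwards [hderiv, hle] with a h1 h2
      have h3 := Convex.norm_image_sub_le_of_norm_hasDerivWithin_le
        (fun x hx => (h1 x hx).mono hKI) (fun x hx => h2 x hx) hK ht hs.1
      have hne : 0 < ‖s - t‖ := norm_pos_iff.2 (sub_ne_zero.2 hs.2)
      rw [slope_def_module, norm_smul, norm_inv, inv_mul_le_iff₀ hne, mul_comm]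
      exact h3
    · filter_upwards [hderiv] with a h1
      exact hasDerivWithinAt_iff_tendsto_slope.1 ((h1 t ht).mono hKI)
  refine key.congr' ?_
  filter_upwards [hev] with s hs
  exact (hslope s hs.1).symm

/-- The analogue of `hasDerivWithinAt_integral_of_dominated` for series. -/
theorem hasDerivWithinAt_tsum_of_dominated {β E : Type*}
    [NormedAddCommGroup E] [NormedSpace ℝ E] [CompleteSpace E] {I K : Set ℝ} {t : ℝ}
    {F F' : ℝ → β → E} {bound : β → ℝ} (hK : Convex ℝ K) (hKI : K ⊆ I) (hnhds : K ∈ 𝓝[I] t)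
    (ht : t ∈ K) (hF : ∀ s ∈ K, Summable (F s)) (hbound : Summable bound)
    (hderiv : ∀ a, ∀ s ∈ K, HasDerivWithinAt (fun r => F r a) (F' s a) I s)
    (hle : ∀ a, ∀ s ∈ K, ‖F' s a‖ ≤ bound a) :
    HasDerivWithinAt (fun s => ∑' a, F s a) (∑' a, F' t a) I t := by
  refine HasDerivWithinAt.mono_of_mem_nhdsWithin (t := K) ?_ hnhds
  rw [hasDerivWithinAt_iff_tendsto_slope]
  have hev : ∀ᶠ s in 𝓝[K \ {t}] t, s ∈ K \ {t} := self_mem_nhdsWithin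
  have hslope : ∀ s ∈ K, slope (fun s => ∑' a, F s a) t s
      = ∑' a, slope (fun r => F r a) t s := by
    intro s hs
    simp only [slope_def_module]
    rw [Summable.tsum_const_smul _ ((hF s hs).sub (hF t ht)), (hF s hs).tsum_sub (hF t ht)]
  have key : Tendsto (fun s => ∑' a, slope (fun r => F r a) t s) (𝓝[K \ {t}] t)
      (𝓝 (∑' a, F' t a)) := by
    refine tendsto_tsum_of_dominated_convergence hbound ?_ ?_
    · intro a
      exact hasDerivWithinAt_iff_tendsto_slope.1 ((hderiv a t ht).mono hKI)
    · filter_upwards [hev] with s hs a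
      have h3 := Convex.norm_image_sub_le_of_norm_hasDerivWithin_le
        (fun x hx => (hderiv a x hx).mono hKI) (fun x hx => hle a x hx) hK ht hs.1
      have hne : 0 < ‖s - t‖ := norm_pos_iff.2 (sub_ne_zero.2 hs.2)
      rw [slope_def_module, norm_smul, norm_inv, inv_mul_le_iff₀ hne, mul_comm]
      exact h3
  refine key.congr' ?_
  filter_upwards [hev] with s hs
  exact (hslope s hs.1).symm

/-! ### The time interval and the slab -/

theorem convex_timeInterval (T : EReal) : Convex ℝ (timeInterval T) := by
  rw [convex_iff_ordConnected]
  refine ⟨fun x hx y hy z hz => ⟨hx.1.trans hz.1, lt_of_le_of_lt ?_ hy.2⟩⟩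
  exact_mod_cast hz.2

theorem exists_gt_mem_timeInterval {T : EReal} {t : ℝ} (ht : t ∈ timeInterval T) :
    ∃ t₁ ∈ timeInterval T, t < t₁ := by
  obtain ⟨r, h1, h2⟩ := EReal.lt_iff_exists_real_btwn.1 ht.2
  have h1' : t < r := by exact_mod_cast h1
  exact ⟨r, ⟨ht.1.trans h1'.le, h2⟩, h1'⟩

theorem zero_mem_timeInterval {T : EReal} (hT : 0 < T) : (0 : ℝ) ∈ timeInterval T :=
  ⟨le_rfl, by simpa using hT⟩

theorem Icc_subset_timeInterval {T : EReal} {t₁ : ℝ} (h : t₁ ∈ timeInterval T) :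
    Icc 0 t₁ ⊆ timeInterval T := fun s hs => ⟨hs.1, lt_of_le_of_lt (by exact_mod_cast hs.2) h.2⟩

theorem Icc_mem_nhdsWithin_timeInterval {T : EReal} {t t₁ : ℝ} (h : t < t₁) :
    Icc 0 t₁ ∈ 𝓝[timeInterval T] t := by
  filter_upwards [self_mem_nhdsWithin, mem_nhdsWithin_of_mem_nhds (Iio_mem_nhds h)] with s h1 h2
  exact ⟨h1.1, le_of_lt h2⟩

theorem interior_timeInterval_nonempty {T : EReal} (hT : 0 < T) :
    (interior (timeInterval T)).Nonempty := by
  obtain ⟨t₁, h1, h2⟩ := exists_gt_mem_timeInterval (zero_mem_timeInterval hT)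
  refine ⟨t₁ / 2, interior_mono (Icc_subset_timeInterval h1) ?_⟩
  rw [interior_Icc]
  exact ⟨by linarith, by linarith⟩

theorem uniqueDiffOn_timeInterval {T : EReal} (hT : 0 < T) : UniqueDiffOn ℝ (timeInterval T) :=
  uniqueDiffOn_convex (convex_timeInterval T) (interior_timeInterval_nonempty hT)

theorem convex_closedSlab (b : ℝ) : Convex ℝ (closedSlab b) := by
  intro x hx y hy p q hp hq hpq
  simp only [closedSlab, mem_ofPred_eq, Pi.add_apply, Pi.smul_apply, smul_eq_mul] at *
  constructor <;> nlinarith [hx.1, hx.2, hy.1, hy.2, mul_le_mul_of_nonneg_left hx.1 hp,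
    mul_le_mul_of_nonneg_left hy.1 hq, mul_nonneg hp (neg_nonneg.2 hx.2),
    mul_nonneg hq (neg_nonneg.2 hy.2)]

theorem isOpen_slab (b : ℝ) : IsOpen (slab b) :=
  (isOpen_lt continuous_const (continuous_apply 2)).inter
    (isOpen_lt (continuous_apply 2) continuous_const)

theorem slab_subset_closedSlab (b : ℝ) : slab b ⊆ closedSlab b := fun _ h => ⟨h.1.le, h.2.le⟩

theorem closedSlab_mem_nhds {b : ℝ} {x : R3} (hx : x ∈ slab b) : closedSlab b ∈ 𝓝 x :=
  mem_of_superset ((isOpen_slab b).mem_nhds hx) (slab_subset_closedSlab b)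

theorem slab_nonempty {b : ℝ} (hb : 0 < b) : (slab b).Nonempty :=
  ⟨![0, 0, -b / 2], by constructor <;> simp <;> linarith⟩

theorem uniqueDiffOn_closedSlab {b : ℝ} (hb : 0 < b) : UniqueDiffOn ℝ (closedSlab b) :=
  uniqueDiffOn_convex (convex_closedSlab b) ((slab_nonempty hb).mono
    (interior_maximal (slab_subset_closedSlab b) (isOpen_slab b)))

theorem cell_subset_slab (b : ℝ) : cell b ⊆ slab b := fun _ h => h.2.2

theorem atHeight_zero_mem {b : ℝ} (hb : 0 < b) (y : R2) : atHeight 0 y ∈ closedSlab b := by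
  simp [atHeight, closedSlab, hb.le]

/-! ### Time and space derivatives of functions on space-time -/

section SpaceTime

variable {X F : Type*} [NormedAddCommGroup X] [NormedSpace ℝ X] [NormedAddCommGroup F]
  [NormedSpace ℝ F] {T : EReal} {s : Set X}

/-- Along `[0, T)`, the time derivative of a differentiable function on space-time is the value of
its differential at the time direction. -/
theorem hasDerivWithinAt_time {G : ℝ × X → F} {t : ℝ} {x : X}
    (hG : DifferentiableWithinAt ℝ G (timeInterval T ×ˢ s) (t, x)) (hx : x ∈ s) :
    HasDerivWithinAt (fun r => G (r, x)) (fderivWithin ℝ G (timeInterval T ×ˢ s) (t, x) (1, 0))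
      (timeInterval T) t := by
  have h2 : HasDerivWithinAt (fun r : ℝ => ((r, x) : ℝ × X)) ((1 : ℝ), (0 : X))
      (timeInterval T) t :=
    (hasDerivWithinAt_id t _).prodMk (hasDerivWithinAt_const t _ x)
  exact hG.hasFDerivWithinAt.comp_hasDerivWithinAt t h2
    (fun r hr => mk_mem_prod hr hx)

theorem hasFDerivWithinAt_space {G : ℝ × X → F} {t : ℝ} {x : X}
    (hG : DifferentiableWithinAt ℝ G (timeInterval T ×ˢ s) (t, x)) (ht : t ∈ timeInterval T) :
    HasFDerivWithinAt (fun y => G (t, y))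
      ((fderivWithin ℝ G (timeInterval T ×ˢ s) (t, x)).comp (ContinuousLinearMap.inr ℝ ℝ X))
      s x :=
  hG.hasFDerivWithinAt.comp x (hasFDerivAt_prodMk_right t x).hasFDerivWithinAt
    (fun _ hr => mk_mem_prod ht hr)

theorem tpartial_eq (hT : 0 < T) {G : ℝ × X → F} {t : ℝ} {x : X}
    (hG : DifferentiableWithinAt ℝ G (timeInterval T ×ˢ s) (t, x)) (ht : t ∈ timeInterval T)
    (hx : x ∈ s) :
    tpartial T (fun r => G (r, x)) t = fderivWithin ℝ G (timeInterval T ×ˢ s) (t, x) (1, 0) :=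
  (hasDerivWithinAt_time hG hx).derivWithin (uniqueDiffOn_timeInterval hT t ht)

theorem contDiffOn_tpartial (hT : 0 < T) (hs : UniqueDiffOn ℝ s) {n : WithTop ℕ∞} {G : ℝ × X → F}
    (hG : ContDiffOn ℝ (n + 1) G (timeInterval T ×ˢ s)) :
    ContDiffOn ℝ n (fun z : ℝ × X => tpartial T (fun r => G (r, z.2)) z.1)
      (timeInterval T ×ˢ s) := by
  have h := (hG.fderivWithin ((uniqueDiffOn_timeInterval hT).prod hs) le_rfl).clm_apply
    (contDiffOn_const (c := ((1 : ℝ), (0 : X))))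
  refine h.congr fun z hz => ?_
  exact tpartial_eq hT (hG.differentiableOn (by simp) z hz) hz.1 hz.2

theorem hasDerivWithinAt_tpartial (hT : 0 < T) {G : ℝ × X → F} {t : ℝ} {x : X}
    (hG : DifferentiableWithinAt ℝ G (timeInterval T ×ˢ s) (t, x)) (ht : t ∈ timeInterval T)
    (hx : x ∈ s) :
    HasDerivWithinAt (fun r => G (r, x)) (tpartial T (fun r => G (r, x)) t)
      (timeInterval T) t := by
  rw [tpartial_eq hT hG ht hx]; exact hasDerivWithinAt_time hG hx

theorem tpartial_eq_of_hasDerivWithinAt (hT : 0 < T) {w : ℝ → F} {w' : F} {t : ℝ}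
    (h : HasDerivWithinAt w w' (timeInterval T) t) (ht : t ∈ timeInterval T) :
    tpartial T w t = w' :=
  h.derivWithin (uniqueDiffOn_timeInterval hT t ht)

end SpaceTime

/-! ### Calculus on the closed slab -/

/-- Real functions of class `C^n` on the closed slab (up to the boundary) that are periodic in the
horizontal variables. -/
structure SlabReg (b : ℝ) (n : ℕ) (h : R3 → ℝ) : Prop where
  contDiff : ContDiffOn ℝ n h (closedSlab b)
  periodic : PeriodicOnSlab b h

theorem add_single_mem_closedSlab {b : ℝ} {x : R3} {j : Fin 3} (hj : j ≠ 2) :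
    x + Pi.single j 1 ∈ closedSlab b ↔ x ∈ closedSlab b := by
  have : (Pi.single j (1 : ℝ) : R3) 2 = 0 := by simp [hj.symm]
  simp [closedSlab, this]

open scoped Pointwise in
theorem vadd_closedSlab {b : ℝ} {j : Fin 3} (hj : j ≠ 2) :
    (Pi.single j (1 : ℝ) : R3) +ᵥ closedSlab b = closedSlab b := by
  ext x
  rw [mem_vadd_set_iff_neg_vadd_mem, vadd_eq_add, ← add_single_mem_closedSlab hj]
  simp

theorem spartial_add_single {b : ℝ} {h : R3 → ℝ} {j : Fin 3} (hj : j ≠ 2)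
    (hp : ∀ x ∈ closedSlab b, h (x + Pi.single j 1) = h x) (i : Fin 3) {x : R3}
    (hx : x ∈ closedSlab b) : spartial b i h (x + Pi.single j 1) = spartial b i h x := by
  have h1 := fderivWithin_comp_add_right (𝕜 := ℝ) (f := h) (x := x) (s := closedSlab b)
    (Pi.single j 1)
  rw [vadd_closedSlab hj] at h1
  unfold spartial
  rw [← h1, fderivWithin_congr hp (hp x hx)]

section SPartial

variable {b : ℝ} {f h : R3 → ℝ} {x : R3} {i : Fin 3}

theorem spartial_congr {f h : R3 → ℝ} (hfh : EqOn f h (closedSlab b)) (hx : x ∈ closedSlab b) :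
    spartial b i f x = spartial b i h x := by
  unfold spartial; rw [fderivWithin_congr hfh (hfh hx)]

theorem spartial_eq_of_hasFDerivWithinAt (hb : 0 < b) {f' : R3 →L[ℝ] ℝ}
    (hf : HasFDerivWithinAt f f' (closedSlab b) x)
    (hx : x ∈ closedSlab b) : spartial b i f x = f' (Pi.single i 1) := by
  unfold spartial; rw [hf.fderivWithin (uniqueDiffOn_closedSlab hb x hx)]

theorem spartial_add (hb : 0 < b) (hf : DifferentiableWithinAt ℝ f (closedSlab b) x)
    (hh : DifferentiableWithinAt ℝ h (closedSlab b) x) (hx : x ∈ closedSlab b) :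
    spartial b i (fun y => f y + h y) x = spartial b i f x + spartial b i h x := by
  unfold spartial
  rw [fderivWithin_fun_add (uniqueDiffOn_closedSlab hb x hx) hf hh]; rfl

theorem spartial_sub (hb : 0 < b) (hf : DifferentiableWithinAt ℝ f (closedSlab b) x)
    (hh : DifferentiableWithinAt ℝ h (closedSlab b) x) (hx : x ∈ closedSlab b) :
    spartial b i (fun y => f y - h y) x = spartial b i f x - spartial b i h x := by
  unfold spartial
  rw [fderivWithin_fun_sub (uniqueDiffOn_closedSlab hb x hx) hf hh]; rfl

theorem spartial_mul (hb : 0 < b) (hf : DifferentiableWithinAt ℝ f (closedSlab b) x)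
    (hh : DifferentiableWithinAt ℝ h (closedSlab b) x) (hx : x ∈ closedSlab b) :
    spartial b i (fun y => f y * h y) x = f x * spartial b i h x + h x * spartial b i f x := by
  unfold spartial
  rw [fderivWithin_fun_mul (uniqueDiffOn_closedSlab hb x hx) hf hh]; rfl

theorem spartial_sum (hb : 0 < b) {ι : Type*} (s : Finset ι) {F : ι → R3 → ℝ}
    (hF : ∀ k ∈ s, DifferentiableWithinAt ℝ (F k) (closedSlab b) x) (hx : x ∈ closedSlab b) :
    spartial b i (fun y => ∑ k ∈ s, F k y) x = ∑ k ∈ s, spartial b i (F k) x := by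
  unfold spartial
  rw [fderivWithin_fun_sum (uniqueDiffOn_closedSlab hb x hx) hF]; simp

theorem spartial_const (c : ℝ) : spartial b i (fun _ => c) x = 0 := by
  simp [spartial]

theorem spartial_proj (hb : 0 < b) (hx : x ∈ closedSlab b) (k : Fin 3) :
    spartial b i (fun y => y k) x = if k = i then 1 else 0 := by
  refine (spartial_eq_of_hasFDerivWithinAt hb
    (ContinuousLinearMap.proj (R := ℝ) (φ := fun _ : Fin 3 => ℝ) k).hasFDerivAt.hasFDerivWithinAt
    hx).trans ?_
  simp [Pi.single_apply]

theorem closedSlab_subset_closure_interior (hb : 0 < b) :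
    closedSlab b ⊆ closure (interior (closedSlab b)) := by
  rw [(convex_closedSlab b).closure_interior_eq_closure_of_nonempty_interior
    ((slab_nonempty hb).mono (interior_maximal (slab_subset_closedSlab b) (isOpen_slab b)))]
  exact subset_closure

/-- Second partial derivatives of a `C²` function commute, up to the boundary. -/
theorem spartial_comm (hb : 0 < b) (hf : ContDiffOn ℝ 2 f (closedSlab b)) (hx : x ∈ closedSlab b)
    (i j : Fin 3) : spartial b i (spartial b j f) x = spartial b j (spartial b i f) x := by
  have hU := uniqueDiffOn_closedSlab hb
  have hd : DifferentiableWithinAt ℝ (fderivWithin ℝ f (closedSlab b)) (closedSlab b) x :=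
    (hf.fderivWithin hU (m := 1) (by norm_num)).differentiableOn (by simp) x hx
  have hs := (hf x hx).isSymmSndFDerivWithinAt (by simp) hU
    (closedSlab_subset_closure_interior hb hx) hx
  have key : ∀ k l : Fin 3, spartial b k (spartial b l f) x
      = fderivWithin ℝ (fderivWithin ℝ f (closedSlab b)) (closedSlab b) x (Pi.single k 1)
          (Pi.single l 1) := by
    intro k l
    refine (spartial_eq_of_hasFDerivWithinAt hb (hd.hasFDerivWithinAt.clm_apply
      (hasFDerivWithinAt_const (Pi.single l (1 : ℝ) : R3) x _)) hx).trans ?_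
    simp
  rw [key, key, hs]

end SPartial

namespace SlabReg

variable {b : ℝ} {n m : ℕ} {f h : R3 → ℝ}

theorem of_le (hf : SlabReg b n f) (hmn : m ≤ n) : SlabReg b m f :=
  ⟨hf.contDiff.of_le (by exact_mod_cast hmn), hf.periodic⟩

theorem differentiableWithinAt (hf : SlabReg b n f) (hn : 1 ≤ n) {x : R3} (hx : x ∈ closedSlab b) :
    DifferentiableWithinAt ℝ f (closedSlab b) x :=
  hf.contDiff.differentiableOn (by exact_mod_cast (by omega : n ≠ 0)) x hx

theorem congr (hf : SlabReg b n f) (hfh : EqOn h f (closedSlab b)) : SlabReg b n h :=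
  ⟨hf.contDiff.congr hfh, fun x hx => by
    rw [hfh hx, hfh ((add_single_mem_closedSlab (by decide)).2 hx),
      hfh ((add_single_mem_closedSlab (by decide)).2 hx)]
    exact hf.periodic x hx⟩

theorem const (c : ℝ) : SlabReg b n (fun _ => c) :=
  ⟨contDiffOn_const, fun _ _ => ⟨rfl, rfl⟩⟩

theorem add (hf : SlabReg b n f) (hh : SlabReg b n h) : SlabReg b n (fun x => f x + h x) :=
  ⟨hf.contDiff.add hh.contDiff, fun x hx => by
    simp only [(hf.periodic x hx).1, (hf.periodic x hx).2, (hh.periodic x hx).1,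
      (hh.periodic x hx).2, and_self]⟩

theorem sub (hf : SlabReg b n f) (hh : SlabReg b n h) : SlabReg b n (fun x => f x - h x) :=
  ⟨hf.contDiff.sub hh.contDiff, fun x hx => by
    simp only [(hf.periodic x hx).1, (hf.periodic x hx).2, (hh.periodic x hx).1,
      (hh.periodic x hx).2, and_self]⟩

theorem mul (hf : SlabReg b n f) (hh : SlabReg b n h) : SlabReg b n (fun x => f x * h x) :=
  ⟨hf.contDiff.mul hh.contDiff, fun x hx => by
    simp only [(hf.periodic x hx).1, (hf.periodic x hx).2, (hh.periodic x hx).1,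
      (hh.periodic x hx).2, and_self]⟩

theorem neg (hf : SlabReg b n f) : SlabReg b n (fun x => -f x) :=
  ⟨hf.contDiff.neg, fun x hx => by
    simp only [(hf.periodic x hx).1, (hf.periodic x hx).2, and_self]⟩

theorem inv (hf : SlabReg b n f) (h0 : ∀ x ∈ closedSlab b, f x ≠ 0) :
    SlabReg b n (fun x => (f x)⁻¹) :=
  ⟨hf.contDiff.inv h0, fun x hx => by
    simp only [(hf.periodic x hx).1, (hf.periodic x hx).2, and_self]⟩

theorem sum {ι : Type*} (s : Finset ι) {F : ι → R3 → ℝ} (hF : ∀ k ∈ s, SlabReg b n (F k)) :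
    SlabReg b n (fun x => ∑ k ∈ s, F k x) :=
  ⟨ContDiffOn.sum fun k hk => (hF k hk).contDiff, fun x hx =>
    ⟨Finset.sum_congr rfl fun k hk => ((hF k hk).periodic x hx).1,
      Finset.sum_congr rfl fun k hk => ((hF k hk).periodic x hx).2⟩⟩

theorem spartial (hb : 0 < b) (hf : SlabReg b (n + 1) f) (i : Fin 3) :
    SlabReg b n (FreeSurface.spartial b i f) :=
  ⟨(hf.contDiff.fderivWithin (uniqueDiffOn_closedSlab hb) (by exact_mod_cast le_rfl)).clm_apply
      contDiffOn_const, fun x hx =>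
    ⟨spartial_add_single (by decide) (fun y hy => (hf.periodic y hy).1) i hx,
      spartial_add_single (by decide) (fun y hy => (hf.periodic y hy).2) i hx⟩⟩

theorem apply {w : R3 → R3} (hw : ContDiffOn ℝ n w (closedSlab b)) (hp : PeriodicOnSlab b w)
    (i : Fin 3) : SlabReg b n (fun x => w x i) :=
  ⟨contDiffOn_pi.1 hw i, fun x hx => by simp only [(hp x hx).1, (hp x hx).2, and_self]⟩

end SlabReg

/-! ### Integrals over one period -/

theorem cell_ae_eq_Icc (b : ℝ) :
    cell b =ᵐ[volume] Icc (![0, 0, -b] : R3) (![1, 1, 0] : R3) := by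
  refine EventuallyLE.antisymm (LE.le.eventuallyLE ?_) ?_
  · intro x hx
    constructor <;> intro i <;> fin_cases i <;> simp
    exacts [hx.1.1, hx.2.1.1, hx.2.2.1.le, hx.1.2.le, hx.2.1.2.le, hx.2.2.2.le]
  · refine (Measure.univ_pi_Ioo_ae_eq_Icc (μ := fun _ : Fin 3 => (volume : Measure ℝ))).symm.le.trans
      (LE.le.eventuallyLE ?_)
    intro x hx
    have h0 := hx 0 trivial
    have h1 := hx 1 trivial
    have h2 := hx 2 trivial
    simp at h0 h1 h2
    exact ⟨⟨h0.1.le, h0.2⟩, ⟨h1.1.le, h1.2⟩, h2⟩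

theorem square_eq_pi : square = univ.pi fun _ : Fin 2 => Ico (0 : ℝ) 1 := by
  ext x; simp [square]

theorem square_ae_eq_Icc : square =ᵐ[volume] Icc (0 : R2) 1 := by
  rw [square_eq_pi]
  exact Measure.univ_pi_Ico_ae_eq_Icc (μ := fun _ : Fin 2 => (volume : Measure ℝ))
    (f := 0) (g := 1)

theorem measurableSet_square : MeasurableSet square := by
  rw [square_eq_pi]; exact MeasurableSet.univ_pi fun _ => measurableSet_Ico

theorem measurableSet_cell (b : ℝ) : MeasurableSet (cell b) := by
  unfold cell; measurability

theorem square_subset_Icc : square ⊆ Icc (0 : R2) 1 :=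
  fun _ hx => ⟨fun i => (hx i).1, fun i => (hx i).2.le⟩

theorem Icc_subset_closedSlab (b : ℝ) :
    Icc (![0, 0, -b] : R3) (![1, 1, 0] : R3) ⊆ closedSlab b :=
  fun _ hx => ⟨by simpa using hx.1 2, by simpa using hx.2 2⟩

theorem cell_subset_Icc (b : ℝ) : cell b ⊆ Icc (![0, 0, -b] : R3) (![1, 1, 0] : R3) := by
  intro x hx
  constructor <;> intro i <;> fin_cases i <;> simp
  exacts [hx.1.1, hx.2.1.1, hx.2.2.1.le, hx.1.2.le, hx.2.1.2.le, hx.2.2.2.le]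

theorem integrableOn_cell {E : Type*} [NormedAddCommGroup E] {b : ℝ} {h : R3 → E}
    (hh : ContinuousOn h (closedSlab b)) : IntegrableOn h (cell b) :=
  ((hh.mono (Icc_subset_closedSlab b)).integrableOn_compact isCompact_Icc).mono_set
    (cell_subset_Icc b)

theorem integrableOn_square {E : Type*} [NormedAddCommGroup E] {h : R2 → E} (hh : Continuous h) :
    IntegrableOn h square :=
  (hh.continuousOn.integrableOn_compact isCompact_Icc).mono_set square_subset_Icc

theorem integrableOn_cell_const (b c : ℝ) : IntegrableOn (fun _ => c) (cell b) :=
  integrableOn_cell continuousOn_const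

theorem integrableOn_square_const (c : ℝ) : IntegrableOn (fun _ => c) square :=
  integrableOn_square continuous_const

/-- Gauss' theorem on one period of the slab: the contributions of the lateral faces cancel by
periodicity. -/
theorem integral_cell_divergence {b : ℝ} (hb : 0 < b) {F : Fin 3 → R3 → ℝ}
    (hF : ∀ j, SlabReg b 1 (F j)) :
    ∫ x in cell b, ∑ j, spartial b j (F j) x
      = (∫ y in square, F 2 (atHeight 0 y)) - ∫ y in square, F 2 (atHeight (-b) y) := by
  have hcont : ∀ j, ContinuousOn (spartial b j (F j)) (closedSlab b) := fun j =>
    ((hF j).spartial (n := 0) hb j).contDiff.continuousOn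
  rw [setIntegral_congr_set (cell_ae_eq_Icc b)]
  have hle : (![0, 0, -b] : R3) ≤ ![1, 1, 0] := by
    intro i; fin_cases i <;> simp [hb.le]
  have key := integral_divergence_of_hasFDerivAt_off_countable' (![0, 0, -b] : R3) ![1, 1, 0] hle
    F (fun j x => fderivWithin ℝ (F j) (closedSlab b) x) ∅ countable_empty
    (fun j => (hF j).contDiff.continuousOn.mono (Icc_subset_closedSlab b))
    (fun x hx j => by
      have h2 := hx.1 2 trivial
      simp at h2
      exact (((hF j).differentiableWithinAt le_rfl
        (slab_subset_closedSlab b h2)).hasFDerivWithinAt).hasFDerivAt (closedSlab_mem_nhds h2))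
    (((continuousOn_finsetSum _ fun j _ => hcont j).mono
      (Icc_subset_closedSlab b)).integrableOn_compact isCompact_Icc)
  refine key.trans ?_
  rw [Fin.sum_univ_three]
  -- lateral faces at distance one carry the same values
  have hside : ∀ (j : Fin 3), j ≠ 2 →
      (∫ y in Icc ((![0, 0, -b] : R3) ∘ j.succAbove) ((![1, 1, 0] : R3) ∘ j.succAbove),
        F j (j.insertNth ((![1, 1, 0] : R3) j) y))
      = ∫ y in Icc ((![0, 0, -b] : R3) ∘ j.succAbove) ((![1, 1, 0] : R3) ∘ j.succAbove),
        F j (j.insertNth ((![0, 0, -b] : R3) j) y) := by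
    intro j hj
    refine setIntegral_congr_fun measurableSet_Icc fun y hy => ?_
    have hmem : (j.insertNth ((![0, 0, -b] : R3) j) y : R3) ∈ closedSlab b := by
      apply Icc_subset_closedSlab b
      rw [Fin.insertNth_mem_Icc]
      exact ⟨⟨le_rfl, hle j⟩, hy⟩
    have hper : F j ((j.insertNth ((![0, 0, -b] : R3) j) y : R3) + Pi.single j 1)
        = F j (j.insertNth ((![0, 0, -b] : R3) j) y : R3) := by
      fin_cases j
      · exact ((hF 0).periodic _ hmem).1
      · exact ((hF 1).periodic _ hmem).2
      · exact absurd rfl hj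
    rw [← hper]
    congr 1
    ext k
    refine Fin.succAboveCases j ?_ (fun l => ?_) k
    · fin_cases j <;> simp at hj ⊢
    · simp
  have htop : ∀ c : ℝ, (∫ y in Icc ((![0, 0, -b] : R3) ∘ (2 : Fin 3).succAbove)
      ((![1, 1, 0] : R3) ∘ (2 : Fin 3).succAbove), F 2 ((2 : Fin 3).insertNth c y))
      = ∫ y in square, F 2 (atHeight c y) := by
    intro c
    have h0 : ((![0, 0, -b] : R3) ∘ (2 : Fin 3).succAbove) = 0 := by
      ext k; fin_cases k <;> rfl
    have h1 : ((![1, 1, 0] : R3) ∘ (2 : Fin 3).succAbove) = 1 := by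
      ext k; fin_cases k <;> rfl
    have h2 : ∀ y : R2, ((2 : Fin 3).insertNth c y : R3) = atHeight c y := by
      intro y; ext k; fin_cases k <;> rfl
    rw [setIntegral_congr_set square_ae_eq_Icc, h0, h1]
    simp only [h2]
  rw [hside 0 (by decide), hside 1 (by decide), sub_self, sub_self, zero_add, zero_add,
    htop, htop]
  rfl

/-- The integral of a partial derivative over one period of the torus vanishes. -/
theorem integral_square_fderiv_eq_zero {E : Type*} [NormedAddCommGroup E] [NormedSpace ℝ E]
    {h : R2 → E} (hh : ContDiff ℝ 1 h) (hp : PeriodicOnPlane h) (i : Fin 2) :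
    ∫ y in square, fderiv ℝ h y (Pi.single i 1) = 0 := by
  rw [setIntegral_congr_set square_ae_eq_Icc]
  have hc : Continuous fun y => fderiv ℝ h y (Pi.single i 1) :=
    (hh.continuous_fderiv (by simp)).clm_apply continuous_const
  -- the field whose only nonzero component is the `i`-th one, equal to `h`
  have key := integral_divergence_of_hasFDerivAt_off_countable' (0 : R2) 1 zero_le_one
    (fun j => if j = i then h else 0) (fun j x => if j = i then fderiv ℝ h x else 0) ∅
    countable_empty
    (fun j => by split_ifs; exacts [hh.continuous.continuousOn, continuousOn_const])
    (fun x _ j => by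
      split_ifs
      exacts [(hh.differentiable (by simp) x).hasFDerivAt, hasFDerivAt_const (0 : E) x])
    (by
      refine Continuous.integrableOn_Icc ?_
      refine continuous_finsetSum _ fun j _ => ?_
      by_cases hj : j = i
      · subst hj; simpa using hc
      · simpa [hj] using continuous_const)
  have hlhs : ∀ x, (∑ j, (if j = i then fderiv ℝ h x else 0) (Pi.single j 1))
      = fderiv ℝ h x (Pi.single i 1) := by
    intro x
    rw [Finset.sum_eq_single i (fun j _ hj => by simp [hj]) (by simp)]
    simp
  simp only [hlhs] at key
  rw [key, Finset.sum_eq_single i (fun j _ hj => by simp [hj]) (by simp), sub_eq_zero]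
  refine setIntegral_congr_fun measurableSet_Icc fun y hy => ?_
  have hper : ∀ x, h (x + Pi.single i 1) = h x := by
    intro x; fin_cases i; exacts [(hp x).1, (hp x).2]
  simp only [if_true]
  rw [← hper (i.insertNth ((0 : R2) i) y)]
  congr 1
  ext k
  refine Fin.succAboveCases i ?_ (fun l => ?_) k
  · simp
  · simp

/-! ### Calculus on the plane -/

section Plane

variable {T : EReal}

theorem contDiff_slice {F : Type*} [NormedAddCommGroup F] [NormedSpace ℝ F] {n : WithTop ℕ∞}
    {G : ℝ × R2 → F} (hG : ContDiffOn ℝ n G (timeInterval T ×ˢ univ)) {t : ℝ}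
    (ht : t ∈ timeInterval T) : ContDiff ℝ n fun y => G (t, y) := by
  rw [← contDiffOn_univ]
  exact hG.comp (contDiff_prodMk_right t).contDiffOn fun y _ => mk_mem_prod ht (mem_univ y)

/-- Differentiation in time of an integral over the torus. -/
theorem hasDerivWithinAt_integral_square {E : Type*} [NormedAddCommGroup E] [NormedSpace ℝ E]
    (hT : 0 < T) {H : ℝ × R2 → E} (hH : ContDiffOn ℝ 1 H (timeInterval T ×ˢ univ)) {t : ℝ}
    (ht : t ∈ timeInterval T) :
    HasDerivWithinAt (fun s => ∫ y in square, H (s, y))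
      (∫ y in square, tpartial T (fun r => H (r, y)) t) (timeInterval T) t := by
  obtain ⟨t₁, ht₁, hlt⟩ := exists_gt_mem_timeInterval ht
  have hKI := Icc_subset_timeInterval ht₁
  have hc : ContinuousOn (fun z : ℝ × R2 => tpartial T (fun r => H (r, z.2)) z.1)
      (timeInterval T ×ˢ univ) :=
    (contDiffOn_tpartial (n := 0) hT uniqueDiffOn_univ (by simpa using hH)).continuousOn
  obtain ⟨M, hM⟩ := (isCompact_Icc.prod isCompact_Icc).exists_bound_of_continuousOn
    (hc.mono (prod_mono hKI (subset_univ (Icc (0 : R2) 1))))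
  refine hasDerivWithinAt_integral_of_dominated (K := Icc 0 t₁) (bound := fun _ => M)
    (F' := fun s y => tpartial T (fun r => H (r, y)) s)
    (convex_Icc _ _) hKI (Icc_mem_nhdsWithin_timeInterval hlt) ⟨ht.1, hlt.le⟩ ?_
    (integrableOn_square_const M) ?_ ?_
  · exact fun s hs => integrableOn_square (contDiff_slice hH (hKI hs)).continuous
  · exact Eventually.of_forall fun y s hs => hasDerivWithinAt_tpartial hT
      (hH.differentiableOn (by simp) (s, y) (mk_mem_prod (hKI hs) (mem_univ y))) (hKI hs)
      (mem_univ y)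
  · filter_upwards [ae_restrict_mem measurableSet_square] with y hy s hs
    exact hM (s, y) (mk_mem_prod hs (square_subset_Icc hy))

theorem contDiff_hpartial {n : WithTop ℕ∞} {h : R2 → ℝ} (hh : ContDiff ℝ (n + 1) h) (i : Fin 2) :
    ContDiff ℝ n (hpartial i h) :=
  (hh.fderiv_right le_rfl).clm_apply contDiff_const

theorem PeriodicOnPlane.hpartial {h : R2 → ℝ} (hp : PeriodicOnPlane h) (i : Fin 2) :
    PeriodicOnPlane (hpartial i h) := by
  intro x
  have key : ∀ e : R2, (∀ x, h (x + e) = h x) →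
      FreeSurface.hpartial i h (x + e) = FreeSurface.hpartial i h x := by
    intro e he
    unfold FreeSurface.hpartial
    rw [← fderiv_comp_add_right e]
    simp only [he]
  exact ⟨key _ fun x => (hp x).1, key _ fun x => (hp x).2⟩

theorem PeriodicOnPlane.mul {h k : R2 → ℝ} (hp : PeriodicOnPlane h) (kp : PeriodicOnPlane k) :
    PeriodicOnPlane fun x => h x * k x := fun x => by
  simp only [(hp x).1, (hp x).2, (kp x).1, (kp x).2, and_self]

theorem hpartial_comm {h : R2 → ℝ} (hh : ContDiff ℝ 2 h) (i j : Fin 2) (x : R2) :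
    hpartial i (hpartial j h) x = hpartial j (hpartial i h) x := by
  have hd : DifferentiableAt ℝ (fderiv ℝ h) x :=
    (hh.fderiv_right (m := 1) (by norm_num)).differentiable (by simp) x
  have hs := hh.contDiffAt.isSymmSndFDerivAt (x := x) (by simp)
  have key : ∀ k l : Fin 2, hpartial k (hpartial l h) x
      = fderiv ℝ (fderiv ℝ h) x (Pi.single k 1) (Pi.single l 1) := by
    intro k l
    have h1 := hd.hasFDerivAt.clm_apply (hasFDerivAt_const (Pi.single l (1 : ℝ) : R2) x)
    change fderiv ℝ (fun y => fderiv ℝ h y (Pi.single l 1)) x _ = _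
    rw [h1.fderiv]
    simp
  rw [key, key, hs]

/-- Integration by parts on the torus. -/
theorem integral_mul_hpartial {a φ : R2 → ℝ} (ha : ContDiff ℝ 1 a) (hφ : ContDiff ℝ 1 φ)
    (hap : PeriodicOnPlane a) (hφp : PeriodicOnPlane φ) (i : Fin 2) :
    ∫ y in square, a y * hpartial i φ y = -∫ y in square, hpartial i a y * φ y := by
  have h0 := integral_square_fderiv_eq_zero (ha.mul hφ) (hap.mul hφp) i
  have h1 : ∀ y, fderiv ℝ (fun y => a y * φ y) y (Pi.single i 1)
      = a y * hpartial i φ y + hpartial i a y * φ y := by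
    intro y
    rw [fderiv_fun_mul (ha.differentiable (by simp) y) (hφ.differentiable (by simp) y)]
    simp [hpartial, mul_comm]
  have ca : Continuous (hpartial i a) := (contDiff_hpartial (n := 0) (by simpa using ha) i).continuous
  have cφ : Continuous (hpartial i φ) := (contDiff_hpartial (n := 0) (by simpa using hφ) i).continuous
  simp only [h1] at h0
  have h2 := integral_add (integrableOn_square (ha.continuous.mul cφ))
    (integrableOn_square (ca.mul hφ.continuous))
  simp only [Pi.mul_apply] at h2
  linarith

end Plane

/-! ### Jets and their formal adjoint -/

theorem apply_eq_sum_coords (l : JetSpace →L[ℝ] ℝ) (P : Fin 2 → ℝ) (M : Fin 2 → Fin 2 → ℝ) :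
    l (P, M) = (∑ i, (coords l).1 i * P i) + ∑ i, ∑ j, (coords l).2 i j * M i j := by
  have h : ((P, M) : JetSpace)
      = (∑ i, P i • ((Pi.single i 1, 0) : JetSpace))
        + ∑ i, ∑ j, M i j • ((0, Pi.single i (Pi.single j 1)) : JetSpace) := by
    ext i j
    · fin_cases i <;> simp [Fin.sum_univ_two]
    · fin_cases i <;> fin_cases j <;> simp [Fin.sum_univ_two]
  rw [h, map_add, map_sum, map_sum]
  simp only [map_sum, map_smul, smul_eq_mul, coords, mul_comm]

theorem contDiff_coords_fst {n : WithTop ℕ∞} {l : R2 → JetSpace →L[ℝ] ℝ} (hl : ContDiff ℝ n l)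
    (i : Fin 2) : ContDiff ℝ n fun y => (coords (l y)).1 i :=
  hl.clm_apply contDiff_const

theorem contDiff_coords_snd {n : WithTop ℕ∞} {l : R2 → JetSpace →L[ℝ] ℝ} (hl : ContDiff ℝ n l)
    (i j : Fin 2) : ContDiff ℝ n fun y => (coords (l y)).2 i j :=
  hl.clm_apply contDiff_const

/-- `𝒥^*` is the adjoint of `𝒥` for the `L²` pairing on the torus. -/
theorem integral_apply_jet {l : R2 → JetSpace →L[ℝ] ℝ} (hl : ContDiff ℝ 2 l)
    (hlp : PeriodicOnPlane l) {φ : R2 → ℝ} (hφ : ContDiff ℝ 2 φ) (hφp : PeriodicOnPlane φ) :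
    ∫ y in square, l y (jet φ y) = ∫ y in square, jetAdj (fun y => coords (l y)) y * φ y := by
  have hl1 := fun i => contDiff_coords_fst hl i
  have hl2 := fun i j => contDiff_coords_snd hl i j
  have hp1 : ∀ i, PeriodicOnPlane fun y => (coords (l y)).1 i := fun i x => by
    simp only [(hlp x).1, (hlp x).2, and_self]
  have hp2 : ∀ i j, PeriodicOnPlane fun y => (coords (l y)).2 i j := fun i j x => by
    simp only [(hlp x).1, (hlp x).2, and_self]
  have dφ : ∀ i, ContDiff ℝ 1 (hpartial i φ) := fun i => contDiff_hpartial (by norm_num; exact hφ) i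
  have ddφ : ∀ i j, Continuous (hpartial i (hpartial j φ)) := fun i j =>
    (contDiff_hpartial (n := 0) (by simpa using dφ j) i).continuous
  have d1 : ∀ i, ContDiff ℝ 1 (hpartial i fun y => (coords (l y)).1 i) := fun i =>
    contDiff_hpartial (by norm_num; exact hl1 i) i
  have d2 : ∀ k i j, ContDiff ℝ 1 (hpartial k fun y => (coords (l y)).2 i j) := fun k i j =>
    contDiff_hpartial (by norm_num; exact hl2 i j) k
  have dd2 : ∀ k m i j, Continuous (hpartial m (hpartial k fun y => (coords (l y)).2 i j)) :=
    fun k m i j => (contDiff_hpartial (n := 0) (by simpa using d2 k i j) m).continuous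
  have first : ∀ i, ∫ y in square, (coords (l y)).1 i * hpartial i φ y
      = ∫ y in square, -(hpartial i (fun y => (coords (l y)).1 i) y * φ y) := by
    intro i
    rw [integral_mul_hpartial ((hl1 i).of_le (by norm_num)) (hφ.of_le (by norm_num)) (hp1 i) hφp,
      integral_neg]
  have second : ∀ i j, ∫ y in square, (coords (l y)).2 i j * hpartial i (hpartial j φ) y
      = ∫ y in square, hpartial i (hpartial j fun y => (coords (l y)).2 i j) y * φ y := by
    intro i j
    rw [integral_mul_hpartial ((hl2 i j).of_le (by norm_num)) (dφ j) (hp2 i j) (hφp.hpartial j),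
      integral_mul_hpartial (d2 i i j) (hφ.of_le (by norm_num)) ((hp2 i j).hpartial i) hφp, neg_neg]
    simp only [hpartial_comm (hl2 i j) j i]
  have i1 : ∀ i, IntegrableOn (fun y => (coords (l y)).1 i * hpartial i φ y) square := fun i =>
    integrableOn_square ((hl1 i).continuous.mul (dφ i).continuous)
  have i2 : ∀ i j, IntegrableOn (fun y => (coords (l y)).2 i j * hpartial i (hpartial j φ) y)
      square := fun i j => integrableOn_square ((hl2 i j).continuous.mul (ddφ i j))
  have j1 : ∀ i, IntegrableOn (fun y => -(hpartial i (fun y => (coords (l y)).1 i) y * φ y))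
      square := fun i => integrableOn_square ((d1 i).continuous.mul hφ.continuous).neg
  have j2 : ∀ i j, IntegrableOn
      (fun y => hpartial i (hpartial j fun y => (coords (l y)).2 i j) y * φ y) square :=
    fun i j => integrableOn_square ((dd2 j i i j).mul hφ.continuous)
  have lhs : ∀ y, l y (jet φ y) = (∑ i, (coords (l y)).1 i * hpartial i φ y)
      + ∑ i, ∑ j, (coords (l y)).2 i j * hpartial i (hpartial j φ) y := fun y =>
    apply_eq_sum_coords _ _ _
  have rhs : ∀ y, jetAdj (fun y => coords (l y)) y * φ y
      = (∑ i, -(hpartial i (fun y => (coords (l y)).1 i) y * φ y))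
        + ∑ i, ∑ j, hpartial i (hpartial j fun y => (coords (l y)).2 i j) y * φ y := by
    intro y
    simp only [jetAdj, Fin.sum_univ_two]; ring
  simp only [lhs, rhs]
  rw [integral_add (integrable_finsetSum _ fun i _ => i1 i)
      (integrable_finsetSum _ fun i _ => integrable_finsetSum _ fun j _ => i2 i j),
    integral_add (integrable_finsetSum _ fun i _ => j1 i)
      (integrable_finsetSum _ fun i _ => integrable_finsetSum _ fun j _ => j2 i j),
    integral_finsetSum _ (fun i _ => i1 i), integral_finsetSum _ (fun i _ => j1 i),
    integral_finsetSum _ (fun i _ => integrable_finsetSum _ fun j _ => i2 i j),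
    integral_finsetSum _ (fun i _ => integrable_finsetSum _ fun j _ => j2 i j)]
  congr 1
  · exact Finset.sum_congr rfl fun i _ => first i
  · refine Finset.sum_congr rfl fun i _ => ?_
    rw [integral_finsetSum _ (fun j _ => i2 i j), integral_finsetSum _ (fun j _ => j2 i j)]
    exact Finset.sum_congr rfl fun j _ => second i j

/-! ### Time-dependent surface elevations -/

namespace RegularElevation

variable {T : EReal} {n m : ℕ} {η : ℝ → R2 → ℝ}

theorem of_le (hη : RegularElevation T n η) (hmn : m ≤ n) : RegularElevation T m η :=
  ⟨hη.periodic, hη.contDiff.of_le (by exact_mod_cast hmn)⟩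

theorem contDiff_space (hη : RegularElevation T n η) {t : ℝ} (ht : t ∈ timeInterval T) :
    ContDiff ℝ n (η t) := contDiff_slice hη.contDiff ht

theorem differentiableWithinAt (hη : RegularElevation T n η) (hn : 1 ≤ n) {t : ℝ}
    (ht : t ∈ timeInterval T) (y : R2) :
    DifferentiableWithinAt ℝ (fun z : ℝ × R2 => η z.1 z.2) (timeInterval T ×ˢ univ) (t, y) :=
  hη.contDiff.differentiableOn (by exact_mod_cast (by omega : n ≠ 0)) _
    (mk_mem_prod ht (mem_univ y))

theorem hpartial_eq (hη : RegularElevation T n η) (hn : 1 ≤ n) {t : ℝ} (ht : t ∈ timeInterval T)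
    (i : Fin 2) (y : R2) : FreeSurface.hpartial i (η t) y
      = fderivWithin ℝ (fun z : ℝ × R2 => η z.1 z.2) (timeInterval T ×ˢ univ) (t, y)
          (0, Pi.single i 1) := by
  have h := hasFDerivWithinAt_space (hη.differentiableWithinAt hn ht y) ht
  rw [hasFDerivWithinAt_univ] at h
  unfold FreeSurface.hpartial
  rw [h.fderiv]; rfl

theorem hpartial (hT : 0 < T) (hη : RegularElevation T (n + 1) η) (i : Fin 2) :
    RegularElevation T n fun t => FreeSurface.hpartial i (η t) where
  periodic t ht := (hη.periodic t ht).hpartial i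
  contDiff := by
    refine ((hη.contDiff.fderivWithin ((uniqueDiffOn_timeInterval hT).prod uniqueDiffOn_univ)
      (by exact_mod_cast le_rfl)).clm_apply
      (contDiffOn_const (c := ((0 : ℝ), (Pi.single i 1 : R2))))).congr fun z hz => ?_
    exact hη.hpartial_eq (by omega) hz.1 i z.2

theorem tpartial (hT : 0 < T) (hη : RegularElevation T (n + 1) η) :
    RegularElevation T n fun t y => FreeSurface.tpartial T (fun s => η s y) t where
  periodic t ht y := by
    constructor <;> refine derivWithin_congr (fun s hs => ?_) ?_
    exacts [(hη.periodic s hs y).1, (hη.periodic t ht y).1, (hη.periodic s hs y).2,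
      (hη.periodic t ht y).2]
  contDiff := contDiffOn_tpartial hT uniqueDiffOn_univ
    (G := fun z : ℝ × R2 => η z.1 z.2) (by exact_mod_cast hη.contDiff)

theorem hasDerivWithinAt (hT : 0 < T) (hη : RegularElevation T n η) (hn : 1 ≤ n) {t : ℝ}
    (ht : t ∈ timeInterval T) (y : R2) :
    HasDerivWithinAt (fun s => η s y) (FreeSurface.tpartial T (fun s => η s y) t)
      (timeInterval T) t :=
  hasDerivWithinAt_tpartial hT (hη.differentiableWithinAt hn ht y) ht (mem_univ y)

/-- Time and space derivatives of a `C²` elevation commute, also at the initial time. -/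
theorem hasDerivWithinAt_hpartial (hT : 0 < T) (hη : RegularElevation T n η) (hn : 2 ≤ n) {t : ℝ}
    (ht : t ∈ timeInterval T) (i : Fin 2) (y : R2) :
    HasDerivWithinAt (fun s => FreeSurface.hpartial i (η s) y)
      (FreeSurface.hpartial i (fun x => FreeSurface.tpartial T (fun s => η s x) t) y)
      (timeInterval T) t := by
  set G : ℝ × R2 → ℝ := fun z => η z.1 z.2 with hGdef
  set U : Set (ℝ × R2) := timeInterval T ×ˢ univ with hUdef
  have hU : UniqueDiffOn ℝ U := (uniqueDiffOn_timeInterval hT).prod uniqueDiffOn_univ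
  have hz : (t, y) ∈ U := mk_mem_prod ht (mem_univ y)
  have hcv : Convex ℝ U := (convex_timeInterval T).prod convex_univ
  have hint : (interior U).Nonempty := by
    rw [hUdef, interior_prod_eq, interior_univ]
    exact (interior_timeInterval_nonempty hT).prod univ_nonempty
  have hG : ContDiffOn ℝ 2 G U := (hη.of_le hn).contDiff
  have hs := (hG _ hz).isSymmSndFDerivWithinAt (by simp) hU
    (by rw [hcv.closure_interior_eq_closure_of_nonempty_interior hint]; exact subset_closure hz) hz
  have hd : DifferentiableWithinAt ℝ (fderivWithin ℝ G U) U (t, y) :=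
    (hG.fderivWithin hU (m := 1) (by norm_num)).differentiableOn (by simp) _ hz
  have h1 := hd.hasFDerivWithinAt.clm_apply
    (hasFDerivWithinAt_const (((0 : ℝ), (Pi.single i 1 : R2))) (t, y) U)
  have h2 := hd.hasFDerivWithinAt.clm_apply
    (hasFDerivWithinAt_const (((1 : ℝ), (0 : R2))) (t, y) U)
  have h3 := hasDerivWithinAt_time h1.differentiableWithinAt (mem_univ y)
  have h4 := hasFDerivWithinAt_space h2.differentiableWithinAt ht
  rw [h1.fderivWithin (hU _ hz)] at h3
  rw [h2.fderivWithin (hU _ hz), hasFDerivWithinAt_univ] at h4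
  have e1 : FreeSurface.hpartial i (fun x => FreeSurface.tpartial T (fun s => η s x) t) y
      = fderivWithin ℝ (fderivWithin ℝ G U) U (t, y) (0, Pi.single i 1) (1, 0) := by
    have : (fun x => FreeSurface.tpartial T (fun s => η s x) t)
        = fun x => fderivWithin ℝ G U (t, x) (1, 0) := by
      funext x
      exact tpartial_eq hT (G := G) (hη.differentiableWithinAt (by omega) ht x) ht (mem_univ x)
    unfold FreeSurface.hpartial
    rw [this, h4.fderiv]
    simp
  rw [e1, hs]
  refine HasDerivWithinAt.congr (f := fun r => fderivWithin ℝ G U (r, y) (0, Pi.single i 1)) ?_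
    (fun s hs => hη.hpartial_eq (by omega) hs i y) (hη.hpartial_eq (by omega) ht i y)
  convert h3 using 1
  simp

theorem contDiffOn_jet (hT : 0 < T) (hη : RegularElevation T (n + 2) η) :
    ContDiffOn ℝ n (fun z : ℝ × R2 => jet (η z.1) z.2) (timeInterval T ×ˢ univ) := by
  refine ContDiffOn.prodMk ?_ ?_
  · exact contDiffOn_pi.2 fun i => (((hη.of_le (by omega : n + 1 ≤ n + 2)).hpartial hT i)).contDiff
  · exact contDiffOn_pi.2 fun i => contDiffOn_pi.2 fun j =>
      ((RegularElevation.hpartial (n := n + 1) hT hη j).hpartial hT i).contDiff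

theorem hasDerivWithinAt_jet (hT : 0 < T) (hη : RegularElevation T n η) (hn : 3 ≤ n) {t : ℝ}
    (ht : t ∈ timeInterval T) (y : R2) :
    HasDerivWithinAt (fun s => jet (η s) y)
      (jet (fun x => FreeSurface.tpartial T (fun s => η s x) t) y) (timeInterval T) t := by
  refine HasDerivWithinAt.prodMk ?_ ?_
  · exact hasDerivWithinAt_pi.2 fun i => hη.hasDerivWithinAt_hpartial hT (by omega) ht i y
  · refine hasDerivWithinAt_pi.2 fun i => hasDerivWithinAt_pi.2 fun j => ?_
    have h := RegularElevation.hasDerivWithinAt_hpartial (n := 2) hT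
      (RegularElevation.hpartial (n := 2) hT (hη.of_le hn) j) le_rfl ht i y
    have e : (fun x => FreeSurface.tpartial T (fun s => FreeSurface.hpartial j (η s) x) t)
        = FreeSurface.hpartial j (fun x => FreeSurface.tpartial T (fun s => η s x) t) := by
      funext x
      exact tpartial_eq_of_hasDerivWithinAt hT (hη.hasDerivWithinAt_hpartial hT (by omega) ht j x) ht
    rw [e] at h
    exact h

end RegularElevation

theorem PeriodicOnPlane.jet {η : R2 → ℝ} (hp : PeriodicOnPlane η) :
    PeriodicOnPlane (jet η) := by
  have h1 := fun i => hp.hpartial i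
  have h2 := fun i j => (hp.hpartial j).hpartial i
  intro x
  simp only [FreeSurface.jet, (h1 _ x).1, (h1 _ x).2, (h2 _ _ x).1, (h2 _ _ x).2, and_self]

/-! ### Time derivatives of the surface energies -/

section SurfaceEnergy

variable {T : EReal} {f : JetSpace → ℝ} {η ζ : ℝ → R2 → ℝ} {t : ℝ}

theorem contDiff_hess (hf : ContDiff ℝ ∞ f) : ContDiff ℝ ∞ (hess f) :=
  (hf.fderiv_right (m := ∞) (by simp)).fderiv_right (m := ∞) (by simp)

theorem hess_symm (hf : ContDiff ℝ ∞ f) (w a c : JetSpace) : hess f w a c = hess f w c a :=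
  ((hf.of_le (m := 2) ENat.LEInfty.out).contDiffAt.isSymmSndFDerivAt (x := w) (by simp)) a c

theorem hasDerivWithinAt_potential (g : ℝ) (hT : 0 < T) (hζ : RegularElevation T 1 ζ)
    (ht : t ∈ timeInterval T) :
    HasDerivWithinAt (fun s => potential g (ζ s))
      (∫ y in square, g * ζ t y * tpartial T (fun s => ζ s y) t) (timeInterval T) t := by
  have h := hasDerivWithinAt_integral_square hT
    (H := fun z : ℝ × R2 => g / 2 * ζ z.1 z.2 ^ 2) (contDiffOn_const.mul (hζ.contDiff.pow 2)) ht
  refine h.congr_deriv (integral_congr_ae (Eventually.of_forall fun y => ?_))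
  refine tpartial_eq_of_hasDerivWithinAt hT
    ((((hζ.hasDerivWithinAt hT le_rfl ht y).pow 2).const_mul (g / 2)).congr_deriv ?_) ht
  simp; ring

theorem hasDerivWithinAt_surfEnergy (hT : 0 < T) (hf : ContDiff ℝ ∞ f)
    (hη : RegularElevation T 5 η) (ht : t ∈ timeInterval T) :
    HasDerivWithinAt (fun s => surfEnergy f (η s))
      (∫ y in square, firstVar f (η t) y * tpartial T (fun s => η s y) t) (timeInterval T) t := by
  have hjet : ContDiffOn ℝ 3 (fun z : ℝ × R2 => jet (η z.1) z.2) (timeInterval T ×ˢ univ) :=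
    RegularElevation.contDiffOn_jet (n := 3) hT hη
  have h := hasDerivWithinAt_integral_square hT (H := fun z : ℝ × R2 => f (jet (η z.1) z.2))
    ((hf.of_le (by simp)).comp_contDiffOn (hjet.of_le (by norm_num))) ht
  refine h.congr_deriv ?_
  have hηt : RegularElevation T 4 fun t y => tpartial T (fun s => η s y) t := hη.tpartial hT
  have hjt := contDiff_slice hjet ht
  refine Eq.trans ?_ (integral_apply_jet (l := fun y => fderiv ℝ f (jet (η t) y))
    (((hf.fderiv_right (m := ∞) (by simp)).of_le ENat.LEInfty.out).comp (hjt.of_le (by norm_num)))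
    (fun x => by
      have := (hη.periodic t ht).jet x
      simp only [this.1, this.2, and_self])
    ((hηt.contDiff_space ht).of_le (by norm_num)) (hηt.periodic t ht))
  refine integral_congr_ae (Eventually.of_forall fun y => ?_)
  refine tpartial_eq_of_hasDerivWithinAt hT ?_ ht
  exact ((hf.differentiable (by simp)) _).hasFDerivAt.comp_hasDerivWithinAt t
    (hη.hasDerivWithinAt_jet hT (by norm_num) ht y)

theorem hasDerivWithinAt_quadW (hT : 0 < T) (hf : ContDiff ℝ ∞ f)
    (hη : RegularElevation T 5 η) (hζ : RegularElevation T 4 ζ) (ht : t ∈ timeInterval T) :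
    HasDerivWithinAt (fun s => quadW f (η s) (ζ s))
      (quadWdot f T η t (ζ t)
        + ∫ y in square, secondVar f (η t) (ζ t) y * tpartial T (fun s => ζ s y) t)
      (timeInterval T) t := by
  have hjη : ContDiffOn ℝ 3 (fun z : ℝ × R2 => jet (η z.1) z.2) (timeInterval T ×ˢ univ) :=
    RegularElevation.contDiffOn_jet (n := 3) hT hη
  have hjζ : ContDiffOn ℝ 2 (fun z : ℝ × R2 => jet (ζ z.1) z.2) (timeInterval T ×ˢ univ) :=
    RegularElevation.contDiffOn_jet (n := 2) hT hζ
  have hH : ContDiffOn ℝ 2 (fun z : ℝ × R2 => hess f (jet (η z.1) z.2)) (timeInterval T ×ˢ univ) :=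
    ((contDiff_hess hf).of_le ENat.LEInfty.out).comp_contDiffOn (hjη.of_le (by norm_num))
  have hHt : ContDiffOn ℝ 1
      (fun z : ℝ × R2 => tpartial T (fun s => hess f (jet (η s) z.2)) z.1)
      (timeInterval T ×ˢ univ) :=
    contDiffOn_tpartial (n := 1) (G := fun z : ℝ × R2 => hess f (jet (η z.1) z.2)) hT
      uniqueDiffOn_univ (by norm_num; exact hH)
  have hζt : RegularElevation T 3 fun t y => tpartial T (fun s => ζ s y) t := hζ.tpartial hT
  have hjζt : ContDiffOn ℝ 1
      (fun z : ℝ × R2 => jet (fun x => tpartial T (fun s => ζ s x) z.1) z.2)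
      (timeInterval T ×ˢ univ) := RegularElevation.contDiffOn_jet (n := 1) hT hζt
  have h := hasDerivWithinAt_integral_square hT
    (H := fun z : ℝ × R2 => hess f (jet (η z.1) z.2) (jet (ζ z.1) z.2) (jet (ζ z.1) z.2))
    (((hH.clm_apply hjζ).clm_apply hjζ).of_le (by norm_num)) ht
  refine (h.const_mul (1 / 2)).congr_deriv ?_
  have ibp := integral_apply_jet (l := fun y => hess f (jet (η t) y) (jet (ζ t) y))
    ((contDiff_slice hH ht).clm_apply (contDiff_slice hjζ ht))
    (fun x => by
      have h1 := (hη.periodic t ht).jet x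
      have h2 := (hζ.periodic t ht).jet x
      simp only [h1.1, h1.2, h2.1, h2.2, and_self])
    ((hζt.contDiff_space ht).of_le (by norm_num)) (hζt.periodic t ht)
  have hpt : ∀ y, tpartial T
      (fun s => hess f (jet (η s) y) (jet (ζ s) y) (jet (ζ s) y)) t
      = tpartial T (fun s => hess f (jet (η s) y)) t (jet (ζ t) y) (jet (ζ t) y)
        + 2 * hess f (jet (η t) y) (jet (ζ t) y)
          (jet (fun x => tpartial T (fun s => ζ s x) t) y) := by
    intro y
    have d1 := hasDerivWithinAt_tpartial hT
      (hH.differentiableOn (by simp) (t, y) (mk_mem_prod ht (mem_univ y))) ht (mem_univ y)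
    have d2 := hζ.hasDerivWithinAt_jet hT (by norm_num) ht y
    refine tpartial_eq_of_hasDerivWithinAt hT (((d1.clm_apply d2).clm_apply d2).congr_deriv ?_) ht
    rw [_root_.add_apply, hess_symm hf _ (jet (fun x => tpartial T _ t) y)]
    ring
  have c1 : Continuous fun y => tpartial T (fun s => hess f (jet (η s) y)) t (jet (ζ t) y)
      (jet (ζ t) y) :=
    ((contDiff_slice hHt ht).continuous.clm_apply (contDiff_slice hjζ ht).continuous).clm_apply
      (contDiff_slice hjζ ht).continuous
  have c2 : Continuous fun y => hess f (jet (η t) y) (jet (ζ t) y)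
      (jet (fun x => tpartial T (fun s => ζ s x) t) y) :=
    ((contDiff_slice hH ht).continuous.clm_apply (contDiff_slice hjζ ht).continuous).clm_apply
      (contDiff_slice hjζt ht).continuous
  have c3 := integral_add (integrableOn_square c1)
    (integrableOn_square (continuous_const (y := (2 : ℝ)).mul c2))
  simp only [Pi.mul_apply] at c3
  simp only [hpt]
  rw [c3, integral_const_mul, ibp]
  unfold quadWdot secondVar
  ring

end SurfaceEnergy

/-! ### Fourier coefficients on the torus -/

/-- The linear phase `k ⬝ y`. -/
def phase (k : Fin 2 → ℤ) : R2 →L[ℝ] ℝ :=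
  (k 0 : ℝ) • ContinuousLinearMap.proj 0 + (k 1 : ℝ) • ContinuousLinearMap.proj 1

theorem phase_apply (k : Fin 2 → ℤ) (y : R2) : phase k y = (k 0 : ℝ) * y 0 + (k 1 : ℝ) * y 1 := by
  simp [phase]

theorem phase_single (k : Fin 2 → ℤ) (i : Fin 2) : phase k (Pi.single i 1) = k i := by
  rw [phase_apply]; fin_cases i <;> simp

/-- The character `exp (-2π i k ⬝ y)`. -/
def character (k : Fin 2 → ℤ) (y : R2) : ℂ :=
  Complex.exp (-(2 * Real.pi * Complex.I * ((phase k y : ℝ) : ℂ)))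

theorem fourierCoeffTorus_eq (h : R2 → ℝ) (k : Fin 2 → ℤ) :
    fourierCoeffTorus h k = ∫ y in square, (h y : ℂ) * character k y := by
  simp only [fourierCoeffTorus, character, phase_apply]

theorem contDiff_character {n : WithTop ℕ∞} (k : Fin 2 → ℤ) : ContDiff ℝ n (character k) :=
  ((contDiff_const.mul (Complex.ofRealCLM.contDiff.comp (phase k).contDiff)).neg).cexp

theorem hasFDerivAt_character (k : Fin 2 → ℤ) (y : R2) :
    HasFDerivAt (character k)
      (character k y • -((2 * Real.pi * Complex.I : ℂ) •
        (Complex.ofRealCLM.comp (phase k)))) y :=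
  (((Complex.ofRealCLM.comp (phase k)).hasFDerivAt.const_mul
    (2 * Real.pi * Complex.I : ℂ)).neg).cexp

theorem norm_character (k : Fin 2 → ℤ) (y : R2) : ‖character k y‖ = 1 := by
  rw [character, Complex.norm_exp]; simp

theorem periodic_character (k : Fin 2 → ℤ) : PeriodicOnPlane (character k) := by
  have key : ∀ (i : Fin 2) (y : R2), character k (y + Pi.single i 1) = character k y := by
    intro i y
    unfold character
    rw [map_add, phase_single, Complex.exp_eq_exp_iff_exists_int]
    exact ⟨-k i, by push_cast; ring⟩
  exact fun y => ⟨key 0 y, key 1 y⟩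

/-- A horizontal derivative multiplies the `k`-th Fourier coefficient by `2π i kᵢ`. -/
theorem fourierCoeffTorus_hpartial {h : R2 → ℝ} (hh : ContDiff ℝ 1 h) (hp : PeriodicOnPlane h)
    (i : Fin 2) (k : Fin 2 → ℤ) :
    fourierCoeffTorus (hpartial i h) k
      = (2 * Real.pi * Complex.I * (k i : ℂ)) * fourierCoeffTorus h k := by
  have hc : ContDiff ℝ 1 fun y => (h y : ℂ) := Complex.ofRealCLM.contDiff.comp hh
  have h0 := integral_square_fderiv_eq_zero (hc.mul (contDiff_character k))
    (fun y => by simp only [(hp y).1, (hp y).2, (periodic_character k y).1,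
      (periodic_character k y).2, and_self]) i
  have h1 : ∀ y, fderiv ℝ (fun y => (h y : ℂ) * character k y) y (Pi.single i 1)
      = (hpartial i h y : ℂ) * character k y
        - (2 * Real.pi * Complex.I * (k i : ℂ)) * ((h y : ℂ) * character k y) := by
    intro y
    have d1 : HasFDerivAt (fun y => (h y : ℂ)) (Complex.ofRealCLM.comp (fderiv ℝ h y)) y :=
      Complex.ofRealCLM.hasFDerivAt.comp y (hh.differentiable (by simp) y).hasFDerivAt
    refine (congrArg (fun L : R2 →L[ℝ] ℂ => L (Pi.single i 1))
      (d1.mul (hasFDerivAt_character k y)).fderiv).trans ?_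
    simp [phase_single, hpartial]
    ring
  have c1 : Continuous fun y => (hpartial i h y : ℂ) * character k y :=
    (Complex.continuous_ofReal.comp
      (contDiff_hpartial (n := 0) (by simpa using hh) i).continuous).mul
      (contDiff_character (n := 0) k).continuous
  have c2 : Continuous fun y => (2 * Real.pi * Complex.I * (k i : ℂ)) *
      ((h y : ℂ) * character k y) :=
    continuous_const.mul (hc.continuous.mul (contDiff_character (n := 0) k).continuous)
  have h2 : ∫ y in square, ((hpartial i h y : ℂ) * character k y
        - (2 * Real.pi * Complex.I * (k i : ℂ)) * ((h y : ℂ) * character k y)) = 0 := by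
    rw [← h0]
    exact integral_congr_ae (Eventually.of_forall fun y => (h1 y).symm)
  rw [integral_sub (integrableOn_square c1) (integrableOn_square c2), integral_const_mul,
    sub_eq_zero] at h2
  rw [fourierCoeffTorus_eq, fourierCoeffTorus_eq]
  exact h2

theorem norm_fourierCoeffTorus_le {h : R2 → ℝ} {M : ℝ} (hM : ∀ y ∈ square, |h y| ≤ M)
    (k : Fin 2 → ℤ) : ‖fourierCoeffTorus h k‖ ≤ M * volume.real square := by
  rw [fourierCoeffTorus_eq]
  refine norm_setIntegral_le_of_norm_le_const ?_ fun y hy => ?_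
  · exact (measure_mono square_subset_Icc).trans_lt isCompact_Icc.measure_lt_top
  · rw [norm_mul, norm_character, mul_one, Complex.norm_real]; exact hM y hy

section Decay

variable {T : EReal} {n : ℕ} {η : ℝ → R2 → ℝ} {t t₁ : ℝ}

/-- Each derivative in the `i`-th direction gains a factor `|kᵢ|`, with constants that are uniform on
compact time intervals. -/
theorem RegularElevation.exists_coordinate_decay (hT : 0 < T) (m : ℕ)
    (hη : RegularElevation T m η) (ht₁ : t₁ ∈ timeInterval T) (i : Fin 2) :
    ∃ C, ∀ s ∈ Icc 0 t₁, ∀ k : Fin 2 → ℤ,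
      |(k i : ℝ)| ^ m * ‖fourierCoeffTorus (η s) k‖ ≤ C := by
  induction m generalizing η with
  | zero =>
    obtain ⟨M, hM⟩ := (isCompact_Icc.prod isCompact_Icc).exists_bound_of_continuousOn
      (hη.contDiff.continuousOn.mono (prod_mono (Icc_subset_timeInterval ht₁)
        (subset_univ (Icc (0 : R2) 1))))
    refine ⟨M * volume.real square, fun s hs k => ?_⟩
    simpa using norm_fourierCoeffTorus_le
      (fun y hy => hM (s, y) (mk_mem_prod hs (square_subset_Icc hy))) k
  | succ m ih =>
    obtain ⟨C, hC⟩ := ih (hη.hpartial hT i)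
    refine ⟨C, fun s hs k => le_trans ?_ (hC s hs k)⟩
    have hsI := Icc_subset_timeInterval ht₁ hs
    rw [fourierCoeffTorus_hpartial ((hη.of_le (by omega : 1 ≤ m + 1)).contDiff_space hsI)
      (hη.periodic s hsI), norm_mul]
    have e : ‖(2 * Real.pi * Complex.I * (k i : ℂ))‖ = 2 * Real.pi * |(k i : ℝ)| := by
      simp [abs_of_pos Real.pi_pos]
    rw [e, pow_succ]
    have hp : (1 : ℝ) ≤ 2 * Real.pi := by linarith [Real.pi_gt_three]
    have h0 : 0 ≤ |(k i : ℝ)| ^ m * |(k i : ℝ)| * ‖fourierCoeffTorus (η s) k‖ := by positivity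
    nlinarith

/-- The Fourier coefficients of a `C^m` elevation are `O((1 + ‖k‖)^{-m})`, locally uniformly in
time. -/
theorem RegularElevation.exists_decay (hT : 0 < T) {m : ℕ}
    (hη : RegularElevation T m η) (ht₁ : t₁ ∈ timeInterval T) :
    ∃ C, ∀ s ∈ Icc 0 t₁, ∀ k : Fin 2 → ℤ,
      ‖fourierCoeffTorus (η s) k‖ * (1 + ‖k‖) ^ m ≤ C := by
  obtain ⟨C0, h0⟩ := hη.exists_coordinate_decay hT m ht₁ 0
  obtain ⟨C1, h1⟩ := hη.exists_coordinate_decay hT m ht₁ 1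
  obtain ⟨C2, h2⟩ := (hη.of_le (Nat.zero_le m)).exists_coordinate_decay hT 0 ht₁ 0
  refine ⟨2 ^ m * (|C0| + |C1| + |C2|), fun s hs k => ?_⟩
  set c := ‖fourierCoeffTorus (η s) k‖ with hc
  have hc0 : 0 ≤ c := norm_nonneg _
  have b2 : c ≤ |C2| := (by simpa using h2 s hs k : c ≤ C2).trans (le_abs_self _)
  -- use the decay in the direction of the larger component of `k`
  have bk : ‖k‖ ^ m * c ≤ |C0| + |C1| := by
    obtain ⟨i, hi⟩ : ∃ i, ‖k‖ = |(k i : ℝ)| := by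
      obtain ⟨i, -, hi⟩ := Finset.exists_mem_eq_sup' (Finset.univ_nonempty (α := Fin 2))
        (fun i => ‖k i‖₊)
      refine ⟨i, ?_⟩
      rw [Pi.norm_def, ← Finset.sup'_eq_sup Finset.univ_nonempty, hi]
      simp [Int.norm_eq_abs]
    rw [hi]
    fin_cases i
    · exact (h0 s hs k).trans ((le_abs_self _).trans (by simp))
    · exact (h1 s hs k).trans ((le_abs_self _).trans (by simp))
  have hpow : (1 + ‖k‖) ^ m ≤ 2 ^ m * (1 + ‖k‖ ^ m) := by
    rcases le_total ‖k‖ 1 with h | h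
    · calc (1 + ‖k‖) ^ m ≤ 2 ^ m := pow_le_pow_left₀ (by positivity) (by linarith) m
        _ ≤ 2 ^ m * (1 + ‖k‖ ^ m) := le_mul_of_one_le_right (by positivity)
            (by linarith [pow_nonneg (norm_nonneg k) m])
    · calc (1 + ‖k‖) ^ m ≤ (2 * ‖k‖) ^ m := pow_le_pow_left₀ (by positivity) (by linarith) m
        _ = 2 ^ m * ‖k‖ ^ m := mul_pow _ _ _
        _ ≤ 2 ^ m * (1 + ‖k‖ ^ m) := by gcongr; linarith
  calc c * (1 + ‖k‖) ^ m ≤ c * (2 ^ m * (1 + ‖k‖ ^ m)) := by gcongr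
    _ = 2 ^ m * (c + ‖k‖ ^ m * c) := by ring
    _ ≤ 2 ^ m * (|C0| + |C1| + |C2|) :=
        mul_le_mul_of_nonneg_left (by linarith) (by positivity)

theorem summable_one_add_norm_inv_pow : Summable fun k : Fin 2 → ℤ => ((1 + ‖k‖) ^ 3)⁻¹ := by
  have h := EisensteinSeries.summable_one_div_norm_rpow (k := 3) (by norm_num)
  -- at `k = 0` the majorant `‖k‖ ^ (-3)` has the value `0`, so the comparison excludes that index
  refine Summable.of_norm_bounded_eventually h ?_
  have hfin : ({0} : Set (Fin 2 → ℤ)).Finite := finite_singleton 0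
  filter_upwards [hfin.compl_mem_cofinite] with k hk
  have hk0 : 0 < ‖k‖ := norm_pos_iff.2 hk
  rw [Real.rpow_neg (norm_nonneg k), Real.norm_of_nonneg (by positivity)]
  have e : ‖k‖ ^ (3 : ℝ) = ‖k‖ ^ 3 := by exact_mod_cast Real.rpow_natCast ‖k‖ 3
  rw [e]
  gcongr
  linarith

theorem norm_mul_pow_le_of_decay {c : (Fin 2 → ℤ) → ℂ} {C : ℝ} {j : ℕ} {k : Fin 2 → ℤ}
    (hc : ‖c k‖ * (1 + ‖k‖) ^ (j + 3) ≤ C) :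
    ‖c k‖ * (1 + ‖k‖) ^ j ≤ C * ((1 + ‖k‖) ^ 3)⁻¹ := by
  rw [← div_eq_mul_inv, le_div_iff₀ (by positivity), mul_assoc, ← pow_add]
  exact hc

theorem RegularElevation.summable_fourierCoeff (hT : 0 < T) {j : ℕ}
    (hη : RegularElevation T (j + 3) η) (ht : t ∈ timeInterval T) :
    Summable fun k => ‖fourierCoeffTorus (η t) k‖ * (1 + ‖k‖) ^ j := by
  obtain ⟨C, hC⟩ := hη.exists_decay hT ht
  refine Summable.of_nonneg_of_le (fun k => by positivity)
    (fun k => norm_mul_pow_le_of_decay (hC t ⟨ht.1, le_rfl⟩ k))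
    (summable_one_add_norm_inv_pow.mul_left C)

theorem RegularElevation.hasDerivWithinAt_fourierCoeff (hT : 0 < T)
    (hη : RegularElevation T n η) (hn : 1 ≤ n) (ht : t ∈ timeInterval T) (k : Fin 2 → ℤ) :
    HasDerivWithinAt (fun s => fourierCoeffTorus (η s) k)
      (fourierCoeffTorus (fun y => FreeSurface.tpartial T (fun s => η s y) t) k)
      (timeInterval T) t := by
  have hη1 := hη.of_le hn
  have h := hasDerivWithinAt_integral_square hT
    (H := fun z : ℝ × R2 => (η z.1 z.2 : ℂ) * character k z.2)
    ((Complex.ofRealCLM.contDiff.comp_contDiffOn hη1.contDiff).mul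
      ((contDiff_character k).comp contDiff_snd).contDiffOn) ht
  simp only [fourierCoeffTorus_eq]
  refine h.congr_deriv (integral_congr_ae (Eventually.of_forall fun y => ?_))
  exact tpartial_eq_of_hasDerivWithinAt hT
    ((hη1.hasDerivWithinAt hT le_rfl ht y).ofReal_comp.mul_const (character k y)) ht

end Decay

/-! ### Fourier inversion -/

theorem PeriodicOnPlane.eq_of_coe_eq {F : Type*} {h : R2 → F} (hp : PeriodicOnPlane h) {x y : R2}
    (hxy : ∀ i, (x i : UnitAddCircle) = (y i : UnitAddCircle)) : h x = h y := by
  have h0 : Function.Periodic h (Pi.single 0 1) := fun x => (hp x).1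
  have h1 : Function.Periodic h (Pi.single 1 1) := fun x => (hp x).2
  have hm : ∀ i, ∃ m : ℤ, x i = y i + m := by
    intro i
    have h := hxy i
    rw [QuotientAddGroup.eq_iff_sub_mem, AddSubgroup.mem_zmultiples_iff] at h
    obtain ⟨m, hm⟩ := h
    exact ⟨m, by simp at hm; linarith⟩
  obtain ⟨m0, e0⟩ := hm 0
  obtain ⟨m1, e1⟩ := hm 1
  have hx : x = y + m0 • (Pi.single 0 1 : R2) + m1 • (Pi.single 1 1 : R2) := by
    ext i; fin_cases i
    · simpa using e0
    · simpa using e1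
  rw [hx, h1.zsmul m1, h0.zsmul m0]

/-- A periodic continuous function as a continuous function on Mathlib's torus. -/
theorem exists_torus_lift {h : R2 → ℝ} (hh : Continuous h) (hp : PeriodicOnPlane h) :
    ∃ f : C(UnitAddTorus (Fin 2), ℂ), ∀ x : R2, f (fun i => (x i : UnitAddCircle)) = (h x : ℂ) := by
  have hq : IsOpenQuotientMap (Pi.map fun (_ : Fin 2) (x : ℝ) => (x : UnitAddCircle)) :=
    IsOpenQuotientMap.piMap fun _ => QuotientAddGroup.isOpenQuotientMap_mk
  let p : C(R2, UnitAddTorus (Fin 2)) := ⟨_, hq.continuous⟩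
  let g : C(R2, ℂ) := ⟨fun x => (h x : ℂ), Complex.continuous_ofReal.comp hh⟩
  have hfac : Function.FactorsThrough g p := fun x y hxy => by
    have := hp.eq_of_coe_eq fun i => congrFun hxy i
    simp [g, this]
  have hq' : Topology.IsQuotientMap p := hq.isQuotientMap
  refine ⟨hq'.lift g hfac, fun x => ?_⟩
  exact congrArg (fun F : C(R2, ℂ) => F x) (hq'.lift_comp g hfac)

theorem mFourier_coe (k : Fin 2 → ℤ) (x : R2) :
    UnitAddTorus.mFourier k (fun i => (x i : UnitAddCircle))
      = Complex.exp (2 * Real.pi * Complex.I * (((k 0 : ℝ) * x 0 + (k 1 : ℝ) * x 1 : ℝ) : ℂ)) := by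
  simp only [UnitAddTorus.mFourier, ContinuousMap.coe_mk, Fin.prod_univ_two, fourier_coe_apply]
  rw [← Complex.exp_add]
  congr 1
  push_cast
  ring

/-- Fourier inversion on the torus for summable coefficients. -/
theorem hasSum_fourierCoeffTorus {h : R2 → ℝ} (hh : Continuous h) (hp : PeriodicOnPlane h)
    (hs : Summable fun k => ‖fourierCoeffTorus h k‖) (y : R2) :
    HasSum (fun k => fourierCoeffTorus h k * Complex.exp (2 * Real.pi * Complex.I *
      (((k 0 : ℝ) * y 0 + (k 1 : ℝ) * y 1 : ℝ) : ℂ))) (h y : ℂ) := by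
  obtain ⟨f, hf⟩ := exists_torus_lift hh hp
  have hcoef : ∀ k, UnitAddTorus.mFourierCoeff f k = fourierCoeffTorus h k := by
    intro k
    unfold UnitAddTorus.mFourierCoeff
    rw [UnitAddTorus.integral_preimage _ (0 : Fin 2 → ℝ), fourierCoeffTorus_eq]
    have hset : {x : Fin 2 → ℝ | ∀ i, x i ∈ Ioc ((0 : Fin 2 → ℝ) i) ((0 : Fin 2 → ℝ) i + 1)}
        = univ.pi fun _ : Fin 2 => Ioc (0 : ℝ) 1 := by
      ext x; simp
    have hae : (univ.pi fun _ : Fin 2 => Ioc (0 : ℝ) 1) =ᵐ[volume] square := by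
      refine EventuallyEq.trans ?_ square_ae_eq_Icc.symm
      exact Measure.univ_pi_Ioc_ae_eq_Icc (μ := fun _ : Fin 2 => (volume : Measure ℝ))
        (f := 0) (g := 1)
    rw [hset, setIntegral_congr_set hae]
    refine integral_congr_ae (Eventually.of_forall fun x => ?_)
    beta_reduce
    rw [hf, mFourier_coe, smul_eq_mul, mul_comm, character, phase_apply]
    congr 2
    simp only [Pi.neg_apply]
    push_cast
    ring
  have hsum : Summable (UnitAddTorus.mFourierCoeff f) := by
    rw [funext hcoef]
    exact hs.of_norm
  have key := UnitAddTorus.hasSum_mFourier_series_apply_of_summable hsum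
    (fun i => (y i : UnitAddCircle))
  simpa only [hcoef, mFourier_coe, hf, smul_eq_mul] using key

/-! ### Harmonic extension up to the boundary -/

/-- A smooth function with bounded derivatives that agrees with `exp` on `(-∞, 0]`. -/
def cutExp (s : ℝ) : ℝ := Real.exp s * Real.smoothTransition (1 - s)

theorem cutExp_of_nonpos {s : ℝ} (hs : s ≤ 0) : cutExp s = Real.exp s := by
  rw [cutExp, Real.smoothTransition.one_of_one_le (by linarith), mul_one]

theorem contDiff_cutExp (n : ℕ) : ContDiff ℝ n cutExp :=
  Real.contDiff_exp.mul (Real.smoothTransition.contDiff.comp (contDiff_const.sub contDiff_id))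

theorem exists_bound_iteratedDeriv_cutExp (n : ℕ) : ∃ C, ∀ s, ‖iteratedDeriv n cutExp s‖ ≤ C := by
  obtain ⟨M, hM⟩ := (isCompact_Icc (a := (0 : ℝ)) (b := 1)).exists_bound_of_continuousOn
    ((contDiff_cutExp n).continuous_iteratedDeriv n le_rfl).continuousOn
  refine ⟨max M 1, fun s => ?_⟩
  rcases lt_or_ge s 0 with h | h
  · have he : cutExp =ᶠ[𝓝 s] Real.exp := by
      filter_upwards [Iio_mem_nhds h] with r hr using cutExp_of_nonpos (le_of_lt hr)
    rw [he.iteratedDeriv_eq, iteratedDeriv_eq_iterate, Real.iter_deriv_exp,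
      Real.norm_of_nonneg (Real.exp_pos s).le]
    exact (Real.exp_le_one_iff.2 h.le).trans (le_max_right _ _)
  rcases le_or_gt s 1 with h1 | h1
  · exact (hM s ⟨h, h1⟩).trans (le_max_left _ _)
  · have he : cutExp =ᶠ[𝓝 s] fun _ => (0 : ℝ) := by
      filter_upwards [Ioi_mem_nhds h1] with r hr
      rw [cutExp, Real.smoothTransition.zero_of_nonpos (by linarith [mem_Ioi.1 hr]), mul_zero]
    rw [he.iteratedDeriv_eq]
    simp

theorem iteratedDeriv_exp_mul_I (n : ℕ) :
    iteratedDeriv n (fun φ : ℝ => Complex.exp (φ * Complex.I))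
      = fun φ : ℝ => Complex.I ^ n * Complex.exp (φ * Complex.I) := by
  induction n with
  | zero => simp
  | succ n ih =>
    rw [iteratedDeriv_succ, ih]
    funext φ
    have h : HasDerivAt (fun φ : ℝ => Complex.exp (φ * Complex.I))
        (Complex.exp (φ * Complex.I) * (1 * Complex.I)) φ :=
      ((hasDerivAt_id φ).ofReal_comp.mul_const Complex.I).cexp
    rw [(h.const_mul (Complex.I ^ n)).deriv, pow_succ]
    ring

/-- The profile `(s, φ) ↦ e^s e^{iφ}` of all harmonic modes, cut off for `s > 0`. -/
def profile (z : ℝ × ℝ) : ℂ := (cutExp z.1 : ℂ) * Complex.exp (z.2 * Complex.I)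

theorem contDiff_profile_fst (n : ℕ) : ContDiff ℝ n fun s : ℝ => (cutExp s : ℂ) :=
  Complex.ofRealCLM.contDiff.comp (contDiff_cutExp n)

theorem contDiff_exp_mul_I (n : ℕ) : ContDiff ℝ n fun φ : ℝ => Complex.exp (φ * Complex.I) :=
  (Complex.ofRealCLM.contDiff.mul contDiff_const).cexp

theorem contDiff_profile (n : ℕ) : ContDiff ℝ n profile :=
  ((contDiff_profile_fst n).comp contDiff_fst).mul ((contDiff_exp_mul_I n).comp contDiff_snd)

theorem norm_iteratedFDeriv_comp_clm_le {E F G : Type*} [NormedAddCommGroup E] [NormedSpace ℝ E]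
    [NormedAddCommGroup F] [NormedSpace ℝ F] [NormedAddCommGroup G] [NormedSpace ℝ G] {n : ℕ}
    {f : F → G} (hf : ContDiff ℝ n f) (L : E →L[ℝ] F) (x : E) :
    ‖iteratedFDeriv ℝ n (fun y => f (L y)) x‖ ≤ ‖iteratedFDeriv ℝ n f (L x)‖ * ‖L‖ ^ n := by
  have h := L.iteratedFDeriv_comp_right hf x (i := n) le_rfl
  change ‖iteratedFDeriv ℝ n (f ∘ L) x‖ ≤ _
  rw [h]
  refine (ContinuousMultilinearMap.norm_compContinuousLinearMap_le _ _).trans ?_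
  simp

theorem exists_bound_iteratedFDeriv_profile (n : ℕ) :
    ∃ C, 0 ≤ C ∧ ∀ z, ‖iteratedFDeriv ℝ n profile z‖ ≤ C := by
  choose B hB using exists_bound_iteratedDeriv_cutExp
  have hB0 : ∀ m, 0 ≤ B m := fun m => (norm_nonneg _).trans (hB m 0)
  refine ⟨∑ i ∈ Finset.range (n + 1), (n.choose i : ℝ) * B i * 1,
    Finset.sum_nonneg fun i _ => by have := hB0 i; positivity, fun z => ?_⟩
  refine (norm_iteratedFDeriv_mul_le (N := n)
    ((contDiff_profile_fst n).comp contDiff_fst) ((contDiff_exp_mul_I n).comp contDiff_snd) z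
    le_rfl).trans (Finset.sum_le_sum fun i _ => ?_)
  have h1 : ‖iteratedFDeriv ℝ i (fun y : ℝ × ℝ => (cutExp y.1 : ℂ)) z‖ ≤ B i := by
    refine (norm_iteratedFDeriv_comp_clm_le (contDiff_profile_fst i)
      (ContinuousLinearMap.fst ℝ ℝ ℝ) z).trans ?_
    have e1 : ‖iteratedFDeriv ℝ i (fun s : ℝ => (cutExp s : ℂ)) z.1‖ ≤ B i := by
      refine (Complex.ofRealCLM.norm_iteratedFDeriv_comp_left (N := i)
        (contDiff_cutExp i).contDiffAt le_rfl).trans ?_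
      rw [Complex.ofRealCLM_norm, one_mul, norm_iteratedFDeriv_eq_norm_iteratedDeriv]
      exact hB i z.1
    calc _ ≤ B i * 1 ^ i := by
          gcongr
          · exact hB0 i
          · exact e1
          · exact ContinuousLinearMap.norm_fst_le ..
      _ = B i := by simp
  have h2 : ‖iteratedFDeriv ℝ (n - i) (fun y : ℝ × ℝ => Complex.exp (y.2 * Complex.I)) z‖ ≤ 1 := by
    refine (norm_iteratedFDeriv_comp_clm_le (contDiff_exp_mul_I (n - i))
      (ContinuousLinearMap.snd ℝ ℝ ℝ) z).trans ?_
    rw [norm_iteratedFDeriv_eq_norm_iteratedDeriv, iteratedDeriv_exp_mul_I]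
    simp only [norm_mul, norm_pow, Complex.norm_I, one_pow, Complex.norm_exp_ofReal_mul_I, mul_one,
      one_mul]
    exact pow_le_one₀ (norm_nonneg _) (ContinuousLinearMap.norm_snd_le ..)
  have := hB0 i
  exact mul_le_mul (mul_le_mul_of_nonneg_left h1 (by positivity)) h2 (norm_nonneg _)
    (by positivity)

/-- The linear map `x ↦ (2π |k| x₃, 2π k ⬝ (x₁, x₂))`. -/
def modeArg (k : Fin 2 → ℤ) : R3 →L[ℝ] ℝ × ℝ :=
  ((2 * Real.pi * Real.sqrt ((k 0 : ℝ) ^ 2 + (k 1 : ℝ) ^ 2)) •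
    (ContinuousLinearMap.proj 2 : R3 →L[ℝ] ℝ)).prod
  ((2 * Real.pi * (k 0 : ℝ)) • (ContinuousLinearMap.proj 0 : R3 →L[ℝ] ℝ)
    + (2 * Real.pi * (k 1 : ℝ)) • (ContinuousLinearMap.proj 1 : R3 →L[ℝ] ℝ))

theorem modeArg_apply (k : Fin 2 → ℤ) (x : R3) :
    modeArg k x = (2 * Real.pi * Real.sqrt ((k 0 : ℝ) ^ 2 + (k 1 : ℝ) ^ 2) * x 2,
      2 * Real.pi * (k 0 : ℝ) * x 0 + 2 * Real.pi * (k 1 : ℝ) * x 1) := by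
  simp [modeArg]

theorem norm_modeArg_le (k : Fin 2 → ℤ) : ‖modeArg k‖ ≤ 4 * Real.pi * (1 + ‖k‖) := by
  refine ContinuousLinearMap.opNorm_le_bound _ (by positivity) fun x => ?_
  have hπ := Real.pi_pos
  have h0 : |(k 0 : ℝ)| ≤ ‖k‖ := by simpa [Int.norm_eq_abs] using norm_le_pi_norm k 0
  have h1 : |(k 1 : ℝ)| ≤ ‖k‖ := by simpa [Int.norm_eq_abs] using norm_le_pi_norm k 1
  have x0 : |x 0| ≤ ‖x‖ := norm_le_pi_norm x 0
  have x1 : |x 1| ≤ ‖x‖ := norm_le_pi_norm x 1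
  have x2 : |x 2| ≤ ‖x‖ := norm_le_pi_norm x 2
  have hk := norm_nonneg k
  have hx := norm_nonneg x
  have hs : Real.sqrt ((k 0 : ℝ) ^ 2 + (k 1 : ℝ) ^ 2) ≤ 2 * ‖k‖ := by
    refine Real.sqrt_le_iff.2 ⟨by positivity, ?_⟩
    rw [← sq_abs (k 0 : ℝ), ← sq_abs (k 1 : ℝ)]
    nlinarith [abs_nonneg (k 0 : ℝ), abs_nonneg (k 1 : ℝ)]
  have hle : 4 * Real.pi * (‖k‖ * ‖x‖) ≤ 4 * Real.pi * (1 + ‖k‖) * ‖x‖ := by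
    have : 0 ≤ 4 * Real.pi * ‖x‖ := by positivity
    linarith
  rw [modeArg_apply, Prod.norm_def]
  refine max_le (le_trans ?_ hle) (le_trans ?_ hle)
  · rw [Real.norm_eq_abs, abs_mul, abs_of_nonneg (by positivity)]
    calc _ ≤ 2 * Real.pi * (2 * ‖k‖) * ‖x‖ := by gcongr
      _ = _ := by ring
  · rw [Real.norm_eq_abs]
    refine (abs_add_le _ _).trans ?_
    simp only [abs_mul, abs_two, abs_of_pos hπ]
    calc _ ≤ 2 * Real.pi * ‖k‖ * ‖x‖ + 2 * Real.pi * ‖k‖ * ‖x‖ := by gcongr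
      _ = _ := by ring

/-- The `k`-th harmonic mode `exp (2π |k| x₃) exp (2π i k ⬝ (x₁, x₂))`, continued smoothly, and with
bounded derivatives, from the lower half-space to the whole space. -/
def mode (k : Fin 2 → ℤ) (x : R3) : ℂ := profile (modeArg k x)

theorem contDiff_mode (n : ℕ) (k : Fin 2 → ℤ) : ContDiff ℝ n (mode k) :=
  (contDiff_profile n).comp (modeArg k).contDiff

theorem exists_bound_iteratedFDeriv_mode (n : ℕ) :
    ∃ C, 0 ≤ C ∧ ∀ k x, ‖iteratedFDeriv ℝ n (mode k) x‖ ≤ C * (1 + ‖k‖) ^ n := by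
  obtain ⟨C, hC0, hC⟩ := exists_bound_iteratedFDeriv_profile n
  refine ⟨C * (4 * Real.pi) ^ n, by positivity, fun k x => ?_⟩
  refine (norm_iteratedFDeriv_comp_clm_le (contDiff_profile n) (modeArg k) x).trans ?_
  rw [mul_assoc, ← mul_pow]
  exact mul_le_mul (hC _) (pow_le_pow_left₀ (norm_nonneg _) (norm_modeArg_le k) n)
    (by positivity) hC0

theorem exists_bound_mode : ∃ C, 0 ≤ C ∧ ∀ k x, ‖mode k x‖ ≤ C := by
  obtain ⟨C, h0, h⟩ := exists_bound_iteratedFDeriv_mode 0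
  exact ⟨C, h0, fun k x => by simpa using h k x⟩

theorem exists_bound_fderiv_mode : ∃ C, 0 ≤ C ∧ ∀ k x, ‖fderiv ℝ (mode k) x‖ ≤ C * (1 + ‖k‖) := by
  obtain ⟨C, h0, h⟩ := exists_bound_iteratedFDeriv_mode 1
  exact ⟨C, h0, fun k x => by simpa [norm_iteratedFDeriv_one] using h k x⟩

theorem mode_add_single {j : Fin 3} (hj : j ≠ 2) (k : Fin 2 → ℤ) (x : R3) :
    mode k (x + Pi.single j 1) = mode k x := by
  have h2 : (Pi.single j (1 : ℝ) : R3) 2 = 0 := by simp [hj.symm]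
  simp only [mode, profile, modeArg_apply, Pi.add_apply, h2, add_zero]
  congr 1
  rw [Complex.exp_eq_exp_iff_exists_int]
  fin_cases j
  · exact ⟨k 0, by push_cast; simp; ring⟩
  · exact ⟨k 1, by push_cast; simp; ring⟩
  · exact absurd rfl hj

/-- The harmonic extension, continued to the whole space as a function with the regularity it has on
the closed lower half-space. -/
def fullExt (h : R2 → ℝ) (x : R3) : ℝ := (∑' k, fourierCoeffTorus h k * mode k x).re

theorem harmExt_eq_fullExt (h : R2 → ℝ) {x : R3} (hx : x 2 ≤ 0) : harmExt h x = fullExt h x := by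
  unfold harmExt fullExt
  congr 1
  refine tsum_congr fun k => ?_
  rw [mul_assoc, mode, profile, modeArg_apply, cutExp_of_nonpos
    (mul_nonpos_of_nonneg_of_nonpos (by positivity) hx), Complex.ofReal_exp]
  congr 3
  push_cast
  ring

theorem fullExt_add_single {j : Fin 3} (hj : j ≠ 2) (h : R2 → ℝ) (x : R3) :
    fullExt h (x + Pi.single j 1) = fullExt h x := by
  simp only [fullExt, mode_add_single hj]

theorem fullExt_atHeight_zero {h : R2 → ℝ} (hh : Continuous h) (hp : PeriodicOnPlane h)
    (hs : Summable fun k => ‖fourierCoeffTorus h k‖) (y : R2) : fullExt h (atHeight 0 y) = h y := by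
  unfold fullExt
  have e : ∀ k, mode k (atHeight 0 y) = Complex.exp (2 * Real.pi * Complex.I *
      (((k 0 : ℝ) * y 0 + (k 1 : ℝ) * y 1 : ℝ) : ℂ)) := by
    intro k
    rw [mode, profile, modeArg_apply, cutExp_of_nonpos (by simp [atHeight])]
    simp only [atHeight, Matrix.cons_val, mul_zero, Real.exp_zero, Complex.ofReal_one, one_mul]
    congr 1
    push_cast
    ring
  simp only [e]
  rw [(hasSum_fourierCoeffTorus hh hp hs y).tsum_eq, Complex.ofReal_re]

section FullExt

variable {T : EReal} {n : ℕ} {η : ℝ → R2 → ℝ} {t t₁ : ℝ}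

/-- Three derivatives are spent on the summability of `(1 + ‖k‖)⁻³`; the others pass to the
extension. -/
theorem RegularElevation.contDiff_fullExt (hT : 0 < T) (hη : RegularElevation T (n + 3) η)
    (ht : t ∈ timeInterval T) : ContDiff ℝ n (fullExt (η t)) := by
  refine Complex.reCLM.contDiff.comp ?_
  choose B hB0 hB using exists_bound_iteratedFDeriv_mode
  refine contDiff_tsum (N := n)
    (v := fun m k => B m * (‖fourierCoeffTorus (η t) k‖ * (1 + ‖k‖) ^ m))
    (fun k => contDiff_const.mul (contDiff_mode n k)) (fun m hm => ?_) (fun m k x hm => ?_)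
  · have hm' : m ≤ n := by exact_mod_cast hm
    exact ((hη.of_le (by omega : m + 3 ≤ n + 3)).summable_fourierCoeff hT ht).mul_left (B m)
  · change ‖iteratedFDeriv ℝ m (fourierCoeffTorus (η t) k • mode k) x‖ ≤ _
    rw [iteratedFDeriv_const_smul_apply (contDiff_mode m k).contDiffAt, norm_smul]
    calc _ ≤ ‖fourierCoeffTorus (η t) k‖ * (B m * (1 + ‖k‖) ^ m) :=
          mul_le_mul_of_nonneg_left (hB m k x) (norm_nonneg _)
      _ = _ := by ring

theorem RegularElevation.fderiv_fullExt (hT : 0 < T) (hη : RegularElevation T 4 η)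
    (ht : t ∈ timeInterval T) (x v : R3) :
    fderiv ℝ (fullExt (η t)) x v
      = (∑' k, fourierCoeffTorus (η t) k * fderiv ℝ (mode k) x v).re := by
  obtain ⟨B, hB0, hB⟩ := exists_bound_fderiv_mode
  obtain ⟨B', hB0', hB'⟩ := exists_bound_mode
  have hs1 := (RegularElevation.summable_fourierCoeff (j := 1) hT hη ht).mul_left B
  have hd : ∀ k x, HasFDerivAt (fun x => fourierCoeffTorus (η t) k * mode k x)
      (fourierCoeffTorus (η t) k • fderiv ℝ (mode k) x) x := fun k x =>
    ((contDiff_mode 1 k).differentiable (by simp) x).hasFDerivAt.const_mul _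
  have hle : ∀ k x, ‖fourierCoeffTorus (η t) k • fderiv ℝ (mode k) x‖
      ≤ B * (‖fourierCoeffTorus (η t) k‖ * (1 + ‖k‖) ^ 1) := by
    intro k x
    rw [norm_smul]
    calc _ ≤ ‖fourierCoeffTorus (η t) k‖ * (B * (1 + ‖k‖)) :=
          mul_le_mul_of_nonneg_left (hB k x) (norm_nonneg _)
      _ = _ := by ring
  have hs0 : Summable fun k => fourierCoeffTorus (η t) k * mode k x := by
    refine Summable.of_norm_bounded ((((hη.of_le (by norm_num : 0 + 3 ≤ 4)).summable_fourierCoeff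
      hT ht)).mul_left B') fun k => ?_
    rw [norm_mul, pow_zero, mul_one, mul_comm]
    exact mul_le_mul_of_nonneg_right (hB' k x) (norm_nonneg _)
  have h := Complex.reCLM.hasFDerivAt.comp x (hasFDerivAt_tsum hs1 hd hle hs0 x)
  have hsum : Summable fun k => fourierCoeffTorus (η t) k • fderiv ℝ (mode k) x :=
    Summable.of_norm_bounded hs1 fun k => hle k x
  have e : fderiv ℝ (fullExt (η t)) x = _ := h.fderiv
  rw [e, ContinuousLinearMap.comp_apply, Complex.reCLM_apply]
  congr 1
  exact (ContinuousLinearMap.apply ℝ ℂ v).map_tsum hsum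

/-- Termwise differentiation in time of series in the Fourier coefficients of an elevation. -/
theorem RegularElevation.hasDerivWithinAt_tsum (hT : 0 < T) (hη : RegularElevation T 5 η)
    (ht : t ∈ timeInterval T) {a : (Fin 2 → ℤ) → ℂ} {A : ℝ} (ha : ∀ k, ‖a k‖ ≤ A * (1 + ‖k‖)) :
    HasDerivWithinAt (fun s => (∑' k, fourierCoeffTorus (η s) k * a k).re)
      (∑' k, fourierCoeffTorus (fun y => FreeSurface.tpartial T (fun s => η s y) t) k * a k).re
      (timeInterval T) t := by
  obtain ⟨t₁, ht₁, hlt⟩ := exists_gt_mem_timeInterval ht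
  have hηt : RegularElevation T 4 _ := hη.tpartial hT
  obtain ⟨C, hC⟩ := hηt.exists_decay hT ht₁
  obtain ⟨C', hC'⟩ := (hη.of_le (by norm_num : 4 ≤ 5)).exists_decay hT ht₁
  have hA : 0 ≤ A := by
    have := (norm_nonneg _).trans (ha 0)
    simpa using this
  have est : ∀ {c : (Fin 2 → ℤ) → ℂ} {D : ℝ} (k), ‖c k‖ * (1 + ‖k‖) ^ 4 ≤ D →
      ‖c k * a k‖ ≤ A * (D * ((1 + ‖k‖) ^ 3)⁻¹) := by
    intro c D k h
    have h2 := norm_mul_pow_le_of_decay (j := 1) h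
    rw [norm_mul]
    calc ‖c k‖ * ‖a k‖ ≤ ‖c k‖ * (A * (1 + ‖k‖)) :=
          mul_le_mul_of_nonneg_left (ha k) (norm_nonneg _)
      _ = A * (‖c k‖ * (1 + ‖k‖) ^ 1) := by ring
      _ ≤ _ := mul_le_mul_of_nonneg_left h2 hA
  have hsum : ∀ D : ℝ, Summable fun k : Fin 2 → ℤ => A * (D * ((1 + ‖k‖) ^ 3)⁻¹) := fun D =>
    (summable_one_add_norm_inv_pow.mul_left D).mul_left A
  have key := hasDerivWithinAt_tsum_of_dominated (K := Icc 0 t₁) (I := timeInterval T) (t := t)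
    (F := fun s k => fourierCoeffTorus (η s) k * a k)
    (F' := fun s k => fourierCoeffTorus (fun y => FreeSurface.tpartial T (fun r => η r y) s) k * a k)
    (bound := fun k => A * (C * ((1 + ‖k‖) ^ 3)⁻¹)) (convex_Icc _ _)
    (Icc_subset_timeInterval ht₁) (Icc_mem_nhdsWithin_timeInterval hlt) ⟨ht.1, hlt.le⟩
    (fun s hs => Summable.of_norm_bounded (hsum C') fun k => est k (hC' s hs k)) (hsum C)
    (fun k s hs => (hη.hasDerivWithinAt_fourierCoeff hT (by norm_num)
      (Icc_subset_timeInterval ht₁ hs) k).mul_const (a k))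
    (fun k s hs => est k (hC s hs k))
  exact Complex.reCLM.hasFDerivAt.comp_hasDerivWithinAt t key

theorem RegularElevation.hasDerivWithinAt_fullExt (hT : 0 < T) (hη : RegularElevation T 5 η)
    (ht : t ∈ timeInterval T) (x : R3) :
    HasDerivWithinAt (fun s => fullExt (η s) x)
      (fullExt (fun y => FreeSurface.tpartial T (fun s => η s y) t) x) (timeInterval T) t := by
  obtain ⟨B, hB0, hB⟩ := exists_bound_mode
  refine hη.hasDerivWithinAt_tsum hT ht (A := B) (a := fun k => mode k x) fun k =>
    (hB k x).trans (le_mul_of_one_le_right hB0 (by linarith [norm_nonneg k]))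

theorem RegularElevation.hasDerivWithinAt_fderiv_fullExt (hT : 0 < T)
    (hη : RegularElevation T 5 η) (ht : t ∈ timeInterval T) (x v : R3) :
    HasDerivWithinAt (fun s => fderiv ℝ (fullExt (η s)) x v)
      (fderiv ℝ (fullExt (fun y => FreeSurface.tpartial T (fun s => η s y) t)) x v)
      (timeInterval T) t := by
  obtain ⟨B, hB0, hB⟩ := exists_bound_fderiv_mode
  have h := hη.hasDerivWithinAt_tsum hT ht (A := B * ‖v‖) (a := fun k => fderiv ℝ (mode k) x v)
    fun k => ((fderiv ℝ (mode k) x).le_opNorm v).trans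
      ((mul_le_mul_of_nonneg_right (hB k x) (norm_nonneg v)).trans_eq (by ring))
  have hη4 := hη.of_le (by norm_num : 4 ≤ 5)
  have e : fderiv ℝ (fullExt (fun y => FreeSurface.tpartial T (fun s => η s y) t)) x v = _ :=
    RegularElevation.fderiv_fullExt hT (hη.tpartial hT) ht x v
  rw [e]
  exact h.congr (fun s hs => hη4.fderiv_fullExt hT hs x v) (hη4.fderiv_fullExt hT ht x v)

theorem RegularElevation.exists_bound_fullExt (hT : 0 < T) (hη : RegularElevation T 4 η)
    (ht₁ : t₁ ∈ timeInterval T) :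
    ∃ M, ∀ s ∈ Icc 0 t₁, ∀ x, |fullExt (η s) x| ≤ M ∧
      ∀ i, |fderiv ℝ (fullExt (η s)) x (Pi.single i 1)| ≤ M := by
  obtain ⟨B, hB0, hB⟩ := exists_bound_fderiv_mode
  obtain ⟨B', hB0', hB'⟩ := exists_bound_mode
  obtain ⟨C, hC⟩ := hη.exists_decay hT ht₁
  set S := ∑' k : Fin 2 → ℤ, C * ((1 + ‖k‖) ^ 3)⁻¹ with hS
  have hsum := summable_one_add_norm_inv_pow.mul_left C
  have est : ∀ s ∈ Icc 0 t₁, ∀ (a : (Fin 2 → ℤ) → ℂ) (A : ℝ), 0 ≤ A →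
      (∀ k, ‖a k‖ ≤ A * (1 + ‖k‖)) →
      |(∑' k, fourierCoeffTorus (η s) k * a k).re| ≤ A * S := by
    intro s hs a A hA ha
    refine (Complex.abs_re_le_norm _).trans ?_
    rw [hS, ← tsum_mul_left]
    refine tsum_of_norm_bounded (hsum.mul_left A).hasSum fun k => ?_
    rw [norm_mul]
    calc _ ≤ ‖fourierCoeffTorus (η s) k‖ * (A * (1 + ‖k‖)) :=
          mul_le_mul_of_nonneg_left (ha k) (norm_nonneg _)
      _ = A * (‖fourierCoeffTorus (η s) k‖ * (1 + ‖k‖) ^ 1) := by ring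
      _ ≤ _ := mul_le_mul_of_nonneg_left (norm_mul_pow_le_of_decay (j := 1) (hC s hs k)) hA
  refine ⟨max (B' * S) (B * S), fun s hs x => ⟨?_, fun i => ?_⟩⟩
  · refine (est s hs (fun k => mode k x) B' hB0' fun k => ?_).trans (le_max_left _ _)
    exact (hB' k x).trans (le_mul_of_one_le_right hB0' (by linarith [norm_nonneg k]))
  · rw [hη.fderiv_fullExt hT (Icc_subset_timeInterval ht₁ hs)]
    refine (est s hs (fun k => fderiv ℝ (mode k) x (Pi.single i 1)) B hB0 fun k => ?_).trans
      (le_max_right _ _)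
    refine ((fderiv ℝ (mode k) x).le_opNorm _).trans ?_
    rw [Pi.norm_single, norm_one, mul_one]
    exact hB k x

end FullExt

/-! ### The geometric coefficients of the flattening map -/

/-- The vertical displacement `χ (𝓔 h)` of the flattening map, continued with the harmonic
extension to the whole space. -/
def surfaceLift (χ : R3 → ℝ) (h : R2 → ℝ) (x : R3) : ℝ := χ x * fullExt h x

theorem flattening_apply {b : ℝ} {χ : R3 → ℝ} {h : R2 → ℝ} {x : R3} (hx : x ∈ closedSlab b) :
    flattening χ h x = x + surfaceLift χ h x • e3 := by
  rw [flattening, harmExt_eq_fullExt h hx.2, surfaceLift]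

/-- A flattening map of class `C²` up to the boundary with positive Jacobian. -/
structure RegularFlattening (b : ℝ) (χ : R3 → ℝ) (h : R2 → ℝ) : Prop where
  pos : 0 < b
  lift : SlabReg b 2 (surfaceLift χ h)
  jac_pos : ∀ x ∈ closedSlab b, 0 < jac b χ h x

section Lift

variable {b : ℝ} {χ : R3 → ℝ} {T : EReal} {n : ℕ} {η : ℝ → R2 → ℝ} {t t₁ : ℝ}

theorem IsCutoff.slabReg (hχ : IsCutoff b χ) (n : ℕ) : SlabReg b n χ :=
  ⟨hχ.smooth.of_le (by exact_mod_cast le_top), hχ.periodic⟩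

theorem slabReg_fullExt (hT : 0 < T) (hη : RegularElevation T (n + 3) η)
    (ht : t ∈ timeInterval T) : SlabReg b n (fullExt (η t)) :=
  ⟨(hη.contDiff_fullExt hT ht).contDiffOn, fun x _ =>
    ⟨fullExt_add_single (by decide) _ x, fullExt_add_single (by decide) _ x⟩⟩

theorem slabReg_surfaceLift (hT : 0 < T) (hχ : IsCutoff b χ) (hη : RegularElevation T (n + 3) η)
    (ht : t ∈ timeInterval T) : SlabReg b n (surfaceLift χ (η t)) :=
  (hχ.slabReg n).mul (slabReg_fullExt hT hη ht)

theorem spartial_surfaceLift (hb : 0 < b) (hT : 0 < T) (hχ : IsCutoff b χ)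
    (hη : RegularElevation T 4 η) (ht : t ∈ timeInterval T) {x : R3} (hx : x ∈ closedSlab b)
    (i : Fin 3) :
    spartial b i (surfaceLift χ (η t)) x
      = χ x * fderiv ℝ (fullExt (η t)) x (Pi.single i 1)
        + fullExt (η t) x * spartial b i χ x := by
  have h1 := (hχ.slabReg 1).differentiableWithinAt le_rfl hx
  have h2 : DifferentiableAt ℝ (fullExt (η t)) x :=
    (RegularElevation.contDiff_fullExt (n := 1) hT hη ht).differentiable (by simp) x
  refine (spartial_mul hb h1 h2.differentiableWithinAt hx).trans ?_
  rw [spartial_eq_of_hasFDerivWithinAt hb h2.hasFDerivAt.hasFDerivWithinAt hx]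

theorem hasDerivWithinAt_surfaceLift (hT : 0 < T) (hη : RegularElevation T 5 η)
    (ht : t ∈ timeInterval T) (x : R3) :
    HasDerivWithinAt (fun s => surfaceLift χ (η s) x)
      (surfaceLift χ (fun y => tpartial T (fun s => η s y) t) x) (timeInterval T) t :=
  (hη.hasDerivWithinAt_fullExt hT ht x).const_mul (χ x)

theorem hasDerivWithinAt_spartial_surfaceLift (hb : 0 < b) (hT : 0 < T) (hχ : IsCutoff b χ)
    (hη : RegularElevation T 5 η) (ht : t ∈ timeInterval T) {x : R3} (hx : x ∈ closedSlab b)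
    (i : Fin 3) :
    HasDerivWithinAt (fun s => spartial b i (surfaceLift χ (η s)) x)
      (spartial b i (surfaceLift χ (fun y => tpartial T (fun s => η s y) t)) x)
      (timeInterval T) t := by
  have hη4 := hη.of_le (by norm_num : 4 ≤ 5)
  have e : spartial b i (surfaceLift χ (fun y => tpartial T (fun s => η s y) t)) x = _ :=
    spartial_surfaceLift hb hT hχ (hη.tpartial hT) ht hx i
  rw [e]
  exact (((hη.hasDerivWithinAt_fderiv_fullExt hT ht x _).const_mul (χ x)).add
    ((hη.hasDerivWithinAt_fullExt hT ht x).mul_const _)).congr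
    (fun s hs => spartial_surfaceLift hb hT hχ hη4 hs hx i)
    (spartial_surfaceLift hb hT hχ hη4 ht hx i)

theorem exists_bound_spartial_surfaceLift (hb : 0 < b) (hT : 0 < T) (hχ : IsCutoff b χ)
    (hη : RegularElevation T 4 η) (ht₁ : t₁ ∈ timeInterval T) (i : Fin 3) :
    ∃ M, ∀ s ∈ Icc 0 t₁, ∀ x ∈ cell b, |spartial b i (surfaceLift χ (η s)) x| ≤ M := by
  obtain ⟨M, hM⟩ := hη.exists_bound_fullExt hT ht₁
  obtain ⟨B, hB⟩ := isCompact_Icc.exists_bound_of_continuousOn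
    ((hχ.slabReg 0).contDiff.continuousOn.mono (Icc_subset_closedSlab b))
  obtain ⟨B', hB'⟩ := isCompact_Icc.exists_bound_of_continuousOn
    (((hχ.slabReg 1).spartial (n := 0) hb i).contDiff.continuousOn.mono (Icc_subset_closedSlab b))
  refine ⟨B * M + M * B', fun s hs x hx => ?_⟩
  have hxI := cell_subset_Icc b hx
  have hB0 : 0 ≤ B := (norm_nonneg _).trans (hB x hxI)
  have hM0 : 0 ≤ M := (abs_nonneg _).trans (hM s hs x).1
  rw [spartial_surfaceLift hb hT hχ hη (Icc_subset_timeInterval ht₁ hs)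
    (Icc_subset_closedSlab b hxI)]
  refine (abs_add_le _ _).trans (add_le_add ?_ ?_)
  · rw [abs_mul]
    exact mul_le_mul (hB x hxI) ((hM s hs x).2 i) (abs_nonneg _) hB0
  · rw [abs_mul]
    exact mul_le_mul (hM s hs x).1 (hB' x hxI) (abs_nonneg _) hM0

theorem surfaceLift_atHeight_zero (hT : 0 < T) (hχ : IsCutoff b χ)
    (hη : RegularElevation T 3 η) (ht : t ∈ timeInterval T) (y : R2) :
    surfaceLift χ (η t) (atHeight 0 y) = η t y := by
  have hs := RegularElevation.summable_fourierCoeff (j := 0) hT hη ht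
  simp only [pow_zero, mul_one] at hs
  rw [surfaceLift, hχ.top, one_mul,
    fullExt_atHeight_zero (hη.contDiff_space ht).continuous (hη.periodic t ht) hs]

theorem tpartial_flattening (hT : 0 < T) (hη : RegularElevation T 5 η)
    (ht : t ∈ timeInterval T) {x : R3} (hx : x ∈ closedSlab b) :
    tpartial T (fun s => flattening χ (η s) x) t
      = surfaceLift χ (fun y => tpartial T (fun s => η s y) t) x • e3 := by
  refine tpartial_eq_of_hasDerivWithinAt hT ?_ ht
  simp only [flattening_apply hx]
  exact ((hasDerivWithinAt_surfaceLift hT hη ht x).smul_const e3).const_add x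

/-- On the upper boundary the flattening map moves with the surface. -/
theorem surfaceLift_tpartial_atHeight_zero (hT : 0 < T) (hχ : IsCutoff b χ)
    (hη : RegularElevation T 5 η) (ht : t ∈ timeInterval T) (y : R2) :
    surfaceLift χ (fun y => tpartial T (fun s => η s y) t) (atHeight 0 y)
      = tpartial T (fun s => η s y) t :=
  surfaceLift_atHeight_zero hT hχ (RegularElevation.of_le (hη.tpartial hT) (by norm_num)) ht y

end Lift

namespace RegularFlattening

variable {b : ℝ} {χ : R3 → ℝ} {h : R2 → ℝ} {x : R3}

theorem gradFlattening_apply (hΦ : RegularFlattening b χ h) (hx : x ∈ closedSlab b) (i j : Fin 3) :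
    gradFlattening b χ h x i j
      = (if i = j then 1 else 0) + spartial b j (surfaceLift χ h) x * e3 i := by
  have hd := hΦ.lift.differentiableWithinAt (by norm_num) hx
  have e : EqOn (fun y => flattening χ h y i) (fun y => y i + surfaceLift χ h y * e3 i)
      (closedSlab b) := fun y hy => by
    simp only [flattening_apply hy, Pi.add_apply, Pi.smul_apply, smul_eq_mul]
  have hp : DifferentiableWithinAt ℝ (fun y : R3 => y i) (closedSlab b) x :=
    (differentiable_pi.1 differentiable_id i x).differentiableWithinAt
  simp only [gradFlattening, Matrix.of_apply]
  rw [spartial_congr e hx, spartial_add hΦ.pos hp (hd.mul_const _) hx, spartial_proj hΦ.pos hx,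
    spartial_mul hΦ.pos hd (differentiableWithinAt_const _) hx, spartial_const]
  ring

theorem jac_eq (hΦ : RegularFlattening b χ h) (hx : x ∈ closedSlab b) :
    jac b χ h x = 1 + spartial b 2 (surfaceLift χ h) x := by
  rw [jac, Matrix.det_fin_three]
  simp [hΦ.gradFlattening_apply hx, e3]

theorem geo_eq (hΦ : RegularFlattening b χ h) (hx : x ∈ closedSlab b) :
    geo b χ h x = !![1, 0, -(spartial b 0 (surfaceLift χ h) x * (jac b χ h x)⁻¹);
      0, 1, -(spartial b 1 (surfaceLift χ h) x * (jac b χ h x)⁻¹); 0, 0, (jac b χ h x)⁻¹] := by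
  have hJ := (hΦ.jac_pos x hx).ne'
  have e := hΦ.jac_eq hx
  set J := jac b χ h x with hJdef
  have hinv : (gradFlattening b χ h x)⁻¹ = !![1, 0, 0; 0, 1, 0;
      -(spartial b 0 (surfaceLift χ h) x * J⁻¹), -(spartial b 1 (surfaceLift χ h) x * J⁻¹),
      J⁻¹] := by
    refine Matrix.inv_eq_right_inv ?_
    ext i j
    rw [Matrix.mul_apply, Fin.sum_univ_three]
    simp only [hΦ.gradFlattening_apply hx, e3]
    fin_cases i <;> fin_cases j <;> simp [← e, hJ]
    all_goals field_simp; ring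
  rw [geo, hinv]
  ext i j
  fin_cases i <;> fin_cases j <;> rfl

theorem slabReg_jac (hΦ : RegularFlattening b χ h) : SlabReg b 1 (jac b χ h) :=
  ((SlabReg.const 1).add (hΦ.lift.spartial (n := 1) hΦ.pos 2)).congr fun _ hx => hΦ.jac_eq hx

theorem slabReg_jac_inv (hΦ : RegularFlattening b χ h) : SlabReg b 1 fun x => (jac b χ h x)⁻¹ :=
  hΦ.slabReg_jac.inv fun x hx => (hΦ.jac_pos x hx).ne'

theorem slabReg_slope (hΦ : RegularFlattening b χ h) (i : Fin 3) :
    SlabReg b 1 fun x => spartial b i (surfaceLift χ h) x * (jac b χ h x)⁻¹ :=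
  (hΦ.lift.spartial (n := 1) hΦ.pos i).mul hΦ.slabReg_jac_inv

theorem slabReg_geo (hΦ : RegularFlattening b χ h) (i j : Fin 3) :
    SlabReg b 1 fun x => geo b χ h x i j := by
  fin_cases i <;> fin_cases j
  · exact (SlabReg.const 1).congr fun x hx => by simp [hΦ.geo_eq hx]
  · exact (SlabReg.const 0).congr fun x hx => by simp [hΦ.geo_eq hx]
  · exact (hΦ.slabReg_slope 0).neg.congr fun x hx => by simp [hΦ.geo_eq hx]
  · exact (SlabReg.const 0).congr fun x hx => by simp [hΦ.geo_eq hx]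
  · exact (SlabReg.const 1).congr fun x hx => by simp [hΦ.geo_eq hx]
  · exact (hΦ.slabReg_slope 1).neg.congr fun x hx => by simp [hΦ.geo_eq hx]
  · exact (SlabReg.const 0).congr fun x hx => by simp [hΦ.geo_eq hx]
  · exact (SlabReg.const 0).congr fun x hx => by simp [hΦ.geo_eq hx]
  · exact hΦ.slabReg_jac_inv.congr fun x hx => by simp [hΦ.geo_eq hx]

/-! ### Calculus with the geometric derivatives -/

theorem partialA_zero_eq (hΦ : RegularFlattening b χ h) (hx : x ∈ closedSlab b) (f : R3 → ℝ) :
    partialA b χ h 0 f x = spartial b 0 f x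
      - spartial b 0 (surfaceLift χ h) x * (jac b χ h x)⁻¹ * spartial b 2 f x := by
  simp [partialA, hΦ.geo_eq hx, Fin.sum_univ_three, sub_eq_add_neg]

theorem partialA_one_eq (hΦ : RegularFlattening b χ h) (hx : x ∈ closedSlab b) (f : R3 → ℝ) :
    partialA b χ h 1 f x = spartial b 1 f x
      - spartial b 1 (surfaceLift χ h) x * (jac b χ h x)⁻¹ * spartial b 2 f x := by
  simp [partialA, hΦ.geo_eq hx, Fin.sum_univ_three, sub_eq_add_neg]

theorem partialA_two_eq (hΦ : RegularFlattening b χ h) (hx : x ∈ closedSlab b) (f : R3 → ℝ) :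
    partialA b χ h 2 f x = (jac b χ h x)⁻¹ * spartial b 2 f x := by
  simp [partialA, hΦ.geo_eq hx, Fin.sum_univ_three]

theorem slabReg_partialA (hΦ : RegularFlattening b χ h) {n : ℕ} (hn : n ≤ 1) {f : R3 → ℝ}
    (hf : SlabReg b (n + 1) f) (i : Fin 3) : SlabReg b n (partialA b χ h i f) :=
  SlabReg.sum _ fun j _ => ((hΦ.slabReg_geo i j).of_le hn).mul (hf.spartial hΦ.pos j)

section Rules

variable {f k : R3 → ℝ} {i : Fin 3}

theorem partialA_add (hΦ : RegularFlattening b χ h)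
    (hf : DifferentiableWithinAt ℝ f (closedSlab b) x)
    (hk : DifferentiableWithinAt ℝ k (closedSlab b) x) (hx : x ∈ closedSlab b) :
    partialA b χ h i (fun y => f y + k y) x = partialA b χ h i f x + partialA b χ h i k x := by
  simp only [partialA, spartial_add hΦ.pos hf hk hx, mul_add, Finset.sum_add_distrib]

theorem partialA_sub (hΦ : RegularFlattening b χ h)
    (hf : DifferentiableWithinAt ℝ f (closedSlab b) x)
    (hk : DifferentiableWithinAt ℝ k (closedSlab b) x) (hx : x ∈ closedSlab b) :
    partialA b χ h i (fun y => f y - k y) x = partialA b χ h i f x - partialA b χ h i k x := by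
  simp only [partialA, spartial_sub hΦ.pos hf hk hx, mul_sub, Finset.sum_sub_distrib]

theorem partialA_mul (hΦ : RegularFlattening b χ h)
    (hf : DifferentiableWithinAt ℝ f (closedSlab b) x)
    (hk : DifferentiableWithinAt ℝ k (closedSlab b) x) (hx : x ∈ closedSlab b) :
    partialA b χ h i (fun y => f y * k y) x
      = f x * partialA b χ h i k x + k x * partialA b χ h i f x := by
  simp only [partialA, spartial_mul hΦ.pos hf hk hx, Fin.sum_univ_three]
  ring

theorem partialA_sum (hΦ : RegularFlattening b χ h) {ι : Type*} (s : Finset ι) {F : ι → R3 → ℝ}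
    (hF : ∀ k ∈ s, DifferentiableWithinAt ℝ (F k) (closedSlab b) x) (hx : x ∈ closedSlab b) :
    partialA b χ h i (fun y => ∑ k ∈ s, F k y) x = ∑ k ∈ s, partialA b χ h i (F k) x := by
  simp only [partialA, spartial_sum hΦ.pos s hF hx, Finset.mul_sum]
  exact Finset.sum_comm

end Rules

/-- Piola's identity: the rows of `J 𝒜` are divergence free. -/
theorem piola (hΦ : RegularFlattening b χ h) (hx : x ∈ closedSlab b) (i : Fin 3) :
    ∑ j, spartial b j (fun y => jac b χ h y * geo b χ h y i j) x = 0 := by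
  have hb := hΦ.pos
  have hJ : ∀ y ∈ closedSlab b, jac b χ h y * (jac b χ h y)⁻¹ = 1 := fun y hy =>
    mul_inv_cancel₀ (hΦ.jac_pos y hy).ne'
  have hD := fun l => (hΦ.lift.spartial (n := 1) hb l).differentiableWithinAt le_rfl hx
  have hcomm := fun l m => spartial_comm hb hΦ.lift.contDiff hx l m
  have eJ : ∀ l, spartial b l (fun y => jac b χ h y) x
      = spartial b l (spartial b 2 (surfaceLift χ h)) x := by
    intro l
    rw [spartial_congr (fun y hy => hΦ.jac_eq hy) hx,
      spartial_add hb (differentiableWithinAt_const _) (hD 2) hx, spartial_const, zero_add]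
  have eneg : ∀ l, spartial b 2 (fun y => -spartial b l (surfaceLift χ h) y) x
      = -spartial b 2 (spartial b l (surfaceLift χ h)) x := by
    intro l
    have := spartial_sub (i := 2) hb (differentiableWithinAt_const (0 : ℝ)) (hD l) hx
    simpa [spartial_const] using this
  have ecan : ∀ l, EqOn (fun y => jac b χ h y * -(spartial b l (surfaceLift χ h) y
      * (jac b χ h y)⁻¹)) (fun y => -spartial b l (surfaceLift χ h) y) (closedSlab b) := by
    intro l y hy
    have := hJ y hy
    linear_combination (-spartial b l (surfaceLift χ h) y) * this
  rw [Fin.sum_univ_three]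
  fin_cases i
  · rw [spartial_congr (f := fun y => jac b χ h y * geo b χ h y _ 0) (h := fun y => jac b χ h y)
        (fun y hy => by simp [hΦ.geo_eq hy]) hx,
      spartial_congr (f := fun y => jac b χ h y * geo b χ h y _ 1) (h := fun _ => 0)
        (fun y hy => by simp [hΦ.geo_eq hy]) hx,
      spartial_congr (f := fun y => jac b χ h y * geo b χ h y _ 2)
        (h := fun y => -spartial b 0 (surfaceLift χ h) y)
        (fun y hy => by simpa [hΦ.geo_eq hy] using ecan 0 hy) hx,
      eJ, eneg, spartial_const, hcomm 0 2]
    ring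
  · rw [spartial_congr (f := fun y => jac b χ h y * geo b χ h y _ 0) (h := fun _ => 0)
        (fun y hy => by simp [hΦ.geo_eq hy]) hx,
      spartial_congr (f := fun y => jac b χ h y * geo b χ h y _ 1) (h := fun y => jac b χ h y)
        (fun y hy => by simp [hΦ.geo_eq hy]) hx,
      spartial_congr (f := fun y => jac b χ h y * geo b χ h y _ 2)
        (h := fun y => -spartial b 1 (surfaceLift χ h) y)
        (fun y hy => by simpa [hΦ.geo_eq hy] using ecan 1 hy) hx,
      eJ, eneg, spartial_const, hcomm 1 2]
    ring
  · rw [spartial_congr (f := fun y => jac b χ h y * geo b χ h y _ 0) (h := fun _ => 0)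
        (fun y hy => by simp [hΦ.geo_eq hy]) hx,
      spartial_congr (f := fun y => jac b χ h y * geo b χ h y _ 1) (h := fun _ => 0)
        (fun y hy => by simp [hΦ.geo_eq hy]) hx,
      spartial_congr (f := fun y => jac b χ h y * geo b χ h y _ 2) (h := fun _ => 1)
        (fun y hy => by simpa [hΦ.geo_eq hy] using hJ y hy) hx,
      spartial_const, spartial_const, spartial_const]
    ring

/-- By Piola's identity, `J ∇^𝒜 ⬝ X` is the divergence of `(J 𝒜)ᵀ X`. -/
theorem sum_spartial_piola (hΦ : RegularFlattening b χ h) (hx : x ∈ closedSlab b)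
    {X : Fin 3 → R3 → ℝ} (hX : ∀ i, DifferentiableWithinAt ℝ (X i) (closedSlab b) x) :
    ∑ j, spartial b j (fun y => ∑ i, jac b χ h y * geo b χ h y i j * X i y) x
      = jac b χ h x * ∑ i, partialA b χ h i (X i) x := by
  have hb := hΦ.pos
  have hN := fun i j => (hΦ.slabReg_jac.mul (hΦ.slabReg_geo i j)).differentiableWithinAt le_rfl hx
  have e : ∀ j, spartial b j (fun y => ∑ i, jac b χ h y * geo b χ h y i j * X i y) x
      = ∑ i, (jac b χ h x * geo b χ h x i j * spartial b j (X i) x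
        + X i x * spartial b j (fun y => jac b χ h y * geo b χ h y i j) x) := by
    intro j
    rw [spartial_sum hb _ (fun i _ => (hN i j).fun_mul (hX i)) hx]
    exact Finset.sum_congr rfl fun i _ => spartial_mul hb (hN i j) (hX i) hx
  simp only [e]
  rw [Finset.sum_comm, Finset.mul_sum]
  refine Finset.sum_congr rfl fun i _ => ?_
  rw [Finset.sum_add_distrib, ← Finset.mul_sum, hΦ.piola hx, mul_zero, add_zero, partialA,
    Finset.mul_sum]
  exact Finset.sum_congr rfl fun j _ => by ring

theorem spartial_jac_inv (hΦ : RegularFlattening b χ h) (hx : x ∈ closedSlab b) (l : Fin 3) :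
    spartial b l (fun y => (jac b χ h y)⁻¹) x
      = -((jac b χ h x)⁻¹ ^ 2 * spartial b l (spartial b 2 (surfaceLift χ h)) x) := by
  have hb := hΦ.pos
  have hD := (hΦ.lift.spartial (n := 1) hb 2).differentiableWithinAt le_rfl hx
  have eJ : spartial b l (jac b χ h) x = spartial b l (spartial b 2 (surfaceLift χ h)) x := by
    rw [spartial_congr (fun y hy => hΦ.jac_eq hy) hx,
      spartial_add hb (differentiableWithinAt_const _) hD hx, spartial_const, zero_add]
  have h1 : spartial b l (fun y => jac b χ h y * (jac b χ h y)⁻¹) x = 0 := by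
    rw [spartial_congr (h := fun _ => 1)
      (fun y hy => mul_inv_cancel₀ (hΦ.jac_pos y hy).ne') hx, spartial_const]
  rw [spartial_mul hb (hΦ.slabReg_jac.differentiableWithinAt le_rfl hx)
    (hΦ.slabReg_jac_inv.differentiableWithinAt le_rfl hx) hx, eJ] at h1
  have h2 := mul_inv_cancel₀ (hΦ.jac_pos x hx).ne'
  linear_combination (jac b χ h x)⁻¹ * h1 - spartial b l (fun y => (jac b χ h y)⁻¹) x * h2

/-- The geometric derivatives commute: they are the partial derivatives in the coordinates of the
moving domain. -/
theorem partialA_comm (hΦ : RegularFlattening b χ h) {f : R3 → ℝ} (hf : SlabReg b 2 f)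
    (hx : x ∈ closedSlab b) (i j : Fin 3) :
    partialA b χ h i (partialA b χ h j f) x = partialA b χ h j (partialA b χ h i f) x := by
  have hb := hΦ.pos
  have hθ := fun l => (hΦ.lift.spartial (n := 1) hb l).differentiableWithinAt le_rfl hx
  have hr := hΦ.slabReg_jac_inv.differentiableWithinAt le_rfl hx
  have hD := fun l => (hf.spartial (n := 1) hb l).differentiableWithinAt le_rfl hx
  have cθ := fun l m => spartial_comm hb hΦ.lift.contDiff hx l m
  have cf := fun l m => spartial_comm hb hf.contDiff hx l m
  have e0 : ∀ l, spartial b l (partialA b χ h 0 f) x = spartial b l (spartial b 0 f) x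
      - (spartial b 0 (surfaceLift χ h) x * (jac b χ h x)⁻¹ * spartial b l (spartial b 2 f) x
        + spartial b 2 f x * (spartial b 0 (surfaceLift χ h) x
            * -((jac b χ h x)⁻¹ ^ 2 * spartial b l (spartial b 2 (surfaceLift χ h)) x)
          + (jac b χ h x)⁻¹ * spartial b l (spartial b 0 (surfaceLift χ h)) x)) := by
    intro l
    rw [spartial_congr (fun y hy => hΦ.partialA_zero_eq hy f) hx,
      spartial_sub hb (hD 0) (((hθ 0).fun_mul hr).fun_mul (hD 2)) hx,
      spartial_mul hb ((hθ 0).fun_mul hr) (hD 2) hx, spartial_mul hb (hθ 0) hr hx,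
      hΦ.spartial_jac_inv hx]
  have e1 : ∀ l, spartial b l (partialA b χ h 1 f) x = spartial b l (spartial b 1 f) x
      - (spartial b 1 (surfaceLift χ h) x * (jac b χ h x)⁻¹ * spartial b l (spartial b 2 f) x
        + spartial b 2 f x * (spartial b 1 (surfaceLift χ h) x
            * -((jac b χ h x)⁻¹ ^ 2 * spartial b l (spartial b 2 (surfaceLift χ h)) x)
          + (jac b χ h x)⁻¹ * spartial b l (spartial b 1 (surfaceLift χ h)) x)) := by
    intro l
    rw [spartial_congr (fun y hy => hΦ.partialA_one_eq hy f) hx,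
      spartial_sub hb (hD 1) (((hθ 1).fun_mul hr).fun_mul (hD 2)) hx,
      spartial_mul hb ((hθ 1).fun_mul hr) (hD 2) hx, spartial_mul hb (hθ 1) hr hx,
      hΦ.spartial_jac_inv hx]
  have e2 : ∀ l, spartial b l (partialA b χ h 2 f) x
      = (jac b χ h x)⁻¹ * spartial b l (spartial b 2 f) x
        + spartial b 2 f x
          * -((jac b χ h x)⁻¹ ^ 2 * spartial b l (spartial b 2 (surfaceLift χ h)) x) := by
    intro l
    rw [spartial_congr (fun y hy => hΦ.partialA_two_eq hy f) hx, spartial_mul hb hr (hD 2) hx,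
      hΦ.spartial_jac_inv hx]
  have c01 : partialA b χ h 0 (partialA b χ h 1 f) x = partialA b χ h 1 (partialA b χ h 0 f) x := by
    rw [hΦ.partialA_zero_eq hx, hΦ.partialA_one_eq hx, e1, e1, e0, e0, cf 1 0, cf 2 0, cf 2 1,
      cθ 1 0, cθ 2 0, cθ 2 1]
    ring
  have c02 : partialA b χ h 0 (partialA b χ h 2 f) x = partialA b χ h 2 (partialA b χ h 0 f) x := by
    rw [hΦ.partialA_zero_eq hx, hΦ.partialA_two_eq hx, e2, e2, e0, cf 2 0, cθ 2 0]
    ring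
  have c12 : partialA b χ h 1 (partialA b χ h 2 f) x = partialA b χ h 2 (partialA b χ h 1 f) x := by
    rw [hΦ.partialA_one_eq hx, hΦ.partialA_two_eq hx, e2, e2, e1, cf 2 1, cθ 2 1]
    ring
  fin_cases i <;> fin_cases j
  exacts [rfl, c01, c02, c01.symm, rfl, c12, c02.symm, c12.symm, rfl]

end RegularFlattening

/-! ### The energy identity in the bulk -/

/-- The energy flux `½ |v|² w - T^𝒜 v` carried by a velocity `v` with pressure `q` that is
transported by `-w`. -/
def energyFlux (b : ℝ) (χ : R3 → ℝ) (h : R2 → ℝ) (w v : R3 → R3) (q : R3 → ℝ) (i : Fin 3)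
    (y : R3) : ℝ :=
  w y i * (1 / 2 * (v y ⬝ᵥ v y)) - ∑ k, v y k * stressA b χ h v q y k i

theorem slabReg_half_dotProduct {b : ℝ} {n : ℕ} {v : R3 → R3}
    (hv : ∀ i, SlabReg b n fun y => v y i) :
    SlabReg b n fun y => 1 / 2 * (v y ⬝ᵥ v y) :=
  (SlabReg.const _).mul (SlabReg.sum _ fun i _ => (hv i).mul (hv i))

namespace RegularFlattening

variable {b : ℝ} {χ : R3 → ℝ} {h : R2 → ℝ} {x : R3} {u v w : R3 → R3} {q : R3 → ℝ}

theorem slabReg_symGradA (hΦ : RegularFlattening b χ h) (hv : ∀ i, SlabReg b 2 fun y => v y i)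
    (i j : Fin 3) : SlabReg b 1 fun y => symGradA b χ h v y i j :=
  (hΦ.slabReg_partialA le_rfl (hv j) i).add (hΦ.slabReg_partialA le_rfl (hv i) j)

theorem slabReg_stressA (hΦ : RegularFlattening b χ h) (hv : ∀ i, SlabReg b 2 fun y => v y i)
    (hq : SlabReg b 1 q) (i j : Fin 3) : SlabReg b 1 fun y => stressA b χ h v q y i j :=
  (hq.mul (SlabReg.const ((1 : Matrix (Fin 3) (Fin 3) ℝ) i j))).sub (hΦ.slabReg_symGradA hv i j)

theorem slabReg_energyFlux (hΦ : RegularFlattening b χ h) (hv : ∀ i, SlabReg b 2 fun y => v y i)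
    (hq : SlabReg b 1 q) (hw : ∀ i, SlabReg b 1 fun y => w y i) (i : Fin 3) :
    SlabReg b 1 (energyFlux b χ h w v q i) :=
  ((hw i).mul ((slabReg_half_dotProduct hv).of_le (by norm_num))).sub
    (SlabReg.sum _ fun k _ => ((hv k).of_le (by norm_num)).mul (hΦ.slabReg_stressA hv hq k i))

theorem partialA_energyFlux (hΦ : RegularFlattening b χ h) (hv : ∀ i, SlabReg b 2 fun y => v y i)
    (hq : SlabReg b 1 q) (hw : ∀ i, SlabReg b 1 fun y => w y i) (hx : x ∈ closedSlab b)
    (i : Fin 3) :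
    partialA b χ h i (energyFlux b χ h w v q i) x
      = w x i * (∑ k, v x k * partialA b χ h i (fun y => v y k) x)
        + 1 / 2 * (v x ⬝ᵥ v x) * partialA b χ h i (fun y => w y i) x
        - ∑ k, (v x k * partialA b χ h i (fun y => stressA b χ h v q y k i) x
          + stressA b χ h v q x k i * partialA b χ h i (fun y => v y k) x) := by
  have dv := fun k => (hv k).differentiableWithinAt (by norm_num) hx
  have dw := (hw i).differentiableWithinAt (by norm_num) hx
  have dT := fun k => (hΦ.slabReg_stressA hv hq k i).differentiableWithinAt le_rfl hx
  have de := (slabReg_half_dotProduct hv).differentiableWithinAt (by norm_num) hx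
  have h1 : partialA b χ h i (fun y => 1 / 2 * (v y ⬝ᵥ v y)) x
      = ∑ k, v x k * partialA b χ h i (fun y => v y k) x := by
    have dd : DifferentiableWithinAt ℝ (fun y => v y ⬝ᵥ v y) (closedSlab b) x :=
      (SlabReg.sum (Finset.univ : Finset (Fin 3))
        fun k _ => (hv k).mul (hv k)).differentiableWithinAt (by norm_num) hx
    rw [hΦ.partialA_mul (differentiableWithinAt_const _) dd hx]
    have h2 : partialA b χ h i (fun y => v y ⬝ᵥ v y) x
        = ∑ k, (v x k * partialA b χ h i (fun y => v y k) x
          + v x k * partialA b χ h i (fun y => v y k) x) :=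
      (hΦ.partialA_sum _ (fun k _ => (dv k).fun_mul (dv k)) hx).trans
        (Finset.sum_congr rfl fun k _ => hΦ.partialA_mul (dv k) (dv k) hx)
    rw [h2]
    simp only [partialA, spartial_const, mul_zero, Finset.sum_const_zero, Fin.sum_univ_three]
    ring
  have dS : DifferentiableWithinAt ℝ (fun y => ∑ k, v y k * stressA b χ h v q y k i)
      (closedSlab b) x := DifferentiableWithinAt.fun_sum fun k _ => (dv k).fun_mul (dT k)
  unfold energyFlux
  rw [hΦ.partialA_sub (dw.fun_mul de) dS hx,
    hΦ.partialA_mul dw de hx, h1, hΦ.partialA_sum _ (fun k _ => (dv k).fun_mul (dT k)) hx]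
  congr 1
  exact Finset.sum_congr rfl fun k _ => hΦ.partialA_mul (dv k) (dT k) hx

/-- The local form of the energy balance, for an arbitrary value `a` of the time derivative of the
velocity `v`, transported by `-w`. -/
theorem local_energy_balance (hΦ : RegularFlattening b χ h)
    (hv : ∀ i, SlabReg b 2 fun y => v y i) (hq : SlabReg b 1 q)
    (hw : ∀ i, SlabReg b 1 fun y => w y i) (hx : x ∈ closedSlab b) (a : R3) :
    (v x ⬝ᵥ a) * jac b χ h x + 1 / 2 * (v x ⬝ᵥ v x) * (jac b χ h x * divA b χ h w x)
        + 1 / 2 * (∑ i, ∑ j, symGradA b χ h v x i j ^ 2) * jac b χ h x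
      = ((a - advectA b χ h (w x) v x + matDivA b χ h (stressA b χ h v q) x) ⬝ᵥ v x) * jac b χ h x
        + divA b χ h v x * q x * jac b χ h x
        + jac b χ h x * ∑ i, partialA b χ h i (energyFlux b χ h w v q i) x := by
  simp only [hΦ.partialA_energyFlux hv hq hw hx]
  have hT : ∀ i j, stressA b χ h v q x i j = q x * (1 : Matrix (Fin 3) (Fin 3) ℝ) i j
      - (partialA b χ h i (fun y => v y j) x + partialA b χ h j (fun y => v y i) x) :=
    fun i j => rfl
  have hD : ∀ i j, symGradA b χ h v x i j
      = partialA b χ h i (fun y => v y j) x + partialA b χ h j (fun y => v y i) x :=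
    fun i j => rfl
  simp only [hT, hD, divA, matDivA, advectA, dotProduct, Fin.sum_univ_three, Pi.add_apply,
    Pi.sub_apply, Matrix.one_apply, Fin.reduceEq, if_true, if_false]
  ring

theorem nuA_apply (b : ℝ) (χ : R3 → ℝ) (h : R2 → ℝ) (y : R2) (i : Fin 3) :
    nuA b χ h y i = jac b χ h (atHeight 0 y) * geo b χ h (atHeight 0 y) i 2 := by
  simp [nuA, Matrix.mulVec, dotProduct, e3, Fin.sum_univ_three]

theorem nuA_two (hΦ : RegularFlattening b χ h) (y : R2) : nuA b χ h y 2 = 1 := by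
  have hx := atHeight_zero_mem hΦ.pos y
  rw [nuA_apply, hΦ.geo_eq hx]
  simp [(hΦ.jac_pos _ hx).ne']

/-- The total energy flux enters only through the upper boundary, and there only through the
stress. -/
theorem integral_energyFlux (hΦ : RegularFlattening b χ h)
    (hv : ∀ i, SlabReg b 2 fun y => v y i) (hq : SlabReg b 1 q)
    (hw : ∀ i, SlabReg b 1 fun y => w y i) (hv0 : ∀ y, v (atHeight (-b) y) = 0)
    (hwν : ∀ y, w (atHeight 0 y) ⬝ᵥ nuA b χ h y = 0) :
    ∫ x in cell b, jac b χ h x * ∑ i, partialA b χ h i (energyFlux b χ h w v q i) x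
      = -∫ y in square, v (atHeight 0 y) ⬝ᵥ
          (stressA b χ h v q (atHeight 0 y) *ᵥ nuA b χ h y) := by
  have hX := fun i => hΦ.slabReg_energyFlux hv hq hw i
  have hF : ∀ j, SlabReg b 1
      fun y => ∑ i, jac b χ h y * geo b χ h y i j * energyFlux b χ h w v q i y := fun j =>
    SlabReg.sum _ fun i _ => (hΦ.slabReg_jac.mul (hΦ.slabReg_geo i j)).mul (hX i)
  have h1 : ∫ x in cell b, jac b χ h x * ∑ i, partialA b χ h i (energyFlux b χ h w v q i) x
      = ∫ x in cell b, ∑ j, spartial b j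
        (fun y => ∑ i, jac b χ h y * geo b χ h y i j * energyFlux b χ h w v q i y) x :=
    setIntegral_congr_fun (measurableSet_cell b) fun x hx => by
      have hx' := slab_subset_closedSlab b (cell_subset_slab b hx)
      exact (hΦ.sum_spartial_piola hx' fun i => (hX i).differentiableWithinAt le_rfl hx').symm
  rw [h1, integral_cell_divergence hΦ.pos hF]
  have hbot : ∀ y, ∑ i, jac b χ h (atHeight (-b) y) * geo b χ h (atHeight (-b) y) i 2
      * energyFlux b χ h w v q i (atHeight (-b) y) = 0 := fun y => by
    simp [energyFlux, hv0]
  have htop : ∀ y, ∑ i, jac b χ h (atHeight 0 y) * geo b χ h (atHeight 0 y) i 2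
      * energyFlux b χ h w v q i (atHeight 0 y)
      = -(v (atHeight 0 y) ⬝ᵥ (stressA b χ h v q (atHeight 0 y) *ᵥ nuA b χ h y)) := fun y => by
    have h0 := hwν y
    simp only [← nuA_apply, energyFlux, Matrix.mulVec, dotProduct, Fin.sum_univ_three] at h0 ⊢
    linear_combination (1 / 2 * (v (atHeight 0 y) 0 * v (atHeight 0 y) 0
      + v (atHeight 0 y) 1 * v (atHeight 0 y) 1 + v (atHeight 0 y) 2 * v (atHeight 0 y) 2)) * h0
  simp only [hbot, htop, integral_zero, sub_zero, integral_neg]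

end RegularFlattening

/-! ### Time derivative of the kinetic energy -/

section Kinetic

variable {b : ℝ} {χ : R3 → ℝ} {T : EReal} {η : ℝ → R2 → ℝ} {t : ℝ} {u v : ℝ → R3 → R3}
  {q : ℝ → R3 → ℝ}

theorem regularFlattening (hb : 0 < b) (hT : 0 < T) (hχ : IsCutoff b χ)
    (hη : RegularElevation T 5 η) (hJ : NonDegenerate b χ T η) (ht : t ∈ timeInterval T) :
    RegularFlattening b χ (η t) :=
  ⟨hb, slabReg_surfaceLift (n := 2) hT hχ hη ht, hJ t ht⟩

theorem SpatiallyRegular.slabReg_apply {n : ℕ} (hv : SpatiallyRegular b T n v)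
    (ht : t ∈ timeInterval T) (i : Fin 3) : SlabReg b n fun x => v t x i :=
  SlabReg.apply (hv.contDiff t ht) (hv.periodic t ht) i

theorem SpatiallyRegular.slabReg {n : ℕ} (hq : SpatiallyRegular b T n q)
    (ht : t ∈ timeInterval T) : SlabReg b n (q t) :=
  ⟨hq.contDiff t ht, hq.periodic t ht⟩

theorem RegularVelocity.hasDerivWithinAt (hT : 0 < T) (hv : RegularVelocity b T v)
    (ht : t ∈ timeInterval T) {x : R3} (hx : x ∈ closedSlab b) :
    HasDerivWithinAt (fun s => v s x) (tpartial T (fun s => v s x) t) (timeInterval T) t :=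
  hasDerivWithinAt_tpartial (G := fun z : ℝ × R3 => v z.1 z.2) hT
    (hv.contDiff.differentiableOn (by simp) _ (mk_mem_prod ht hx)) ht hx

theorem RegularVelocity.continuousOn_tpartial (hb : 0 < b) (hT : 0 < T)
    (hv : RegularVelocity b T v) :
    ContinuousOn (fun z : ℝ × R3 => tpartial T (fun s => v s z.2) z.1)
      (timeInterval T ×ˢ closedSlab b) :=
  (contDiffOn_tpartial (n := 0) (G := fun z : ℝ × R3 => v z.1 z.2) hT
    (uniqueDiffOn_closedSlab hb) (by simpa using hv.contDiff)).continuousOn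

theorem continuousOn_dotProduct {X : Type*} [TopologicalSpace X] {s : Set X} {f g : X → R3}
    (hf : ContinuousOn f s) (hg : ContinuousOn g s) : ContinuousOn (fun x => f x ⬝ᵥ g x) s :=
  continuousOn_finsetSum _ fun i _ => ((continuous_apply i).comp_continuousOn hf).mul
    ((continuous_apply i).comp_continuousOn hg)

theorem hasDerivWithinAt_dotProduct {f g : ℝ → R3} {f' g' : R3} {I : Set ℝ}
    (hf : HasDerivWithinAt f f' I t) (hg : HasDerivWithinAt g g' I t) :
    HasDerivWithinAt (fun s => f s ⬝ᵥ g s) (f' ⬝ᵥ g t + f t ⬝ᵥ g') I t := by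
  simp only [dotProduct, ← Finset.sum_add_distrib]
  exact HasDerivWithinAt.fun_sum fun i _ =>
    (hasDerivWithinAt_pi.1 hf i).mul (hasDerivWithinAt_pi.1 hg i)

theorem hasDerivWithinAt_jac (hb : 0 < b) (hT : 0 < T) (hχ : IsCutoff b χ)
    (hη : RegularElevation T 5 η) (hJ : NonDegenerate b χ T η) (ht : t ∈ timeInterval T) {x : R3}
    (hx : x ∈ closedSlab b) :
    HasDerivWithinAt (fun s => jac b χ (η s) x)
      (spartial b 2 (surfaceLift χ (fun y => tpartial T (fun s => η s y) t)) x)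
      (timeInterval T) t :=
  ((hasDerivWithinAt_spartial_surfaceLift hb hT hχ hη ht hx 2).const_add 1).congr
    (fun _ hs => (regularFlattening hb hT hχ hη hJ hs).jac_eq hx)
    ((regularFlattening hb hT hχ hη hJ ht).jac_eq hx)

theorem hasDerivWithinAt_kinetic (hb : 0 < b) (hT : 0 < T) (hχ : IsCutoff b χ)
    (hη : RegularElevation T 5 η) (hJ : NonDegenerate b χ T η) (hv : RegularVelocity b T v)
    (ht : t ∈ timeInterval T) :
    HasDerivWithinAt (fun s => kinetic b χ (η s) (v s))
      (∫ x in cell b, ((v t x ⬝ᵥ tpartial T (fun s => v s x) t) * jac b χ (η t) x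
        + 1 / 2 * (v t x ⬝ᵥ v t x)
          * spartial b 2 (surfaceLift χ (fun y => tpartial T (fun s => η s y) t)) x))
      (timeInterval T) t := by
  obtain ⟨t₁, ht₁, hlt⟩ := exists_gt_mem_timeInterval ht
  have hKI := Icc_subset_timeInterval ht₁
  have hηt : RegularElevation T 4 _ := hη.tpartial hT
  have hprod : Icc 0 t₁ ×ˢ Icc (![0, 0, -b] : R3) (![1, 1, 0] : R3)
      ⊆ timeInterval T ×ˢ closedSlab b := prod_mono hKI (Icc_subset_closedSlab b)
  have hcell : ∀ {x}, x ∈ cell b → x ∈ closedSlab b := fun hx =>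
    slab_subset_closedSlab b (cell_subset_slab b hx)
  obtain ⟨B₁, hB₁⟩ := (isCompact_Icc.prod isCompact_Icc).exists_bound_of_continuousOn
    ((continuousOn_dotProduct hv.contDiff.continuousOn
      (hv.continuousOn_tpartial hb hT)).mono hprod)
  obtain ⟨B₂, hB₂⟩ := (isCompact_Icc.prod isCompact_Icc).exists_bound_of_continuousOn
    ((continuousOn_const (c := (1 / 2 : ℝ)).mul (continuousOn_dotProduct
      hv.contDiff.continuousOn hv.contDiff.continuousOn)).mono hprod)
  obtain ⟨M₁, hM₁⟩ := exists_bound_spartial_surfaceLift hb hT hχ (hη.of_le (by norm_num)) ht₁ 2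
  obtain ⟨M₂, hM₂⟩ := exists_bound_spartial_surfaceLift hb hT hχ hηt ht₁ 2
  refine hasDerivWithinAt_integral_of_dominated (K := Icc 0 t₁)
    (bound := fun _ => B₁ * (1 + M₁) + B₂ * M₂)
    (F := fun s x => 1 / 2 * (v s x ⬝ᵥ v s x) * jac b χ (η s) x)
    (F' := fun s x => (v s x ⬝ᵥ tpartial T (fun s => v s x) s) * jac b χ (η s) x
        + 1 / 2 * (v s x ⬝ᵥ v s x)
          * spartial b 2 (surfaceLift χ (fun y => tpartial T (fun s => η s y) s)) x)
    (convex_Icc _ _) hKI (Icc_mem_nhdsWithin_timeInterval hlt) ⟨ht.1, hlt.le⟩ ?_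
    (integrableOn_cell_const b _) ?_ ?_
  · intro s hs
    exact integrableOn_cell ((slabReg_half_dotProduct fun i =>
      (hv.spatial.slabReg_apply (hKI hs) i).of_le (by norm_num : 1 ≤ 2)).mul
      (regularFlattening hb hT hχ hη hJ (hKI hs)).slabReg_jac).contDiff.continuousOn
  · filter_upwards [ae_restrict_mem (measurableSet_cell b)] with x hx s hs
    have d := hv.hasDerivWithinAt hT (hKI hs) (hcell hx)
    refine ((((hasDerivWithinAt_dotProduct d d).const_mul (1 / 2)).mul
      (hasDerivWithinAt_jac hb hT hχ hη hJ (hKI hs) (hcell hx))).congr_deriv ?_)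
    rw [dotProduct_comm (tpartial T (fun s => v s x) s)]
    ring
  · filter_upwards [ae_restrict_mem (measurableSet_cell b)] with x hx s hs
    have hmem : (s, x) ∈ Icc 0 t₁ ×ˢ Icc (![0, 0, -b] : R3) (![1, 1, 0] : R3) :=
      mk_mem_prod hs (cell_subset_Icc b hx)
    have h1 := hB₁ _ hmem
    have h2 := hB₂ _ hmem
    refine (norm_add_le _ _).trans (add_le_add ?_ ?_)
    · rw [norm_mul, (regularFlattening hb hT hχ hη hJ (hKI hs)).jac_eq (hcell hx)]
      refine mul_le_mul h1 ((norm_add_le _ _).trans ?_) (norm_nonneg _) ((norm_nonneg _).trans h1)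
      rw [norm_one]
      gcongr
      exact hM₁ s hs x hx
    · rw [norm_mul]
      exact mul_le_mul h2 (hM₂ s hs x hx) (norm_nonneg _) ((norm_nonneg _).trans h2)

/-- The power balance of a velocity field `v` that is advected by the fluid velocity `u`: the motion
of the domain and the advection by `u` do not contribute, and the stress acts on `v` only through
its work on the upper boundary. -/
theorem bulk_energy_balance (hb : 0 < b) (hT : 0 < T) (hχ : IsCutoff b χ)
    (hη : RegularElevation T 5 η) (hJ : NonDegenerate b χ T η) (hu : SpatiallyRegular b T 1 u)
    (hkin : SolvesKinematic b χ T u η) (hv : RegularVelocity b T v)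
    (hq : SpatiallyRegular b T 1 q) (hv0 : ∀ t ∈ timeInterval T, ∀ y, v t (atHeight (-b) y) = 0)
    (ht : t ∈ timeInterval T) :
    ∃ K : ℝ, HasDerivWithinAt (fun s => kinetic b χ (η s) (v s)) K (timeInterval T) t ∧
      K + dissipation b χ (η t) (v t)
        = (∫ x in cell b, ((materialA b χ T η u v t x
              + matDivA b χ (η t) (stressA b χ (η t) (v t) (q t)) x) ⬝ᵥ v t x) * jac b χ (η t) x)
          + (∫ x in cell b, divA b χ (η t) (v t) x * q t x * jac b χ (η t) x)
          - ∫ y in square, v t (atHeight 0 y) ⬝ᵥ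
              (stressA b χ (η t) (v t) (q t) (atHeight 0 y) *ᵥ nuA b χ (η t) y) := by
  refine ⟨_, hasDerivWithinAt_kinetic hb hT hχ hη hJ hv ht, ?_⟩
  have hΦ := regularFlattening hb hT hχ hη hJ ht
  have hcell : ∀ {x}, x ∈ cell b → x ∈ closedSlab b := fun hx =>
    slab_subset_closedSlab b (cell_subset_slab b hx)
  set θ' := surfaceLift χ (fun y => tpartial T (fun s => η s y) t) with hθ'
  have hθ'1 : SlabReg b 1 θ' := slabReg_surfaceLift (n := 1) hT hχ (hη.tpartial hT) ht
  set a : R3 → R3 := fun x => tpartial T (fun s => v s x) t with ha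
  -- the velocity of the moving coordinates relative to the fluid
  set w : R3 → R3 := fun x => θ' x • e3 - u t x with hwdef
  have hv2 := fun i => hv.spatial.slabReg_apply ht i
  have hv1 := fun i => (hv2 i).of_le (by norm_num : 1 ≤ 2)
  have hu1 := fun i => hu.slabReg_apply ht i
  have hq1 := hq.slabReg ht
  have hw1 : ∀ i, SlabReg b 1 fun y => w y i := fun i =>
    (hθ'1.mul (SlabReg.const (e3 i))).sub (hu1 i)
  have hadv : ∀ x ∈ closedSlab b, materialA b χ T η u v t x
      = a x - advectA b χ (η t) (w x) (v t) x := by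
    intro x hx
    simp only [materialA]
    rw [tpartial_flattening hT hη ht hx]
    funext k
    simp only [advectA, Pi.add_apply, Pi.sub_apply, hwdef, ha, ← hθ', sub_mul,
      Finset.sum_sub_distrib]
    ring
  -- the relative velocity expands the volume element at the rate `∂ₜJ`
  have hdivw : ∀ x ∈ cell b, jac b χ (η t) x * divA b χ (η t) w x = spartial b 2 θ' x := by
    intro x hx
    have hx' := hcell hx
    have d1 := hθ'1.differentiableWithinAt le_rfl hx'
    have e : ∀ i, partialA b χ (η t) i (fun y => w y i) x
        = e3 i * partialA b χ (η t) i θ' x - partialA b χ (η t) i (fun y => u t y i) x := by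
      intro i
      refine (hΦ.partialA_sub (d1.mul_const (e3 i))
        ((hu1 i).differentiableWithinAt le_rfl hx') hx').trans ?_
      rw [hΦ.partialA_mul d1 (differentiableWithinAt_const _) hx']
      simp [partialA, spartial_const]
    have h0 := hkin.incompressible t ht x (cell_subset_slab b hx)
    simp only [divA] at h0 ⊢
    simp only [e, Finset.sum_sub_distrib, h0, sub_zero, Fin.sum_univ_three]
    rw [hΦ.partialA_two_eq hx']
    have := mul_inv_cancel₀ (hΦ.jac_pos x hx').ne'
    simp only [e3, Matrix.cons_val]
    linear_combination spartial b 2 θ' x * this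
  have hwν : ∀ y, w (atHeight 0 y) ⬝ᵥ nuA b χ (η t) y = 0 := by
    intro y
    rw [hwdef, sub_dotProduct, ← hkin.advection t ht y, smul_dotProduct, hθ',
      surfaceLift_tpartial_atHeight_zero hT hχ hη ht]
    have : e3 ⬝ᵥ nuA b χ (η t) y = 1 := by
      rw [← hΦ.nuA_two y]; simp [dotProduct, e3, Fin.sum_univ_three]
    rw [this]
    simp
  have ca : ContinuousOn a (closedSlab b) :=
    (hv.continuousOn_tpartial hb hT).comp (Continuous.prodMk_right t).continuousOn
      fun x hx => mk_mem_prod ht hx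
  have cv : ContinuousOn (v t) (closedSlab b) := (hv.spatial.contDiff t ht).continuousOn
  have cJ : ContinuousOn (jac b χ (η t)) (closedSlab b) := hΦ.slabReg_jac.contDiff.continuousOn
  have cD : ContinuousOn (fun x => 1 / 2 * (∑ i, ∑ j, symGradA b χ (η t) (v t) x i j ^ 2)
      * jac b χ (η t) x) (closedSlab b) :=
    (continuousOn_const.mul (continuousOn_finsetSum _ fun i _ => continuousOn_finsetSum _ fun j _ =>
      (hΦ.slabReg_symGradA hv2 i j).contDiff.continuousOn.pow 2)).mul cJ
  have cK : ContinuousOn (fun x => (v t x ⬝ᵥ a x) * jac b χ (η t) x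
      + 1 / 2 * (v t x ⬝ᵥ v t x) * spartial b 2 θ' x) (closedSlab b) :=
    ((continuousOn_dotProduct cv ca).mul cJ).add
      ((continuousOn_const.mul (continuousOn_dotProduct cv cv)).mul
        (hθ'1.spartial (n := 0) hb 2).contDiff.continuousOn)
  have cpart : ∀ {f : R3 → ℝ} (i), SlabReg b 1 f →
      ContinuousOn (partialA b χ (η t) i f) (closedSlab b) := fun i hf =>
    (hΦ.slabReg_partialA (n := 0) zero_le_one hf i).contDiff.continuousOn
  have cQ : ContinuousOn (fun x => divA b χ (η t) (v t) x * q t x * jac b χ (η t) x)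
      (closedSlab b) :=
    ((continuousOn_finsetSum _ fun i _ => cpart i (hv1 i)).mul hq1.contDiff.continuousOn).mul cJ
  have cF : ContinuousOn (fun x => jac b χ (η t) x
      * ∑ i, partialA b χ (η t) i (energyFlux b χ (η t) w (v t) (q t) i) x) (closedSlab b) :=
    cJ.mul (continuousOn_finsetSum _ fun i _ => cpart i (hΦ.slabReg_energyFlux hv2 hq1 hw1 i))
  have cM : ContinuousOn (fun x => ((a x - advectA b χ (η t) (w x) (v t) x
      + matDivA b χ (η t) (stressA b χ (η t) (v t) (q t)) x) ⬝ᵥ v t x) * jac b χ (η t) x)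
      (closedSlab b) := by
    refine (continuousOn_dotProduct ((ca.sub ?_).add ?_) cv).mul cJ
    · exact continuousOn_pi.2 fun i => continuousOn_finsetSum _ fun j _ =>
        ((hw1 j).contDiff.continuousOn).mul (cpart j (hv1 i))
    · exact continuousOn_pi.2 fun i => continuousOn_finsetSum _ fun j _ =>
        cpart j (hΦ.slabReg_stressA hv2 hq1 i j)
  have hM : (∫ x in cell b, ((materialA b χ T η u v t x
      + matDivA b χ (η t) (stressA b χ (η t) (v t) (q t)) x) ⬝ᵥ v t x) * jac b χ (η t) x)
      = ∫ x in cell b, ((a x - advectA b χ (η t) (w x) (v t) x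
      + matDivA b χ (η t) (stressA b χ (η t) (v t) (q t)) x) ⬝ᵥ v t x) * jac b χ (η t) x :=
    setIntegral_congr_fun (measurableSet_cell b) fun x hx => by
      simp only [hadv x (hcell hx)]
  rw [hM, sub_eq_add_neg, ← hΦ.integral_energyFlux hv2 hq1 hw1 (hv0 t ht) hwν, dissipation,
    ← integral_add (integrableOn_cell cK) (integrableOn_cell cD),
    ← integral_add (integrableOn_cell cM) (integrableOn_cell cQ),
    ← integral_add (integrableOn_cell (cM.fun_add cQ)) (integrableOn_cell cF)]
  refine setIntegral_congr_fun (measurableSet_cell b) fun x hx => ?_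
  have key := hΦ.local_energy_balance hv2 hq1 hw1 (hcell hx) (a x)
  rw [hdivw x hx] at key
  exact key

end Kinetic

/-! ### Traces on the upper boundary -/

theorem continuous_trace {F : Type*} [TopologicalSpace F] {b : ℝ} (hb : 0 < b) {w : R3 → F}
    (hw : ContinuousOn w (closedSlab b)) : Continuous fun y => w (atHeight 0 y) := by
  have hc : Continuous (atHeight 0) := by
    refine continuous_pi fun i => ?_
    fin_cases i
    exacts [continuous_apply 0, continuous_apply 1, continuous_const]
  exact hw.comp_continuous hc (atHeight_zero_mem hb)

theorem continuous_jetAdj {l : R2 → JetSpace →L[ℝ] ℝ} (hl : ContDiff ℝ 2 l) :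
    Continuous (jetAdj fun y => coords (l y)) := by
  have h1 := fun i => contDiff_coords_fst hl i
  have h2 := fun i j => contDiff_coords_snd hl i j
  refine Continuous.add (continuous_finsetSum _ fun i _ => ?_).neg
    (continuous_finsetSum _ fun i _ => continuous_finsetSum _ fun j _ => ?_)
  · exact (contDiff_hpartial (n := 1) (by norm_num; exact h1 i) i).continuous
  · exact (contDiff_hpartial (n := 0) (by
      simpa using contDiff_hpartial (n := 1) (by norm_num; exact h2 i j) j) i).continuous

theorem continuous_firstVar {T : EReal} (hT : 0 < T) {f : JetSpace → ℝ} (hf : ContDiff ℝ ∞ f)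
    {η : ℝ → R2 → ℝ} (hη : RegularElevation T 5 η) {t : ℝ} (ht : t ∈ timeInterval T) :
    Continuous (firstVar f (η t)) :=
  continuous_jetAdj (((hf.fderiv_right (m := ∞) (by simp)).of_le ENat.LEInfty.out).comp
    ((contDiff_slice (RegularElevation.contDiffOn_jet (n := 3) hT hη) ht).of_le (by norm_num)))

theorem continuous_secondVar {T : EReal} (hT : 0 < T) {f : JetSpace → ℝ} (hf : ContDiff ℝ ∞ f)
    {η ζ : ℝ → R2 → ℝ} (hη : RegularElevation T 5 η) (hζ : RegularElevation T 4 ζ) {t : ℝ}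
    (ht : t ∈ timeInterval T) : Continuous (secondVar f (η t) (ζ t)) :=
  continuous_jetAdj ((((contDiff_hess hf).of_le ENat.LEInfty.out).comp
    ((contDiff_slice (RegularElevation.contDiffOn_jet (n := 3) hT hη) ht).of_le
      (by norm_num))).clm_apply
    (contDiff_slice (RegularElevation.contDiffOn_jet (n := 2) hT hζ) ht))

namespace RegularFlattening

variable {b : ℝ} {χ : R3 → ℝ} {h : R2 → ℝ} {x : R3} {v : R3 → R3} {q : R3 → ℝ}

theorem continuous_nuA (hΦ : RegularFlattening b χ h) : Continuous (nuA b χ h) := by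
  refine continuous_pi fun i => ?_
  simp only [nuA_apply]
  exact continuous_trace (w := fun x => jac b χ h x * geo b χ h x i 2) hΦ.pos
    (hΦ.slabReg_jac.mul (hΦ.slabReg_geo i 2)).contDiff.continuousOn

theorem continuous_normal_stress (hΦ : RegularFlattening b χ h)
    (hv : ∀ i, SlabReg b 2 fun y => v y i) (hq : SlabReg b 1 q) :
    Continuous fun y => stressA b χ h v q (atHeight 0 y) *ᵥ nuA b χ h y :=
  Continuous.matrix_mulVec
    (continuous_matrix fun i j =>
      continuous_trace (w := fun x => stressA b χ h v q x i j) hΦ.pos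
        (hΦ.slabReg_stressA hv hq i j).contDiff.continuousOn)
    hΦ.continuous_nuA

/-- For a divergence-free velocity the divergence of the stress tensor is `∇^𝒜 q - Δ^𝒜 v`, because
the geometric derivatives commute. -/
theorem matDivA_stressA (hΦ : RegularFlattening b χ h) (hv : ∀ i, SlabReg b 2 fun y => v y i)
    (hq : SlabReg b 1 q) (hdiv : ∀ y ∈ slab b, divA b χ h v y = 0) (hx : x ∈ slab b) :
    matDivA b χ h (stressA b χ h v q) x = gradA b χ h q x - lapA b χ h v x := by
  have hx' := slab_subset_closedSlab b hx
  have dq := hq.differentiableWithinAt le_rfl hx'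
  have dP := fun i j => (hΦ.slabReg_partialA le_rfl (hv j) i).differentiableWithinAt le_rfl hx'
  have hdiv' : ∀ i, partialA b χ h i (divA b χ h v) x = 0 := by
    intro i
    have he : divA b χ h v =ᶠ[𝓝[closedSlab b] x] fun _ => 0 := by
      filter_upwards [mem_nhdsWithin_of_mem_nhds ((isOpen_slab b).mem_nhds hx)] with y hy
      exact hdiv y hy
    simp [partialA, spartial, he.fderivWithin_eq (hdiv x hx)]
  have hcomm : ∀ i, ∑ j, partialA b χ h j (partialA b χ h i fun y => v y j) x = 0 := by
    intro i
    rw [← hdiv' i]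
    simp only [fun j => hΦ.partialA_comm (hv j) hx' j i]
    exact (hΦ.partialA_sum _ (fun j _ => dP j j) hx').symm
  have e : ∀ i j, partialA b χ h j (fun y => stressA b χ h v q y i j) x
      = (1 : Matrix (Fin 3) (Fin 3) ℝ) i j * partialA b χ h j q x
        - (partialA b χ h j (partialA b χ h i fun y => v y j) x
          + partialA b χ h j (partialA b χ h j fun y => v y i) x) := by
    intro i j
    refine (hΦ.partialA_sub (dq.mul_const ((1 : Matrix (Fin 3) (Fin 3) ℝ) i j))
      ((dP i j).fun_add (dP j i)) hx').trans ?_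
    rw [hΦ.partialA_add (dP i j) (dP j i) hx',
      hΦ.partialA_mul dq (differentiableWithinAt_const _) hx']
    simp [partialA, spartial_const]
  funext i
  simp only [matDivA, e, Finset.sum_sub_distrib, Finset.sum_add_distrib, hcomm, zero_add,
    Matrix.one_apply, ite_mul, one_mul, zero_mul, Finset.sum_ite_eq, Finset.mem_univ, if_true]
  rfl

end RegularFlattening

/-! ### The energy-dissipation relations -/

theorem energy_dissipation_linear {b g : ℝ} (hb : 0 < b) {T : EReal} (hT : 0 < T) {χ : R3 → ℝ}
    (hχ : IsCutoff b χ) {f : JetSpace → ℝ} (hf : ContDiff ℝ ∞ f) {η : ℝ → R2 → ℝ}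
    (hη : RegularElevation T 5 η) (hJ : NonDegenerate b χ T η)
    {u v : ℝ → R3 → R3} {q : ℝ → R3 → ℝ} {ζ : ℝ → R2 → ℝ} {C1 : ℝ → R3 → R3} {C2 : ℝ → R3 → ℝ}
    {C3 : ℝ → R2 → R3} {C4 : ℝ → R2 → ℝ} (hu : SpatiallyRegular b T 1 u)
    (hv : RegularVelocity b T v) (hq : SpatiallyRegular b T 1 q) (hζ : RegularElevation T 4 ζ)
    (hkin : SolvesKinematic b χ T u η) (hL : SolvesLinear b g χ f T u η v q ζ C1 C2 C3 C4)
    {t : ℝ} (ht : t ∈ timeInterval T) :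
    ∃ E' : ℝ,
      HasDerivWithinAt (fun s => energy b g χ f (η s) (v s) (ζ s)) E' (timeInterval T) t ∧
      E' + dissipation b χ (η t) (v t)
        = pairing b g χ f T η t (v t) (q t) (ζ t) (C1 t) (C2 t) (C3 t) (C4 t) := by
  obtain ⟨K, hK, eK⟩ := bulk_energy_balance hb hT hχ hη hJ hu hkin hv hq hL.no_slip ht
  refine ⟨_, (hK.add (hasDerivWithinAt_quadW hT hf hη hζ ht)).add
    (hasDerivWithinAt_potential g hT (hζ.of_le (by norm_num)) ht), ?_⟩
  have hΦ := regularFlattening hb hT hχ hη hJ ht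
  have hv2 := fun i => hv.spatial.slabReg_apply ht i
  have e1 : (∫ x in cell b, ((materialA b χ T η u v t x
      + matDivA b χ (η t) (stressA b χ (η t) (v t) (q t)) x) ⬝ᵥ v t x) * jac b χ (η t) x)
      = ∫ x in cell b, (C1 t x ⬝ᵥ v t x) * jac b χ (η t) x :=
    setIntegral_congr_fun (measurableSet_cell b) fun x hx => by
      simp only [hL.momentum t ht x (cell_subset_slab b hx)]
  have e2 : (∫ x in cell b, divA b χ (η t) (v t) x * q t x * jac b χ (η t) x)
      = ∫ x in cell b, C2 t x * q t x * jac b χ (η t) x :=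
    setIntegral_congr_fun (measurableSet_cell b) fun x hx => by
      simp only [hL.divergence t ht x (cell_subset_slab b hx)]
  have cν := hΦ.continuous_nuA
  have cv : Continuous fun y => v t (atHeight 0 y) :=
    continuous_trace hb (hv.spatial.contDiff t ht).continuousOn
  have cT := hΦ.continuous_normal_stress hv2 (hq.slabReg ht)
  have cζ : Continuous (ζ t) := (hζ.contDiff_space ht).continuous
  have cS : Continuous (secondVar f (η t) (ζ t)) := continuous_secondVar hT hf hη hζ ht
  have cζt : Continuous fun y => tpartial T (fun s => ζ s y) t :=
    (RegularElevation.contDiff_space (n := 3) (hζ.tpartial hT) ht).continuous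
  have cvT := cv.dotProduct cT
  have cvν := cv.dotProduct cν
  have e3 : (∫ y in square, C3 t y ⬝ᵥ v t (atHeight 0 y))
      = ∫ y in square, ((secondVar f (η t) (ζ t) y + g * ζ t y)
          * (v t (atHeight 0 y) ⬝ᵥ nuA b χ (η t) y)
        - v t (atHeight 0 y) ⬝ᵥ
          (stressA b χ (η t) (v t) (q t) (atHeight 0 y) *ᵥ nuA b χ (η t) y)) := by
    refine integral_congr_ae (Filter.Eventually.of_forall fun y => ?_)
    beta_reduce
    rw [← hL.dynamic t ht y, sub_dotProduct, smul_dotProduct, smul_eq_mul,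
      dotProduct_comm (nuA b χ (η t) y), dotProduct_comm (_ *ᵥ _)]
  have e4 : (∫ y in square, C4 t y * (secondVar f (η t) (ζ t) y + g * ζ t y))
      = ∫ y in square, (tpartial T (fun s => ζ s y) t
          - v t (atHeight 0 y) ⬝ᵥ nuA b χ (η t) y)
        * (secondVar f (η t) (ζ t) y + g * ζ t y) := by
    refine integral_congr_ae (Filter.Eventually.of_forall fun y => ?_)
    beta_reduce
    rw [hL.kinematic t ht y]
  have e5 : (∫ y in square, secondVar f (η t) (ζ t) y * tpartial T (fun s => ζ s y) t)
        + (∫ y in square, g * ζ t y * tpartial T (fun s => ζ s y) t)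
      = (∫ y in square, C3 t y ⬝ᵥ v t (atHeight 0 y))
        + (∫ y in square, C4 t y * (secondVar f (η t) (ζ t) y + g * ζ t y))
        + ∫ y in square, v t (atHeight 0 y) ⬝ᵥ
          (stressA b χ (η t) (v t) (q t) (atHeight 0 y) *ᵥ nuA b χ (η t) y) := by
    rw [e3, e4, ← integral_add (integrableOn_square (by fun_prop))
        (integrableOn_square (by fun_prop)),
      ← integral_add (integrableOn_square (by fun_prop)) (integrableOn_square (by fun_prop)),
      ← integral_add (integrableOn_square (by fun_prop)) (integrableOn_square cvT)]
    refine integral_congr_ae (Filter.Eventually.of_forall fun y => ?_)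
    beta_reduce
    ring
  unfold pairing
  rw [e1, e2] at eK
  linarith

theorem energy_dissipation_zero {b g : ℝ} (hb : 0 < b) {T : EReal} (hT : 0 < T) {χ : R3 → ℝ}
    (hχ : IsCutoff b χ) {f : JetSpace → ℝ} (hf : ContDiff ℝ ∞ f) {η : ℝ → R2 → ℝ}
    (hη : RegularElevation T 5 η) (hJ : NonDegenerate b χ T η)
    {u : ℝ → R3 → R3} {p : ℝ → R3 → ℝ} (hu : RegularVelocity b T u)
    (hp : SpatiallyRegular b T 1 p) (hNS : SolvesNS b g χ f T u p η)
    {t : ℝ} (ht : t ∈ timeInterval T) :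
    ∃ E' : ℝ,
      HasDerivWithinAt (fun s => energyZero b g χ f (u s) (η s)) E' (timeInterval T) t ∧
      E' + dissipation b χ (η t) (u t) = 0 := by
  have hu1 : SpatiallyRegular b T 1 u :=
    ⟨hu.spatial.periodic, fun s hs => (hu.spatial.contDiff s hs).of_le (by norm_num)⟩
  obtain ⟨K, hK, eK⟩ := bulk_energy_balance hb hT hχ hη hJ hu1 hNS.kinematic hu hp
    hNS.kinematic.no_slip ht
  refine ⟨_, (hK.add (hasDerivWithinAt_surfEnergy hT hf hη ht)).add
    (hasDerivWithinAt_potential g hT (hη.of_le (by norm_num)) ht), ?_⟩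
  have hΦ := regularFlattening hb hT hχ hη hJ ht
  have hu2 := fun i => hu.spatial.slabReg_apply ht i
  have e1 : (∫ x in cell b, ((materialA b χ T η u u t x
      + matDivA b χ (η t) (stressA b χ (η t) (u t) (p t)) x) ⬝ᵥ u t x) * jac b χ (η t) x) = 0 :=
    setIntegral_eq_zero_of_forall_eq_zero fun x hx => by
      have hx' := cell_subset_slab b hx
      rw [hNS.momentum t ht x hx', hΦ.matDivA_stressA hu2 (hp.slabReg ht)
        (hNS.kinematic.incompressible t ht) hx']
      simp
  have e2 : (∫ x in cell b, divA b χ (η t) (u t) x * p t x * jac b χ (η t) x) = 0 :=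
    setIntegral_eq_zero_of_forall_eq_zero fun x hx => by
      rw [hNS.kinematic.incompressible t ht x (cell_subset_slab b hx)]
      simp
  have cη : Continuous (η t) := (hη.contDiff_space ht).continuous
  have cS : Continuous (firstVar f (η t)) := continuous_firstVar hT hf hη ht
  have cηt : Continuous fun y => tpartial T (fun s => η s y) t :=
    (RegularElevation.contDiff_space (n := 4) (hη.tpartial hT) ht).continuous
  have e3 : (∫ y in square, firstVar f (η t) y * tpartial T (fun s => η s y) t)
        + (∫ y in square, g * η t y * tpartial T (fun s => η s y) t)
      = ∫ y in square, u t (atHeight 0 y) ⬝ᵥ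
          (stressA b χ (η t) (u t) (p t) (atHeight 0 y) *ᵥ nuA b χ (η t) y) := by
    rw [← integral_add (integrableOn_square (by fun_prop)) (integrableOn_square (by fun_prop))]
    refine integral_congr_ae (Filter.Eventually.of_forall fun y => ?_)
    beta_reduce
    rw [hNS.dynamic t ht y, dotProduct_smul, hNS.kinematic.advection t ht y, smul_eq_mul]
    ring
  rw [e1, e2] at eK
  linarith

end FreeSurface

end

theorem mainTheorem4 (b g : ℝ) (hb : 0 < b) (T : EReal) (hT : 0 < T)
    (χ : FreeSurface.R3 → ℝ) (hχ : FreeSurface.IsCutoff b χ)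
    (f : FreeSurface.JetSpace → ℝ) (hf : ContDiff ℝ ∞ f)
    (η : ℝ → FreeSurface.R2 → ℝ) (hη : FreeSurface.RegularElevation T 5 η)
    (hJ : FreeSurface.NonDegenerate b χ T η) :
    (∀ (u v : ℝ → FreeSurface.R3 → FreeSurface.R3) (q : ℝ → FreeSurface.R3 → ℝ)
        (ζ : ℝ → FreeSurface.R2 → ℝ)
        (C1 : ℝ → FreeSurface.R3 → FreeSurface.R3) (C2 : ℝ → FreeSurface.R3 → ℝ)
        (C3 : ℝ → FreeSurface.R2 → FreeSurface.R3) (C4 : ℝ → FreeSurface.R2 → ℝ),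
        FreeSurface.SpatiallyRegular b T 1 u →
        FreeSurface.RegularVelocity b T v →
        FreeSurface.SpatiallyRegular b T 1 q →
        FreeSurface.RegularElevation T 4 ζ →
        FreeSurface.SolvesKinematic b χ T u η →
        FreeSurface.SolvesLinear b g χ f T u η v q ζ C1 C2 C3 C4 →
        ∀ t ∈ FreeSurface.timeInterval T,
          ∃ E' : ℝ,
            HasDerivWithinAt (fun s => FreeSurface.energy b g χ f (η s) (v s) (ζ s)) E'
              (FreeSurface.timeInterval T) t ∧
            E' + FreeSurface.dissipation b χ (η t) (v t)
              = FreeSurface.pairing b g χ f T η t (v t) (q t) (ζ t)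
                  (C1 t) (C2 t) (C3 t) (C4 t)) ∧
    (∀ (u : ℝ → FreeSurface.R3 → FreeSurface.R3) (p : ℝ → FreeSurface.R3 → ℝ),
        FreeSurface.RegularVelocity b T u →
        FreeSurface.SpatiallyRegular b T 1 p →
        FreeSurface.SolvesNS b g χ f T u p η →
        ∀ t ∈ FreeSurface.timeInterval T,
          ∃ E' : ℝ,
            HasDerivWithinAt (fun s => FreeSurface.energyZero b g χ f (u s) (η s)) E'
              (FreeSurface.timeInterval T) t ∧
            E' + FreeSurface.dissipation b χ (η t) (u t) = 0) := by
  exact ⟨fun _ _ _ _ _ _ _ _ hu hv hq hζ hkin hL _ ht =>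
      FreeSurface.energy_dissipation_linear hb hT hχ hf hη hJ hu hv hq hζ hkin hL ht,
    fun _ _ hu hp hNS _ ht => FreeSurface.energy_dissipation_zero hb hT hχ hf hη hJ hu hp hNS ht⟩
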